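/- **Asymptotic expansion of the Selberg–Mehta integral.** Let $\beta\geq 2$ be an even integer, let $\zeta_1\neq\zeta_2$ be complex numbers, let $V\in\mathbb{C}[X]$ and put $$V_0(z)=\frac{4}{(\zeta_2-\zeta_1)^2}\Big(z-\frac{\zeta_1+\zeta_2}{2}\Big)^2+V\Big(\frac{\zeta_1+\zeta_2}{2}\Big).$$ Let $\Gamma_0$ be the infinite straight line through $\zeta_1$ and $\zeta_2$, oriented from $\zeta_1$ to $\zeta_2$ and parametrised by $\gamma_0(x)=\zeta_1+x(\zeta_2-\zeta_1)$, $x\in\mathbb{R}$, and let $$\mathcal{Z}_{N,\Gamma_0}[V_0]=\int_{\Gamma_0^N}\prod_{a<b}(z_a-z_b)^\beta\prod_{k=1}^N e^{-N\beta V_0(z_k)}\,d\mathbf{z}.$$ This integral converges absolutely for every $N$. Let $\mathcal{P}(\Gamma_0)$ be the set of Borel probability measures on $\Gamma_0$. The energy $$\mathrm{I}_{\Gamma_0}[\mu]=\iint\Big(\ln\frac{1}{|z-w|}+\mathrm{Re}\,V_0(z)+\mathrm{Re}\,V_0(w)\Big)d\mu(z)\,d\mu(w)\in(-\infty,+\infty]$$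 has exactly one minimiser $\mu_{\Gamma_0}$ on $\mathcal{P}(\Gamma_0)$, the equilibrium measure; it is the image under $\gamma_0$ of the semicircle law $\frac{8}{\pi}\sqrt{x(1-x)}\,dx$ on $[0,1]$. Fix any determination $\lambda$ of $\ln(\zeta_2-\zeta_1)$. For $w\in\Gamma_0$ let $\ln(z-w)=\lambda+\mathrm{Log}\frac{z-w}{\zeta_2-\zeta_1}$ ($\mathrm{Log}$ the principal logarithm), whose cut is the part of $\Gamma_0$ that precedes $w$; let $g(z)=-\int\ln(z-w)\,d\mu_{\Gamma_0}(w)$ for $z\notin\Gamma_0$, let $g_\pm$ be its boundary values on $\Gamma_0$ from the left and from the right, and let $$\mathcal{I}_{\Gamma_0}[\mu_{\Gamma_0}]=\int\Big(\tfrac12 g_+(z)+\tfrac12 g_-(z)+2V_0(z)\Big)d\mu_{\Gamma_0}(z)$$ be the complex energy. Let $\frac{d\mu_{\Gamma_0}}{dz}$ be the (complex-valued, continuous) density of $\mu_{\Gamma_0}$ with respect to $dz=\gamma_0'(x)\,dx$; since $(\zeta_2-\zeta_1)\frac{d\mu_{\Gamma_0}}{dz}>0$ inside the support, its logarithm there is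 taken to be $\ln\big\{\frac{d\mu_{\Gamma_0}}{dz}\big\}=\mathrm{Log}\big((\zeta_2-\zeta_1)\frac{d\mu_{\Gamma_0}}{dz}\big)-\lambda$. The boundary values exist and the integrals converge. Then $\mathcal{Z}_{N,\Gamma_0}[V_0]\neq 0$ for every $N\geq 1$, and there are complex numbers $F_k(\beta,V_0)$, $k\geq -2$, such that, for a suitable determination of $\ln\mathcal{Z}_{N,\Gamma_0}[V_0]$ (not depending on $K$), for every $K\in\mathbb{N}$, as $N\to+\infty$, $$\ln\mathcal{Z}_{N,\Gamma_0}[V_0]=\frac{\beta}{2}N\ln N+\frac{3+\frac{\beta}{2}+\frac{2}{\beta}}{12}\ln N+\sum_{k=-2}^{K}\frac{F_k(\beta,V_0)}{N^k}+O(N^{-K-1}),$$ with $$F_{-2}(\beta,V_0)=-\frac{\beta}{2}\,\mathcal{I}_{\Gamma_0}[\mu_{\Gamma_0}],$$ $$F_{-1}(\beta,V_0)=\Big(\frac{\beta}{2}-1\Big)\Big[\int_{\Gamma_0}\ln\Big\{\frac{d\mu_{\Gamma_0}}{dz}(z)\Big\}\,d\mu_{\Gamma_0}(z)+\ln\frac{\beta}{2}\Big]+\frac{\beta}{2}\ln\frac{2\pi}{e}-\ln\Gamma\Big(\frac{\beta}{2}\Big).$$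 -/

import Mathlib

open MeasureTheory Filter Topology Set

noncomputable section

namespace SelbergExpansion

/-- The integrand of the complex partition function, pulled back by a parametrisation `γ` of the
contour: `∏_{a<b} (z_a - z_b)^β ∏_k e^{-N β V(z_k)} dz_k` with `z_k = γ (x_k)`. -/
def partitionIntegrand (β N : ℕ) (V : ℂ → ℂ) (γ : ℝ → ℂ) (x : Fin N → ℝ) : ℂ :=
  (∏ a : Fin N, ∏ b ∈ Finset.Ioi a, (γ (x a) - γ (x b)) ^ β) *
    ∏ k : Fin N, (Complex.exp (-((N : ℂ) * (β : ℂ) * V (γ (x k)))) * deriv γ (x k))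

/-- The complex partition function of the contour parametrised by `γ : ℝ → ℂ`. -/
def partitionFunction (β N : ℕ) (V : ℂ → ℂ) (γ : ℝ → ℂ) : ℂ :=
  ∫ x : Fin N → ℝ, partitionIntegrand β N V γ x

open Classical in
/-- `ln (1/|z-w|) + φ(z) + φ(w)` with `φ = Re V`, equal to `+∞` on the diagonal. -/
def energyKernel (V : ℂ → ℂ) (z w : ℂ) : EReal :=
  if z = w then ⊤
  else ((Real.log (1 / ‖z - w‖) + (V z).re + (V w).re : ℝ) : EReal)

/-- The weighted logarithmic energy `∬ (ln (1/|z-w|) + φ(z) + φ(w)) dμ(z) dμ(w)`, as the integral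
of the positive part minus the integral of the negative part. -/
def logEnergy (V : ℂ → ℂ) (μ : Measure ℂ) : EReal :=
  ((∫⁻ p, (energyKernel V p.1 p.2).toENNReal ∂(μ.prod μ) : ENNReal) : EReal) -
    ((∫⁻ p, (-energyKernel V p.1 p.2).toENNReal ∂(μ.prod μ) : ENNReal) : EReal)

/-- `μ` minimises the energy among the Borel probability measures carried by `Γ`. -/
structure IsEquilibriumMeasure (Γ : Set ℂ) (V : ℂ → ℂ) (μ : Measure ℂ) : Prop where
  isProbabilityMeasure : IsProbabilityMeasure μ
  compl_null : μ Γᶜ = 0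
  le_energy : ∀ ν : Measure ℂ, IsProbabilityMeasure ν → ν Γᶜ = 0 → logEnergy V μ ≤ logEnergy V ν

/-- The `g`-function `g[μ](z) = - ∫ ln (z-w) dμ(w)`, where `L z w` is the determination of
`ln (z-w)`. -/
def gFunction (L : ℂ → ℂ → ℂ) (μ : Measure ℂ) (z : ℂ) : ℂ :=
  -∫ w, L z w ∂μ

/-- `E` is the complex energy `∫ (g₊(z)/2 + g₋(z)/2 + 2 V(z)) dμ(z)` of `μ` on the contour
parametrised by `γ`. Here `g₊` and `g₋` are the boundary values of the `g`-function from the left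
and from the right of the oriented contour. The existence of the boundary values and the convergence
of the integrals are part of the assertion. -/
def HasComplexEnergy (γ : ℝ → ℂ) (L : ℂ → ℂ → ℂ) (V : ℂ → ℂ) (μ : Measure ℂ) (E : ℂ) : Prop :=
  (∀ z : ℂ, z ∉ range γ → Integrable (fun w => L z w) μ) ∧
  ∃ gp gm : ℂ → ℂ,
    (∀ t : ℝ, Tendsto (fun ε : ℝ => gFunction L μ (γ t + (ε : ℂ) * (Complex.I * deriv γ t)))
      (𝓝[>] 0) (𝓝 (gp (γ t)))) ∧
    (∀ t : ℝ, Tendsto (fun ε : ℝ => gFunction L μ (γ t - (ε : ℂ) * (Complex.I * deriv γ t)))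
      (𝓝[>] 0) (𝓝 (gm (γ t)))) ∧
    Integrable (fun z => 1 / 2 * gp z + 1 / 2 * gm z + 2 * V z) μ ∧
    E = ∫ z, (1 / 2 * gp z + 1 / 2 * gm z + 2 * V z) ∂μ

/-- `ρ` is the continuous density `dμ/dz` of `μ` with respect to the complex differential
`dz = γ'(t) dt` on the contour parametrised by `γ`. -/
structure IsDensityAlong (γ : ℝ → ℂ) (μ : Measure ℂ) (ρ : ℂ → ℂ) : Prop where
  continuousOn : ContinuousOn ρ (range γ)
  integrable : Integrable (fun t : ℝ => ρ (γ t) * deriv γ t)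
  measure_eq : ∀ s : Set ℂ, MeasurableSet s →
    (((μ s).toReal : ℝ) : ℂ) = ∫ t in γ ⁻¹' s, ρ (γ t) * deriv γ t

/-- `S = ∫ ln (dμ/dz) dμ` (minus the complex entropy), where `lg` is the determination of the
logarithm on the values of `dμ/dz`. -/
def HasLogDensityIntegral (γ : ℝ → ℂ) (lg : ℂ → ℂ) (μ : Measure ℂ) (S : ℂ) : Prop :=
  ∃ ρ : ℂ → ℂ, IsDensityAlong γ μ ρ ∧ Integrable (fun z => lg (ρ z)) μ ∧ S = ∫ z, lg (ρ z) ∂μ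

/-- The straight line through `ζ₁` and `ζ₂`, oriented from `ζ₁` to `ζ₂`. -/
def lineCurve (ζ₁ ζ₂ : ℂ) (x : ℝ) : ℂ := ζ₁ + (x : ℂ) * (ζ₂ - ζ₁)

/-- The quadratic potential `4 (z - m)² / (ζ₂ - ζ₁)² + V(m)` with `m = (ζ₁ + ζ₂) / 2`. -/
def quadraticPotential (V : Polynomial ℂ) (ζ₁ ζ₂ : ℂ) (z : ℂ) : ℂ :=
  4 / (ζ₂ - ζ₁) ^ 2 * (z - (ζ₁ + ζ₂) / 2) ^ 2 + V.eval ((ζ₁ + ζ₂) / 2)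

/-- The image on the segment `[ζ₁, ζ₂]` of the semicircle law `(8/π) √(x(1-x)) dx` on `[0,1]`. -/
def semicircleMeasure (ζ₁ ζ₂ : ℂ) : Measure ℂ :=
  ((volume.restrict (Icc (0 : ℝ) 1)).withDensity
    (fun x => ENNReal.ofReal (8 / Real.pi * √(x * (1 - x))))).map (lineCurve ζ₁ ζ₂)

/-- The determination of `ln (z-w)`, for `w` on the line, whose cut is the half-line of the line
that comes in from infinity and ends at `w`, normalised by `ln (ζ₂ - ζ₁) = lam`. -/
def lineLog (ζ₁ ζ₂ lam z w : ℂ) : ℂ := lam + Complex.log ((z - w) / (ζ₂ - ζ₁))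

/-- The determination of `ln u` on the ray `u (ζ₂ - ζ₁) > 0` (which contains the nonzero values of
`dμ/dz` for a positive measure on the line) that corresponds to `ln (ζ₂ - ζ₁) = lam`. -/
def lineDensityLog (ζ₁ ζ₂ lam u : ℂ) : ℂ := Complex.log (u * (ζ₂ - ζ₁)) - lam

theorem exp_lineLog {ζ₁ ζ₂ lam z w : ℂ} (hζ : ζ₁ ≠ ζ₂) (hlam : Complex.exp lam = ζ₂ - ζ₁)
    (h : z ≠ w) : Complex.exp (lineLog ζ₁ ζ₂ lam z w) = z - w := by
  have h1 : ζ₂ - ζ₁ ≠ 0 := sub_ne_zero.2 hζ.symm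
  have h2 : z - w ≠ 0 := sub_ne_zero.2 h
  rw [lineLog, Complex.exp_add, hlam, Complex.exp_log (div_ne_zero h2 h1)]
  field_simp

theorem exp_lineDensityLog {ζ₁ ζ₂ lam u : ℂ} (hζ : ζ₁ ≠ ζ₂)
    (hlam : Complex.exp lam = ζ₂ - ζ₁) (h : u ≠ 0) :
    Complex.exp (lineDensityLog ζ₁ ζ₂ lam u) = u := by
  have h1 : ζ₂ - ζ₁ ≠ 0 := sub_ne_zero.2 hζ.symm
  rw [lineDensityLog, Complex.exp_sub, hlam, Complex.exp_log (mul_ne_zero h h1)]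
  field_simp

end SelbergExpansion

end

/-! Write `β = 2m`. On a straight line every difference of points is a real multiple of `ζ₂ - ζ₁`
and the potential is a real quadratic plus a constant, so the partition function is an explicit
complex factor times Mehta's integral: the `2m`-th power of the Vandermonde product against the
Gaussian weight `exp (-8mNx²)` (`partitionFunction_lineCurve`). Mehta's integral is a product of
factorials, and the expansion is then a matter of Stirling's formula.

Mehta's integral is evaluated algebraically, with integration replaced by the functional on
polynomials that the moments define. For Gamma weights, integration by parts and symmetrisation give
Aomoto's recursion, which relates the parameters `a` and `a + 1`. At `a = 1` a total derivative
leaves a boundary term at `0`, which is an integral with one variable fewer and parameter `2m + 1`.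
The two relations determine the Laguerre integral; centred and rescaled Gamma moments tend to
Gaussian ones, which gives the Hermite case (`momentFunctional_gaussianMoment_evenVandermonde`).

The asymptotics rest on discrete integration: if the increments of a sequence, times `N²`, have an
expansion in powers of `1 / N`, so has the sequence (`hasInvExpansion_of_diff`). This is used for
`log N!` and then for the sum of the `log (jm)!`. The constant of the second summation enters only
`F 0` and need not be identified.

The equilibrium measure is found from its potential. With `x = cos² θ` the kernel splits into two
terms `log sin (θ ± α)`, and two Fourier integrals of `log sin` show that the potential is an
explicit quadratic on the support; a tangent-line estimate bounds it by the same quadratic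
elsewhere. Positivity of the logarithmic energy of a difference of probability measures
(`mutualLog_positive`) comes from Frullani's formula, which writes the logarithm as a superposition
of Gaussian kernels, and from characteristic functions. The two facts give minimality and uniqueness
(`integral_lineKernel_semicircleReal_le`).

The complex energy and the integral of the log-density are read off from the same potential and
agree with the coefficients of `N²` and `N`. -/

namespace SelbergExpansion

/-! ### Moment functionals on multivariate polynomials -/

section MomentFunctional

open MvPolynomial

/-- The linear functional on polynomials in `n` variables which sends a monomial to the product
of the moments `μ (c i)` of its exponents. -/
noncomputable def momentFunctional (μ : ℕ → ℝ) (n : ℕ) : MvPolynomial (Fin n) ℝ →ₗ[ℝ] ℝ :=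
  (MvPolynomial.basisMonomials (Fin n) ℝ).constr ℝ (fun c => ∏ i, μ (c i))

variable {μ ν : ℕ → ℝ} {n : ℕ}

theorem momentFunctional_monomial (c : Fin n →₀ ℕ) (r : ℝ) :
    momentFunctional μ n (monomial c r) = r * ∏ i, μ (c i) := by
  have h : monomial c r = r • (MvPolynomial.basisMonomials (Fin n) ℝ) c := by
    simp [MvPolynomial.smul_monomial]
  rw [h, map_smul, momentFunctional, Module.Basis.constr_basis, smul_eq_mul]

theorem momentFunctional_ext {A : MvPolynomial (Fin n) ℝ →ₗ[ℝ] ℝ}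
    {B : MvPolynomial (Fin n) ℝ →ₗ[ℝ] ℝ}
    (h : ∀ c : Fin n →₀ ℕ, A (monomial c 1) = B (monomial c 1)) (p : MvPolynomial (Fin n) ℝ) :
    A p = B p := by
  have : A = B := by
    refine (MvPolynomial.basisMonomials (Fin n) ℝ).ext fun c => ?_
    simpa using h c
  rw [this]

theorem momentFunctional_rename (e : Equiv.Perm (Fin n)) (p : MvPolynomial (Fin n) ℝ) :
    momentFunctional μ n (rename e p) = momentFunctional μ n p := by
  refine momentFunctional_ext
    (A := momentFunctional μ n ∘ₗ (rename e : _ →ₐ[ℝ] _).toLinearMap) (fun c => ?_) p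
  simp only [LinearMap.comp_apply, AlgHom.toLinearMap_apply, rename_monomial,
    momentFunctional_monomial, one_mul]
  rw [← Equiv.prod_comp e]
  refine Finset.prod_congr rfl fun i _ => ?_
  rw [Finsupp.mapDomain_apply e.injective]

/-- Integration by parts for the weight `x^(a-1) e^(-x)`: on monomials it is the recursion of the
moments, and both sides are linear. -/
theorem momentFunctional_X_mul {a : ℝ} (hμ : ∀ k, μ (k + 1) = (a + k) * μ k) (i : Fin n)
    (p : MvPolynomial (Fin n) ℝ) :
    momentFunctional μ n (X i * p) =
      a * momentFunctional μ n p + momentFunctional μ n (X i * pderiv i p) := by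
  have key := momentFunctional_ext
    (A := momentFunctional μ n ∘ₗ LinearMap.mulLeft ℝ (X i))
    (B := a • momentFunctional μ n +
      momentFunctional μ n ∘ₗ LinearMap.mulLeft ℝ (X i) ∘ₗ
        (pderiv i : Derivation ℝ (MvPolynomial (Fin n) ℝ) (MvPolynomial (Fin n) ℝ)).toLinearMap)
    (fun c => by
      simp only [LinearMap.comp_apply, LinearMap.mulLeft_apply, LinearMap.add_apply,
        LinearMap.smul_apply, Derivation.coeFn_coe,
        X_mul_pderiv_monomial, smul_eq_mul, map_nsmul]
      rw [nsmul_eq_mul, X, monomial_mul, momentFunctional_monomial, momentFunctional_monomial,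
        ← Finset.mul_prod_erase _ _ (Finset.mem_univ i),
        ← Finset.mul_prod_erase _ _ (Finset.mem_univ i)]
      have : ∏ x ∈ Finset.univ.erase i, μ ((Finsupp.single i 1 + c : Fin n →₀ ℕ) x) =
          ∏ x ∈ Finset.univ.erase i, μ (c x) := by
        refine Finset.prod_congr rfl fun x hx => ?_
        simp [(Finset.ne_of_mem_erase hx).symm]
      rw [this]
      simp only [Finsupp.add_apply, Finsupp.single_eq_same]
      rw [add_comm 1, hμ]
      ring) p
  simpa only [LinearMap.comp_apply, LinearMap.mulLeft_apply, LinearMap.add_apply,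
    LinearMap.smul_apply, Derivation.coeFn_coe, smul_eq_mul] using key

/-- Absorbs a power of the variables into the weight; `b` is the change of normalisation in each
variable. -/
theorem momentFunctional_prod_X_pow_mul (r : ℕ) (b : ℝ) (hμ : ∀ k, μ (k + r) = b * ν k)
    (p : MvPolynomial (Fin n) ℝ) :
    momentFunctional μ n ((∏ i, X i ^ r) * p) = b ^ n * momentFunctional ν n p := by
  refine momentFunctional_ext
    (A := momentFunctional μ n ∘ₗ LinearMap.mulLeft ℝ (∏ i, X i ^ r))
    (B := b ^ n • momentFunctional ν n) (fun c => ?_) p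
  have h : (∏ i, X i ^ r : MvPolynomial (Fin n) ℝ) =
      monomial (∑ i, Finsupp.single i r) 1 := by
    rw [monomial_sum_one]
    simp [X_pow_eq_monomial]
  simp only [LinearMap.comp_apply, LinearMap.mulLeft_apply, LinearMap.smul_apply, smul_eq_mul, h,
    monomial_mul, momentFunctional_monomial, one_mul, Finsupp.add_apply,
    Finsupp.finsetSum_apply]
  have : ∀ i, ∑ x : Fin n, (Finsupp.single x r) i = r := by
    intro i
    simp [Finsupp.single_apply]
  simp only [this, add_comm r, hμ, Finset.prod_mul_distrib, Finset.prod_const,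
    Finset.card_univ, Fintype.card_fin]

/-- The weight `e^(-x)` on the half-line does not vanish at `0`, so integration by parts in the
first variable leaves a boundary term, the substitution `X 0 = 0`. -/
theorem momentFunctional_eq_pderiv_add (hμ : ∀ k, μ (k + 1) = (k + 1) * μ k) (h0 : μ 0 = 1)
    (p : MvPolynomial (Fin (n + 1)) ℝ) :
    momentFunctional μ (n + 1) p = momentFunctional μ (n + 1) (pderiv 0 p) +
      momentFunctional μ n (aeval (Fin.cons 0 X : Fin (n + 1) → MvPolynomial (Fin n) ℝ) p) := by
  have key := momentFunctional_ext (A := momentFunctional μ (n + 1))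
    (B := momentFunctional μ (n + 1) ∘ₗ
        (pderiv 0 : Derivation ℝ (MvPolynomial (Fin (n + 1)) ℝ)
          (MvPolynomial (Fin (n + 1)) ℝ)).toLinearMap +
      momentFunctional μ n ∘ₗ
      (aeval (Fin.cons 0 X : Fin (n + 1) → MvPolynomial (Fin n) ℝ)).toLinearMap)
    (fun c => by
      have hae : aeval (Fin.cons 0 X : Fin (n + 1) → MvPolynomial (Fin n) ℝ) (monomial c (1 : ℝ)) =
          monomial (Finsupp.tail c) ((0 : ℝ) ^ (c 0)) := by
        rw [aeval_monomial, map_one, one_mul, Finsupp.prod_fintype _ _ (by simp),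
          Fin.prod_univ_succ,
          monomial_eq, Finsupp.prod_fintype _ _ (by simp)]
        simp [Finsupp.tail_apply]
      simp only [LinearMap.comp_apply, LinearMap.add_apply, Derivation.coeFn_coe,
        AlgHom.toLinearMap_apply, hae, pderiv_monomial,
        momentFunctional_monomial, Fin.prod_univ_succ, one_mul]
      have h2 : ∀ i : Fin n, (c - Finsupp.single (0 : Fin (n + 1)) 1 : Fin (n + 1) →₀ ℕ) i.succ =
          c i.succ := by
        intro i
        simp
      simp only [h2, Finsupp.tail_apply]
      rcases hc : c 0 with _ | k
      · simp [h0, hc]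
      · simp [hc, hμ]
        ring) p
  simpa only [LinearMap.comp_apply, LinearMap.add_apply, Derivation.coeFn_coe,
    AlgHom.toLinearMap_apply] using key

/-- The moment functional in one variable. -/
theorem momentFunctional_prod_aeval (q : Fin n → Polynomial ℝ) :
    momentFunctional μ n (∏ i, Polynomial.aeval (X i : MvPolynomial (Fin n) ℝ) (q i)) =
      ∏ i, (q i).sum (fun k r => r * μ k) := by
  simp only [Polynomial.aeval_eq_sum_range, Polynomial.sum_over_range _ (f := fun k r => r * μ k)
    (fun k => zero_mul _)]
  rw [Finset.prod_univ_sum, Finset.prod_univ_sum, map_sum]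
  refine Finset.sum_congr rfl fun x _ => ?_
  have : ∏ i, (q i).coeff (x i) • (X i : MvPolynomial (Fin n) ℝ) ^ x i =
      monomial (Finsupp.equivFunOnFinite.symm x) (∏ i, (q i).coeff (x i)) := by
    rw [monomial_eq, Finsupp.prod_fintype _ _ (by simp)]
    simp only [smul_eq_C_mul, Finset.prod_mul_distrib, map_prod,
      Finsupp.coe_equivFunOnFinite_symm]
  rw [this, momentFunctional_monomial, Finset.prod_mul_distrib]
  simp

/-- Push-forward under `x ↦ s x + t`; the hypothesis says that `ν` is the moment sequence of the
image. -/
theorem momentFunctional_aeval_linear (s t : ℝ)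
    (hν : ∀ k, ν k = ((Polynomial.C s * Polynomial.X + Polynomial.C t) ^ k).sum
      (fun k r => r * μ k)) (p : MvPolynomial (Fin n) ℝ) :
    momentFunctional μ n (aeval (fun i => (C s * X i + C t : MvPolynomial (Fin n) ℝ)) p) =
      momentFunctional ν n p := by
  have key := momentFunctional_ext (B := momentFunctional ν n)
    (A := momentFunctional μ n ∘ₗ
      (aeval (fun i => (C s * X i + C t : MvPolynomial (Fin n) ℝ))).toLinearMap)
    (fun c => by
      simp only [LinearMap.comp_apply, AlgHom.toLinearMap_apply, momentFunctional_monomial, hν]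
      rw [← momentFunctional_prod_aeval, aeval_monomial, map_one, one_mul, one_mul,
        Finsupp.prod_fintype _ _ (by simp)]
      refine congrArg _ (Finset.prod_congr rfl fun i _ => ?_)
      rw [map_pow, map_add, map_mul, Polynomial.aeval_C, Polynomial.aeval_C, Polynomial.aeval_X,
        MvPolynomial.algebraMap_eq]) p
  simpa only [LinearMap.comp_apply, AlgHom.toLinearMap_apply] using key

/-- A polynomial involves finitely many moments, so convergence of each moment is enough. -/
theorem tendsto_momentFunctional {ι : Type*} {l : Filter ι} {f : ι → ℕ → ℝ}
    (h : ∀ k, Tendsto (fun a => f a k) l (𝓝 (μ k))) (p : MvPolynomial (Fin n) ℝ) :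
    Tendsto (fun a => momentFunctional (f a) n p) l (𝓝 (momentFunctional μ n p)) := by
  induction p using MvPolynomial.induction_on' with
  | monomial c r =>
    simp only [momentFunctional_monomial]
    exact (tendsto_finsetProd _ fun i _ => h (c i)).const_mul r
  | add p q hp hq => simpa only [map_add] using hp.add hq

end MomentFunctional

/-! ### Even powers of the Vandermonde polynomial -/

section Vandermonde

open MvPolynomial

variable {m n : ℕ}

theorem derivation_prod {R A ι : Type*} [CommSemiring R] [CommSemiring A] [Algebra R A]
    [DecidableEq ι] (d : Derivation R A A) (s : Finset ι) (f : ι → A) :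
    d (∏ a ∈ s, f a) = ∑ a ∈ s, (∏ b ∈ s.erase a, f b) * d (f a) := by
  induction s using Finset.induction_on with
  | empty => simp
  | insert c s hc ih =>
    rw [Finset.prod_insert hc, d.leibniz, ih, Finset.sum_insert hc, Finset.erase_insert hc,
      smul_eq_mul, smul_eq_mul, add_comm, Finset.mul_sum]
    congr 1
    refine Finset.sum_congr rfl fun a ha => ?_
    have hac : c ≠ a := fun h => hc (h ▸ ha)
    rw [Finset.erase_insert_of_ne hac, Finset.prod_insert (fun h => hc (Finset.mem_of_mem_erase h)),
      mul_assoc]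

/-- The polynomial `∏_{a<b} (X_a - X_b)^(2m)`. -/
noncomputable def evenVandermonde (m n : ℕ) : MvPolynomial (Fin n) ℝ :=
  ∏ a : Fin n, ∏ b ∈ Finset.Ioi a, (X a - X b) ^ (2 * m)

/-- The polynomial `∏_{a≠b} (X_a - X_b)^m`. -/
noncomputable def offDiagProd (m n : ℕ) : MvPolynomial (Fin n) ℝ :=
  ∏ p : Fin n × Fin n, if p.1 = p.2 then 1 else (X p.1 - X p.2) ^ m

/-- The product over `a < b` is not visibly invariant under permutations, the one over `a ≠ b` is.
Pairing `(a, b)` with `(b, a)` shows that they differ by a sign, whose value is irrelevant. -/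
theorem evenVandermonde_eq_C_mul (m n : ℕ) :
    ∃ ε : ℝ, evenVandermonde m n = C ε * offDiagProd m n := by
  have h := Finset.prod_prod_Ioi_mul_eq_prod_prod_off_diag
    (fun j i : Fin n => (X i - X j : MvPolynomial (Fin n) ℝ) ^ m)
  have h1 : offDiagProd m n = ∏ i, ∏ j ∈ ({i}ᶜ : Finset (Fin n)),
      (X i - X j : MvPolynomial (Fin n) ℝ) ^ m := by
    rw [offDiagProd, Fintype.prod_prod_type]
    refine Finset.prod_congr rfl fun i _ => ?_
    simp only [Finset.prod_ite, Finset.prod_const_one, one_mul]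
    refine Finset.prod_congr ?_ fun _ _ => rfl
    ext j
    simp [eq_comm]
  have h2 : ∏ i : Fin n, ∏ j ∈ Finset.Ioi i,
      ((X i - X j : MvPolynomial (Fin n) ℝ) ^ m * (X j - X i) ^ m) =
      (∏ i : Fin n, ∏ j ∈ Finset.Ioi i, (-1) ^ m) * evenVandermonde m n := by
    rw [evenVandermonde, ← Finset.prod_mul_distrib]
    refine Finset.prod_congr rfl fun i _ => ?_
    rw [← Finset.prod_mul_distrib]
    refine Finset.prod_congr rfl fun j _ => ?_
    rw [← mul_pow, pow_mul, ← mul_pow]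
    congr 1
    ring
  refine ⟨∏ i : Fin n, ∏ j ∈ Finset.Ioi i, (-1) ^ m, ?_⟩
  rw [h1, ← h, h2, ← mul_assoc]
  simp only [map_prod, map_pow, map_neg, map_one, ← Finset.prod_mul_distrib, ← mul_pow]
  simp

theorem rename_offDiagProd (e : Equiv.Perm (Fin n)) :
    rename e (offDiagProd m n) = offDiagProd m n := by
  rw [offDiagProd, map_prod]
  conv_rhs => rw [← Equiv.prod_comp (e.prodCongr e)]
  refine Finset.prod_congr rfl fun p _ => ?_
  simp only [Equiv.prodCongr_apply, Prod.map_fst, Prod.map_snd, e.injective.eq_iff]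
  split_ifs <;> simp

theorem rename_evenVandermonde (e : Equiv.Perm (Fin n)) :
    rename e (evenVandermonde m n) = evenVandermonde m n := by
  obtain ⟨ε, h⟩ := evenVandermonde_eq_C_mul m n
  rw [h, map_mul, rename_offDiagProd, rename_C]

theorem X_sub_X_ne_zero {i j : Fin n} (h : i ≠ j) : (X i - X j : MvPolynomial (Fin n) ℝ) ≠ 0 :=
  sub_ne_zero.2 fun h' => h (X_injective h')

/-- The logarithmic derivative in `X i` is the sum of `2m / (X i - X j)`. To stay among polynomials,
the quotient by `X i - X j` is formed by lowering one exponent, which is possible as `m ≥ 1`. -/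
theorem exists_offDiagProd_quotients (hm : 1 ≤ m) (i : Fin n) :
    ∃ Q : Fin n → MvPolynomial (Fin n) ℝ,
      (∀ j, j ≠ i → (X i - X j) * Q j = offDiagProd m n) ∧
      pderiv i (offDiagProd m n) = C (2 * (m : ℝ)) * ∑ j ∈ Finset.univ.erase i, Q j := by
  set f : Fin n × Fin n → MvPolynomial (Fin n) ℝ :=
    fun p => if p.1 = p.2 then 1 else (X p.1 - X p.2) ^ m with hf
  set R : Fin n × Fin n → MvPolynomial (Fin n) ℝ :=
    fun p => (∏ q ∈ Finset.univ.erase p, f q) * (X p.1 - X p.2) ^ (m - 1) with hR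
  have hRmul : ∀ a b, a ≠ b → (X a - X b) * R (a, b) = offDiagProd m n := by
    intro a b hab
    rw [offDiagProd, ← Finset.mul_prod_erase _ _ (Finset.mem_univ (a, b))]
    simp only [hR, hab, if_false]
    rw [mul_comm (∏ q ∈ _, f q), ← mul_assoc, ← pow_succ', Nat.sub_add_cancel hm]
  have hRswap : ∀ a b, a ≠ b → R (b, a) = -R (a, b) := by
    intro a b hab
    refine mul_left_cancel₀ (X_sub_X_ne_zero hab) ?_
    have h1 := hRmul a b hab
    have h2 := hRmul b a hab.symm
    linear_combination h1 - h2
  refine ⟨fun j => R (i, j), fun j hj => hRmul i j hj.symm, ?_⟩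
  have hd : ∀ p : Fin n × Fin n, pderiv i (f p) = if p.1 = p.2 then 0 else
      C (m : ℝ) * (X p.1 - X p.2) ^ (m - 1) *
        ((if p.1 = i then 1 else 0) - (if p.2 = i then 1 else 0)) := by
    intro p
    simp only [hf]
    split_ifs with h <;> simp_all [pderiv_X]
  -- Only the pairs with first or second entry `i` depend on `X i`. By `hRswap` the two families
  -- contribute equally, whence the factor `2`.
  have hsum : ∀ p : Fin n × Fin n, (∏ q ∈ Finset.univ.erase p, f q) * pderiv i (f p) =
      (if p.1 = i then (if p.1 = p.2 then 0 else C (m : ℝ) * R p) else 0) -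
      (if p.2 = i then (if p.1 = p.2 then 0 else C (m : ℝ) * R p) else 0) := by
    intro p
    rw [hd]
    simp only [hR]
    split_ifs <;> ring
  have : offDiagProd m n = ∏ p, f p := rfl
  rw [this, derivation_prod, Finset.sum_congr rfl fun p _ => hsum p, Finset.sum_sub_distrib,
    Fintype.sum_prod_type, Fintype.sum_prod_type_right]
  simp only [Finset.sum_ite_irrel, Finset.sum_const_zero, Finset.sum_ite_eq', Finset.mem_univ,
    if_true]
  rw [← Finset.sum_sub_distrib, Finset.mul_sum, ← Finset.sum_erase_add _ _ (Finset.mem_univ i)]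
  simp only [if_true, sub_zero, add_zero]
  refine Finset.sum_congr rfl fun j hj => ?_
  have hji := Finset.ne_of_mem_erase hj
  rw [if_neg hji.symm, if_neg hji, hRswap i j hji.symm, map_mul]
  have : (C (2 : ℝ) : MvPolynomial (Fin n) ℝ) = 2 := rfl
  rw [this]
  ring

/-- The Vandermonde power is symmetric and `X i - X j` changes sign under the swap of `i` and `j`,
so the quotient is antisymmetric; all later cancellations come from this. -/
theorem exists_evenVandermonde_quotients (hm : 1 ≤ m) (i : Fin n) :
    ∃ Q : Fin n → MvPolynomial (Fin n) ℝ,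
      (∀ j, j ≠ i → (X i - X j) * Q j = evenVandermonde m n) ∧
      (∀ j, j ≠ i → rename (Equiv.swap i j) (Q j) = -Q j) ∧
      pderiv i (evenVandermonde m n) = C (2 * (m : ℝ)) * ∑ j ∈ Finset.univ.erase i, Q j := by
  obtain ⟨Q, hQ, hd⟩ := exists_offDiagProd_quotients hm i
  obtain ⟨ε, hε⟩ := evenVandermonde_eq_C_mul m n
  have h1 : ∀ j, j ≠ i → (X i - X j) * (C ε * Q j) = evenVandermonde m n := by
    intro j hj
    rw [hε, ← hQ j hj]
    ring
  refine ⟨fun j => C ε * Q j, h1, fun j hj => ?_, ?_⟩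
  · refine mul_left_cancel₀ (X_sub_X_ne_zero hj) ?_
    have h2 := congrArg (rename (Equiv.swap i j)) (h1 j hj)
    rw [rename_evenVandermonde, map_mul, map_sub, rename_X, rename_X, Equiv.swap_apply_left,
      Equiv.swap_apply_right, ← h1 j hj] at h2
    linear_combination h2
  · rw [hε, pderiv_C_mul, hd, ← Finset.mul_sum]
    ring

theorem pderiv_prod_X_of_notMem {S : Finset (Fin n)} {i : Fin n} (hi : i ∉ S) :
    pderiv i (∏ j ∈ S, X j : MvPolynomial (Fin n) ℝ) = 0 := by
  rw [derivation_prod]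
  refine Finset.sum_eq_zero fun j hj => ?_
  rw [pderiv_X_of_ne (ne_of_mem_of_not_mem hj hi), mul_zero]

/-- Aomoto's recursion for the Laguerre weight. -/
theorem momentFunctional_X_mul_prod_X_mul_evenVandermonde {μ : ℕ → ℝ} {a : ℝ} (hm : 1 ≤ m)
    (hμ : ∀ k, μ (k + 1) = (a + k) * μ k) {S : Finset (Fin n)} {i : Fin n} (hi : i ∉ S) :
    momentFunctional μ n (X i * ((∏ j ∈ S, X j) * evenVandermonde m n)) =
      (a + m * (n - 1 - S.card)) *
        momentFunctional μ n ((∏ j ∈ S, X j) * evenVandermonde m n) := by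
  obtain ⟨Q, hQ, hanti, hd⟩ := exists_evenVandermonde_quotients hm i
  set P : MvPolynomial (Fin n) ℝ := ∏ j ∈ S, X j with hP
  set Φ := momentFunctional μ n
  rw [momentFunctional_X_mul hμ, pderiv_mul, hd, pderiv_prod_X_of_notMem hi, zero_mul, zero_add]
  have h1 : X i * (P * (C (2 * (m : ℝ)) * ∑ j ∈ Finset.univ.erase i, Q j)) =
      (2 * (m : ℝ)) • ∑ j ∈ Finset.univ.erase i, X i * P * Q j := by
    rw [smul_eq_C_mul, ← Finset.mul_sum]
    ring
  -- Swap `i` and `j`. If `j ∈ S`, then `X i * P` is invariant and `Q j` antisymmetric, so the value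
  -- is `0`. Otherwise `X i * P * Q j` has the same value as `-X j * P * Q j`, hence half the value
  -- of `(X i - X j) * P * Q j`.
  have h2 : ∀ j ∈ Finset.univ.erase i, Φ (X i * P * Q j) =
      if j ∈ S then 0 else 1 / 2 * Φ (P * evenVandermonde m n) := by
    intro j hj
    have hji := Finset.ne_of_mem_erase hj
    have h3 := momentFunctional_rename (μ := μ) (Equiv.swap i j) (X i * P * Q j)
    rw [map_mul (rename _), map_mul (rename _), hanti j hji, rename_X,
      Equiv.swap_apply_left] at h3
    split_ifs with hjS
    · have h4 : (X j * rename (Equiv.swap i j) P : MvPolynomial (Fin n) ℝ) = X i * P := by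
        have h5 : (X i * P : MvPolynomial (Fin n) ℝ) = ∏ k ∈ insert i S, X k := by
          rw [Finset.prod_insert hi]
        have h6 : (X j * rename (Equiv.swap i j) P : MvPolynomial (Fin n) ℝ) =
            rename (Equiv.swap i j) (∏ k ∈ insert i S, X k) := by
          rw [← h5, map_mul, rename_X, Equiv.swap_apply_left]
        rw [h6, h5, map_prod]
        refine Finset.prod_equiv (Equiv.swap i j) (fun k => ?_) (fun k _ => by rw [rename_X])
        rcases eq_or_ne k i with rfl | hki
        · simp [hjS]
        · rcases eq_or_ne k j with rfl | hkj
          · simp [hjS]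
          · rw [Equiv.swap_apply_of_ne_of_ne hki hkj]
      rw [h4, mul_neg, map_neg] at h3
      change -Φ _ = Φ _ at h3
      linarith
    · have h4 : rename (Equiv.swap i j) P = P := by
        rw [hP, map_prod]
        refine Finset.prod_congr rfl fun k hk => ?_
        rw [rename_X, Equiv.swap_apply_of_ne_of_ne (ne_of_mem_of_not_mem hk hi)
          (ne_of_mem_of_not_mem hk hjS)]
      rw [h4] at h3
      change Φ _ = Φ _ at h3
      have h5 : P * evenVandermonde m n = X i * P * Q j + X j * P * -Q j := by
        rw [← hQ j hji]
        ring
      rw [h5, map_add, h3]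
      ring
  rw [h1, map_smul, map_sum, Finset.sum_congr rfl h2, Finset.sum_ite, Finset.sum_const_zero,
    zero_add, Finset.sum_const]
  have hcard : (((Finset.univ.erase i).filter (· ∉ S)).card : ℝ) = n - 1 - S.card := by
    have h3 : (Finset.univ.erase i).filter (· ∉ S) = (insert i S)ᶜ := by
      ext k
      simp
    rw [h3, Finset.card_compl, Fintype.card_fin, Nat.cast_sub
      (by simpa using Finset.card_le_univ (insert i S)), Finset.card_insert_of_notMem hi]
    push_cast
    ring
  rw [nsmul_eq_mul, hcard, smul_eq_mul]
  ring

theorem momentFunctional_prod_X_mul_evenVandermonde {μ : ℕ → ℝ} {a : ℝ} (hm : 1 ≤ m)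
    (hμ : ∀ k, μ (k + 1) = (a + k) * μ k) (S : Finset (Fin n)) :
    momentFunctional μ n ((∏ j ∈ S, X j) * evenVandermonde m n) =
      (∏ r ∈ Finset.range S.card, (a + m * (n - 1 - r))) *
        momentFunctional μ n (evenVandermonde m n) := by
  induction S using Finset.induction_on with
  | empty => simp
  | insert i S hi ih =>
    rw [Finset.prod_insert hi, mul_assoc,
      momentFunctional_X_mul_prod_X_mul_evenVandermonde hm hμ hi, ih,
      Finset.card_insert_of_notMem hi, Finset.prod_range_succ]
    ring

/-- The derivative is a sum of terms antisymmetric under a transposition, and the functional is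
symmetric. No recursion of the moments is involved. -/
theorem momentFunctional_pderiv_evenVandermonde {μ : ℕ → ℝ} (hm : 1 ≤ m) (i : Fin n) :
    momentFunctional μ n (pderiv i (evenVandermonde m n)) = 0 := by
  obtain ⟨Q, -, hanti, hd⟩ := exists_evenVandermonde_quotients hm i
  rw [hd, ← smul_eq_C_mul, map_smul, map_sum, Finset.sum_eq_zero, smul_zero]
  intro j hj
  have h := momentFunctional_rename (μ := μ) (Equiv.swap i j) (Q j)
  rw [hanti j (Finset.ne_of_mem_erase hj), map_neg] at h
  linarith

theorem aeval_cons_zero_evenVandermonde :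
    aeval (Fin.cons 0 X : Fin (n + 1) → MvPolynomial (Fin n) ℝ) (evenVandermonde m (n + 1)) =
      (∏ i, X i ^ (2 * m)) * evenVandermonde m n := by
  rw [evenVandermonde, Fin.prod_univ_succ, map_mul, map_prod, map_prod]
  congr 1
  · rw [Fin.prod_Ioi_zero]
    simp [(even_two_mul m).neg_pow]
  · refine Finset.prod_congr rfl fun i _ => ?_
    rw [map_prod, Fin.prod_Ioi_succ]
    simp

/-- Translation invariance, and homogeneity of degree `2m · n(n-1)/2`. -/
theorem aeval_linear_evenVandermonde (s t : ℝ) :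
    aeval (fun i => (C s * X i + C t : MvPolynomial (Fin n) ℝ)) (evenVandermonde m n) =
      C (s ^ (m * (n * (n - 1)))) * evenVandermonde m n := by
  have h : (C (s ^ (m * (n * (n - 1)))) : MvPolynomial (Fin n) ℝ) =
      ∏ a : Fin n, ∏ b ∈ Finset.Ioi a, C s ^ (2 * m) := by
    have h1 : ∑ a : Fin n, (Finset.Ioi a).card * (2 * m) = m * (n * (n - 1)) := by
      rw [← Finset.sum_mul]
      simp only [Fin.card_Ioi]
      rw [Fin.sum_univ_eq_sum_range (fun i => n - 1 - i), Finset.sum_range_reflect (fun i => i),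
        ← Finset.sum_range_id_mul_two]
      ring
    simp only [Finset.prod_const, ← pow_mul, Finset.prod_pow_eq_pow_sum, map_pow]
    rw [← h1]
    refine congrArg _ (Finset.sum_congr rfl fun a _ => mul_comm _ _)
  rw [h, evenVandermonde, ← Finset.prod_mul_distrib, map_prod]
  refine Finset.prod_congr rfl fun a _ => ?_
  rw [← Finset.prod_mul_distrib, map_prod]
  refine Finset.prod_congr rfl fun b _ => ?_
  rw [map_pow, map_sub, aeval_X, aeval_X, ← mul_pow]
  congr 1
  ring

end Vandermonde

/-! ### The Laguerre and Hermite cases of Selberg's integral -/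

section Mehta

open MvPolynomial

/-- The moments of the normalised Gamma distribution of parameter `a`. -/
noncomputable def gammaMoment (a : ℝ) (k : ℕ) : ℝ := (ascPochhammer ℝ k).eval a

theorem gammaMoment_zero (a : ℝ) : gammaMoment a 0 = 1 := by simp [gammaMoment]

theorem gammaMoment_succ (a : ℝ) (k : ℕ) :
    gammaMoment a (k + 1) = (a + k) * gammaMoment a k := by
  rw [gammaMoment, ascPochhammer_succ_eval, mul_comm]
  rfl

theorem gammaMoment_succ_left (a : ℝ) (k : ℕ) :
    gammaMoment a (k + 1) = a * gammaMoment (a + 1) k := by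
  simp [gammaMoment, ascPochhammer_succ_left]

theorem gammaMoment_one_add (r k : ℕ) :
    gammaMoment 1 (k + r) = r.factorial * gammaMoment ((r : ℝ) + 1) k := by
  induction k with
  | zero => simp [gammaMoment]
  | succ k ih =>
    rw [Nat.add_right_comm, gammaMoment_succ, ih, gammaMoment_succ]
    push_cast
    ring

theorem factorial_mul_gammaMoment (r k : ℕ) :
    (r.factorial : ℝ) * gammaMoment ((r : ℝ) + 1) k = (k + r).factorial := by
  rw [← gammaMoment_one_add, gammaMoment, ascPochhammer_eval_one]

variable {m : ℕ}

/-- The product of all variables times the Vandermonde power is evaluated twice: absorbed into the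
weight it raises the parameter, and Aomoto's recursion with `S` everything gives the linear factors.
-/
theorem pow_mul_momentFunctional_gammaMoment (hm : 1 ≤ m) (n : ℕ) (a : ℝ) :
    a ^ n * momentFunctional (gammaMoment (a + 1)) n (evenVandermonde m n) =
      (∏ j ∈ Finset.range n, (a + m * j)) *
        momentFunctional (gammaMoment a) n (evenVandermonde m n) := by
  rw [← momentFunctional_prod_X_pow_mul (μ := gammaMoment a) 1 a (gammaMoment_succ_left a)]
  have h := momentFunctional_prod_X_mul_evenVandermonde hm (gammaMoment_succ a)
    (Finset.univ : Finset (Fin n))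
  simp only [pow_one]
  rw [h, Finset.card_univ, Fintype.card_fin, ← Finset.prod_range_reflect]
  congr 1
  refine Finset.prod_congr rfl fun j hj => ?_
  have : j + 1 ≤ n := Finset.mem_range.1 hj
  rw [Nat.sub_sub, add_comm 1 j, Nat.cast_sub this]
  push_cast
  ring

/-- For `a = 1` the derivative term drops out and the boundary term carries `∏ X i ^ (2m)`, which
turns the exponential weight into that of parameter `2m + 1`. -/
theorem momentFunctional_gammaMoment_one_succ (hm : 1 ≤ m) (n : ℕ) :
    momentFunctional (gammaMoment 1) (n + 1) (evenVandermonde m (n + 1)) =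
      ((2 * m).factorial : ℝ) ^ n *
        momentFunctional (gammaMoment ((2 * m : ℕ) + 1 : ℝ)) n (evenVandermonde m n) := by
  rw [momentFunctional_eq_pderiv_add (fun k => by rw [gammaMoment_succ, add_comm (1 : ℝ)])
    (gammaMoment_zero 1), momentFunctional_pderiv_evenVandermonde hm, zero_add,
    aeval_cons_zero_evenVandermonde,
    momentFunctional_prod_X_pow_mul (2 * m) _ (gammaMoment_one_add (2 * m))]

/-- The Laguerre case of Selberg's integral. -/
theorem momentFunctional_gammaMoment_evenVandermonde (hm : 1 ≤ m) (n a : ℕ) :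
    momentFunctional (gammaMoment (a + 1)) n (evenVandermonde m n) =
      (∏ j ∈ Finset.range n, ((((j + 1) * m).factorial : ℝ) / m.factorial)) *
        ∏ j ∈ Finset.range n, gammaMoment (a + 1) (j * m) := by
  -- The step in `n` takes place at parameter `1` and calls for parameter `2m + 1` in `n` variables,
  -- hence the generalisation; the inner induction then raises the parameter by one at a time.
  induction n generalizing a with
  | zero =>
    have : evenVandermonde m 0 = monomial 0 1 := by simp [evenVandermonde]
    rw [this, momentFunctional_monomial]
    simp
  | succ n ihn =>
    induction a with
    | zero =>
      have hf : ∀ k, gammaMoment ((0 : ℕ) + 1) k = k.factorial := by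
        intro k
        have := factorial_mul_gammaMoment 0 k
        simpa using this
      have h1 : ((2 * m).factorial : ℝ) ^ n *
          ∏ j ∈ Finset.range n, gammaMoment ((2 * m : ℕ) + 1) (j * m) =
          ∏ j ∈ Finset.range n, (((j + 2) * m).factorial : ℝ) := by
        rw [← Finset.card_range n, ← Finset.prod_const, Finset.card_range,
          ← Finset.prod_mul_distrib]
        refine Finset.prod_congr rfl fun j _ => ?_
        rw [factorial_mul_gammaMoment, add_mul]
      have h2 := Finset.prod_range_succ' (fun j => (((j + 1) * m).factorial : ℝ)) n
      have h3 := Finset.prod_range_succ (fun j => (((j + 1) * m).factorial : ℝ)) n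
      have h4 := Finset.prod_range_succ' (fun j => ((j * m).factorial : ℝ)) n
      have h5 : (m.factorial : ℝ) ≠ 0 := by positivity
      have h0 : gammaMoment ((0 : ℕ) + 1) = gammaMoment 1 := by simp
      simp only [hf]
      rw [h0, momentFunctional_gammaMoment_one_succ hm, ihn, mul_left_comm, h1, h4,
        Finset.prod_range_succ]
      simp only [zero_mul, Nat.factorial_zero, Nat.cast_one, mul_one, zero_add, one_mul] at h2 ⊢
      have h6 : ∏ j ∈ Finset.range n, (((j + 2) * m).factorial : ℝ) =
          (∏ j ∈ Finset.range n, (((j + 1) * m).factorial : ℝ)) *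
            (((n + 1) * m).factorial : ℝ) / m.factorial := by
        rw [eq_div_iff h5, ← h3, h2]
      rw [h6]
      ring
    | succ a iha =>
      have h := pow_mul_momentFunctional_gammaMoment hm (n + 1) ((a : ℝ) + 1)
      have ha : (a : ℝ) + 1 ≠ 0 := by positivity
      rw [iha] at h
      push_cast
      refine mul_left_cancel₀ (pow_ne_zero (n + 1) ha) ?_
      rw [h, mul_left_comm, mul_left_comm (((a : ℝ) + 1) ^ (n + 1))]
      congr 1
      have hc : ((a : ℝ) + 1) ^ (n + 1) = ∏ j ∈ Finset.range (n + 1), ((a : ℝ) + 1) := by simp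
      rw [hc, ← Finset.prod_mul_distrib, ← Finset.prod_mul_distrib]
      refine Finset.prod_congr rfl fun j _ => ?_
      rw [← gammaMoment_succ_left, gammaMoment_succ]
      push_cast
      ring

/-- The moments of the standard normal distribution. -/
noncomputable def gaussianMoment : ℕ → ℝ
  | 0 => 1
  | 1 => 0
  | k + 2 => (k + 1) * gaussianMoment k

/-- The moments of the Gamma distribution of parameter `a` after an affine change of variable. -/
noncomputable def affineGammaMoment (a s t : ℝ) (k : ℕ) : ℝ :=
  ((Polynomial.C s * Polynomial.X + Polynomial.C t) ^ k).sum (fun k r => r * gammaMoment a k)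

theorem affineGammaMoment_zero (a s t : ℝ) : affineGammaMoment a s t 0 = 1 := by
  rw [affineGammaMoment, pow_zero, ← Polynomial.C_1, Polynomial.sum_C_index (by simp)]
  simp [gammaMoment_zero]

/-- The hypotheses normalise the Gamma law to variance `1` and mean `0`. Integration by parts then
gives the Gaussian recursion plus a term with the factor `s`, which is lost as `s → 0`. For `k = 0`
the truncated index `k - 1` has coefficient `0`. -/
theorem affineGammaMoment_succ {a s t : ℝ} (h1 : a * s ^ 2 = 1) (h2 : t = -(a * s)) (k : ℕ) :
    affineGammaMoment a s t (k + 1) =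
      k * affineGammaMoment a s t (k - 1) + s * k * affineGammaMoment a s t k := by
  set l : Polynomial ℝ →ₗ[ℝ] ℝ :=
    Polynomial.lsum (fun k => LinearMap.mulRight ℝ (gammaMoment a k)) with hl
  set y : Polynomial ℝ := Polynomial.C s * Polynomial.X + Polynomial.C t with hy
  have hly : ∀ k, affineGammaMoment a s t k = l (y ^ k) := fun k => rfl
  have hibp : ∀ q : Polynomial ℝ, l (Polynomial.X * q) =
      a * l q + l (Polynomial.X * Polynomial.derivative q) := by
    intro q
    induction q using Polynomial.induction_on' with
    | add p q hp hq =>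
      rw [mul_add, map_add, hp, hq, Polynomial.derivative_add, mul_add, map_add, map_add]
      ring
    | monomial k r =>
      have hm : ∀ k r, l (Polynomial.monomial k r) = r * gammaMoment a k := by
        intro k r
        rw [hl, Polynomial.lsum_apply, Polynomial.sum_monomial_index _ _ (by simp)]
        rfl
      rw [Polynomial.X_mul_monomial, Polynomial.derivative_monomial, Polynomial.X_mul_monomial,
        hm, hm, hm, gammaMoment_succ]
      rcases k with _ | k
      · simp
        ring
      · rw [Nat.add_sub_cancel]
        ring
  rw [hly, hly, hly]
  have hsm : ∀ (r : ℝ) (q : Polynomial ℝ), l (Polynomial.C r * q) = r * l q := by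
    intro r q
    rw [← Polynomial.smul_eq_C_mul, map_smul, smul_eq_mul]
  have e1 : y ^ (k + 1) = Polynomial.C s * (Polynomial.X * y ^ k) + Polynomial.C t * y ^ k := by
    rw [pow_succ, hy]
    ring
  have hdy : Polynomial.derivative y = Polynomial.C s := by simp [hy]
  rw [e1, map_add, hsm, hsm, hibp, Polynomial.derivative_pow, hdy]
  rcases k with _ | k
  · simp [h2]
    ring
  · have e2 : Polynomial.X * (Polynomial.C (((k + 1 : ℕ) : ℝ)) * y ^ (k + 1 - 1) *
        Polynomial.C s) =
        Polynomial.C ((k : ℝ) + 1) * (y ^ (k + 1) + Polynomial.C (-t) * y ^ k) := by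
      rw [pow_succ, Nat.add_sub_cancel, hy]
      simp only [map_neg]
      push_cast
      ring
    rw [e2, hsm, map_add, hsm, Nat.add_sub_cancel, h2]
    push_cast
    linear_combination ((k : ℝ) + 1) * l (y ^ k) * h1

/-- The central limit theorem for Gamma laws, at the level of moments: the recursion passes to the
limit. -/
theorem tendsto_affineGammaMoment (k : ℕ) :
    Tendsto (fun N : ℕ => affineGammaMoment ((N : ℝ) + 1) (1 / √((N : ℝ) + 1))
      (-(((N : ℝ) + 1) * (1 / √((N : ℝ) + 1)))) k) atTop (𝓝 (gaussianMoment k)) := by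
  have hs : Tendsto (fun N : ℕ => 1 / √((N : ℝ) + 1)) atTop (𝓝 0) := by
    have h1 : Tendsto (fun N : ℕ => √((N : ℝ) + 1)) atTop atTop :=
      Real.tendsto_sqrt_atTop.comp (tendsto_atTop_add_const_right _ _ tendsto_natCast_atTop_atTop)
    simpa [Function.comp_def] using tendsto_inv_atTop_zero.comp h1
  have hrec : ∀ N k : ℕ, _ := fun N k => affineGammaMoment_succ (a := (N : ℝ) + 1)
    (s := 1 / √((N : ℝ) + 1)) (by
      rw [div_pow, one_pow, Real.sq_sqrt (by positivity)]
      field_simp) rfl k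
  induction k using Nat.strong_induction_on with
  | _ k ih =>
    rcases k with _ | _ | k
    · simp [affineGammaMoment_zero, gaussianMoment]
    · refine (tendsto_const_nhds (x := (0 : ℝ))).congr fun N => ?_
      rw [hrec N 0]
      simp
    · refine Tendsto.congr (fun N => (hrec N (k + 1)).symm) ?_
      rw [gaussianMoment]
      have h1 := (ih k (by omega)).const_mul ((k : ℝ) + 1)
      have h2 := (hs.mul_const ((k : ℝ) + 1)).mul (ih (k + 1) (by omega))
      simpa using h1.add h2

theorem tendsto_gammaMoment_mul_pow (k : ℕ) :
    Tendsto (fun N : ℕ => gammaMoment ((N : ℝ) + 1) k * (1 / ((N : ℝ) + 1)) ^ k) atTop (𝓝 1) := by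
  induction k with
  | zero => simp [gammaMoment_zero]
  | succ k ih =>
    have h := (((tendsto_one_div_add_atTop_nhds_zero_nat (𝕜 := ℝ)).const_mul (k : ℝ)).const_add
      1).mul ih
    simp only [mul_zero, add_zero, one_mul] at h
    refine h.congr fun N => ?_
    rw [gammaMoment_succ, pow_succ]
    have : (N : ℝ) + 1 ≠ 0 := by positivity
    field_simp

/-- Mehta's integral, as an identity for the moments of the standard normal distribution. -/
theorem momentFunctional_gaussianMoment_evenVandermonde (hm : 1 ≤ m) (n : ℕ) :
    momentFunctional gaussianMoment n (evenVandermonde m n) =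
      ∏ j ∈ Finset.range n, ((((j + 1) * m).factorial : ℝ) / m.factorial) := by
  have h1 := tendsto_momentFunctional tendsto_affineGammaMoment (evenVandermonde m n)
  refine tendsto_nhds_unique h1 ?_
  -- As `j` sums to `n(n-1)/2`, the scaling factor splits into `(N+1)^(-jm)`, one for each rising
  -- factorial of the Laguerre formula, and each quotient tends to `1`.
  have h2 : Tendsto (fun N : ℕ => ∏ j ∈ Finset.range n,
      (gammaMoment ((N : ℝ) + 1) (j * m) * (1 / ((N : ℝ) + 1)) ^ (j * m))) atTop
      (𝓝 (∏ j ∈ Finset.range n, 1)) :=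
    tendsto_finsetProd _ fun j _ => tendsto_gammaMoment_mul_pow (j * m)
  have h3 := h2.const_mul (∏ j ∈ Finset.range n, ((((j + 1) * m).factorial : ℝ) / m.factorial))
  rw [Finset.prod_const_one, mul_one] at h3
  refine h3.congr fun N => ?_
  rw [← momentFunctional_aeval_linear (μ := gammaMoment ((N : ℝ) + 1))
    (ν := affineGammaMoment _ _ _) _ _ (fun k => rfl),
    aeval_linear_evenVandermonde, ← smul_eq_C_mul, map_smul, smul_eq_mul,
    momentFunctional_gammaMoment_evenVandermonde hm, Finset.prod_mul_distrib]
  have h4 : ∏ j ∈ Finset.range n, (1 / ((N : ℝ) + 1)) ^ (j * m) =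
      (1 / √((N : ℝ) + 1)) ^ (m * (n * (n - 1))) := by
    rw [Finset.prod_pow_eq_pow_sum, ← Finset.sum_mul, mul_comm (∑ i ∈ Finset.range n, i) m,
      ← Finset.sum_range_id_mul_two, mul_comm _ 2, mul_left_comm, pow_mul _ 2, div_pow _ _ 2,
      one_pow, Real.sq_sqrt (by positivity)]
  rw [h4]
  ring

end Mehta

/-! ### The partition function of the quadratic potential -/

section Gaussian

open MvPolynomial

variable {b : ℝ}

theorem integrable_pow_mul_exp_neg_mul_sq (hb : 0 < b) (k : ℕ) :
    Integrable fun x : ℝ => x ^ k * Real.exp (-b * x ^ 2) := by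
  have h := integrable_rpow_mul_exp_neg_mul_sq hb (s := k)
    (lt_of_lt_of_le (by norm_num) (Nat.cast_nonneg k))
  simpa only [Real.rpow_natCast] using h

/-- Integrating the derivative of `x^(k+1) exp (-b x²)` to zero gives the recursion of
`gaussianMoment`, with standard deviation `1 / √(2b)`. -/
theorem integral_pow_mul_exp_neg_mul_sq (hb : 0 < b) (k : ℕ) :
    ∫ x : ℝ, x ^ k * Real.exp (-b * x ^ 2) =
      √(Real.pi / b) * ((1 / √(2 * b)) ^ k * gaussianMoment k) := by
  have hexp : ∀ x : ℝ, HasDerivAt (fun x : ℝ => Real.exp (-b * x ^ 2))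
      (Real.exp (-b * x ^ 2) * (-b * (2 * x))) x := by
    intro x
    have := ((hasDerivAt_pow 2 x).const_mul (-b)).exp
    simpa using this
  induction k using Nat.strong_induction_on with
  | _ k ih =>
    rcases k with _ | _ | k
    · simpa [gaussianMoment] using integral_gaussian b
    · have h := integral_eq_zero_of_hasDerivAt_of_integrable hexp
        (by
          have := (integrable_pow_mul_exp_neg_mul_sq hb 1).const_mul (-2 * b)
          refine this.congr (ae_of_all _ fun x => ?_)
          simp only
          ring) (by simpa using integrable_pow_mul_exp_neg_mul_sq hb 0)
      have h2 : ∫ x : ℝ, Real.exp (-b * x ^ 2) * (-b * (2 * x)) =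
          (-2 * b) * ∫ x : ℝ, x ^ (0 + 1) * Real.exp (-b * x ^ 2) := by
        rw [← integral_const_mul]
        refine integral_congr_ae (ae_of_all _ fun x => ?_)
        simp only
        ring
      rw [h2] at h
      simp only [gaussianMoment, mul_zero]
      exact (mul_eq_zero.1 h).resolve_left (by linarith)
    · have hd : ∀ x : ℝ, HasDerivAt (fun x : ℝ => x ^ (k + 1) * Real.exp (-b * x ^ 2))
          (((k : ℝ) + 1) * (x ^ k * Real.exp (-b * x ^ 2)) -
            2 * b * (x ^ (k + 2) * Real.exp (-b * x ^ 2))) x := by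
        intro x
        refine ((hasDerivAt_pow (k + 1) x).mul (hexp x)).congr_deriv ?_
        push_cast
        ring
      have i1 := (integrable_pow_mul_exp_neg_mul_sq hb k).const_mul ((k : ℝ) + 1)
      have i2 := (integrable_pow_mul_exp_neg_mul_sq hb (k + 2)).const_mul (2 * b)
      have h := integral_eq_zero_of_hasDerivAt_of_integrable hd (i1.sub i2)
        (integrable_pow_mul_exp_neg_mul_sq hb (k + 1))
      rw [integral_sub i1 i2, integral_const_mul, integral_const_mul, ih k (by omega)] at h
      have hs : (1 / √(2 * b)) ^ 2 * (2 * b) = 1 := by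
        rw [div_pow, one_pow, Real.sq_sqrt (by positivity)]
        field_simp
      rw [gaussianMoment]
      refine mul_left_cancel₀ (show 2 * b ≠ 0 by positivity) ?_
      rw [show k + 1 + 1 = k + 2 from rfl, pow_add]
      linear_combination -h - √(Real.pi / b) * (1 / √(2 * b)) ^ k * (k + 1) *
        gaussianMoment k * hs

theorem integrable_eval_mul_prod_exp (hb : 0 < b) {n : ℕ} (p : MvPolynomial (Fin n) ℝ) :
    Integrable fun x : Fin n → ℝ => eval x p * ∏ i, Real.exp (-b * x i ^ 2) := by
  induction p using MvPolynomial.induction_on' with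
  | monomial c r =>
    have h := (Integrable.fintype_prod (μ := fun _ : Fin n => (volume : Measure ℝ))
      (f := fun i x => x ^ c i * Real.exp (-b * x ^ 2))
      fun i => integrable_pow_mul_exp_neg_mul_sq hb (c i)).const_mul r
    refine h.congr (ae_of_all _ fun x => ?_)
    simp only [eval_monomial]
    rw [Finsupp.prod_fintype _ _ (by simp), Finset.prod_mul_distrib, mul_assoc]
  | add p q hp hq =>
    simp only [map_add, add_mul]
    exact hp.add hq

theorem integral_eval_mul_prod_exp (hb : 0 < b) {n : ℕ} (p : MvPolynomial (Fin n) ℝ) :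
    ∫ x : Fin n → ℝ, eval x p * ∏ i, Real.exp (-b * x i ^ 2) =
      momentFunctional (fun k => √(Real.pi / b) * ((1 / √(2 * b)) ^ k * gaussianMoment k)) n p := by
  induction p using MvPolynomial.induction_on' with
  | monomial c r =>
    rw [momentFunctional_monomial]
    simp only [← integral_pow_mul_exp_neg_mul_sq hb]
    rw [← integral_fintype_prod_volume_eq_prod, ← integral_const_mul]
    refine integral_congr_ae (ae_of_all _ fun x => ?_)
    simp only [eval_monomial]
    rw [Finsupp.prod_fintype _ _ (by simp), Finset.prod_mul_distrib, mul_assoc]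
  | add p q hp hq =>
    simp only [map_add, add_mul]
    rw [integral_add (integrable_eval_mul_prod_exp hb p) (integrable_eval_mul_prod_exp hb q),
      hp, hq]

/-- **Mehta's integral** for an even exponent `2m`. -/
theorem integral_evenVandermonde_mul_prod_exp (hb : 0 < b) {m : ℕ} (hm : 1 ≤ m) (n : ℕ) :
    ∫ x : Fin n → ℝ, eval x (evenVandermonde m n) * ∏ i, Real.exp (-b * x i ^ 2) =
      √(Real.pi / b) ^ n * ((1 / √(2 * b)) ^ (m * (n * (n - 1))) *
        ∏ j ∈ Finset.range n, ((((j + 1) * m).factorial : ℝ) / m.factorial)) := by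
  rw [integral_eval_mul_prod_exp hb]
  -- Taking `r = 0` extracts the total mass from each variable; `h2` then treats the standard
  -- deviation as a dilation.
  have h1 := momentFunctional_prod_X_pow_mul
    (μ := fun k => √(Real.pi / b) * ((1 / √(2 * b)) ^ k * gaussianMoment k))
    (ν := fun k => (1 / √(2 * b)) ^ k * gaussianMoment k) 0 (√(Real.pi / b)) (fun k => rfl)
    (evenVandermonde m n)
  have h2 := momentFunctional_aeval_linear (μ := gaussianMoment)
    (ν := fun k => (1 / √(2 * b)) ^ k * gaussianMoment k) (1 / √(2 * b)) 0 (fun k => by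
      rw [map_zero, add_zero, mul_pow, ← map_pow, Polynomial.C_mul_X_pow_eq_monomial,
        Polynomial.sum_monomial_index _ _ (by simp)]) (evenVandermonde m n)
  simp only [pow_zero, Finset.prod_const_one, one_mul] at h1
  rw [h1, ← h2, aeval_linear_evenVandermonde, ← smul_eq_C_mul, map_smul, smul_eq_mul,
    momentFunctional_gaussianMoment_evenVandermonde hm]

end Gaussian

/-! ### Reduction of the contour integral to Mehta's integral. -/

section Partition

variable {m : ℕ} {ζ₁ ζ₂ : ℂ} {V : Polynomial ℂ}

theorem hasDerivAt_lineCurve (ζ₁ ζ₂ : ℂ) (x : ℝ) :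
    HasDerivAt (lineCurve ζ₁ ζ₂) (ζ₂ - ζ₁) x := by
  have h : HasDerivAt (fun y : ℝ => (y : ℂ)) 1 x := Complex.ofRealCLM.hasDerivAt
  have h1 := (h.mul_const (ζ₂ - ζ₁)).const_add ζ₁
  rwa [one_mul] at h1

theorem deriv_lineCurve (ζ₁ ζ₂ : ℂ) (x : ℝ) : deriv (lineCurve ζ₁ ζ₂) x = ζ₂ - ζ₁ :=
  (hasDerivAt_lineCurve ζ₁ ζ₂ x).deriv

theorem lineCurve_sub (ζ₁ ζ₂ : ℂ) (x y : ℝ) :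
    lineCurve ζ₁ ζ₂ x - lineCurve ζ₁ ζ₂ y = ((x - y : ℝ) : ℂ) * (ζ₂ - ζ₁) := by
  simp only [lineCurve]
  push_cast
  ring

theorem quadraticPotential_lineCurve (hζ : ζ₁ ≠ ζ₂) (x : ℝ) :
    quadraticPotential V ζ₁ ζ₂ (lineCurve ζ₁ ζ₂ x) =
      ((4 * (x - 1 / 2) ^ 2 : ℝ) : ℂ) + V.eval ((ζ₁ + ζ₂) / 2) := by
  have h : ζ₂ - ζ₁ ≠ 0 := sub_ne_zero.2 hζ.symm
  have h1 : lineCurve ζ₁ ζ₂ x - (ζ₁ + ζ₂) / 2 = ((x : ℂ) - 1 / 2) * (ζ₂ - ζ₁) := by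
    simp only [lineCurve]
    ring
  rw [quadraticPotential, h1]
  push_cast
  field_simp

/-- All complex quantities leave the integrand as constants. The Gaussian rate is `4Nβ = 8mN`,
centred at the midpoint `1 / 2`. -/
theorem partitionIntegrand_lineCurve (hζ : ζ₁ ≠ ζ₂) (m N : ℕ) (x : Fin N → ℝ) :
    partitionIntegrand (2 * m) N (quadraticPotential V ζ₁ ζ₂) (lineCurve ζ₁ ζ₂) x =
      (ζ₂ - ζ₁) ^ (m * (N * (N - 1))) *
        (Complex.exp (-(2 * m * N * V.eval ((ζ₁ + ζ₂) / 2))) * (ζ₂ - ζ₁)) ^ N *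
      ((MvPolynomial.eval (x - fun _ => 1 / 2) (evenVandermonde m N) *
        ∏ i, Real.exp (-(8 * m * N) * (x - fun _ => 1 / 2 : Fin N → ℝ) i ^ 2) : ℝ) : ℂ) := by
  have h1 : ∏ a : Fin N, ∏ b ∈ Finset.Ioi a,
      (lineCurve ζ₁ ζ₂ (x a) - lineCurve ζ₁ ζ₂ (x b)) ^ (2 * m) =
      (ζ₂ - ζ₁) ^ (m * (N * (N - 1))) *
        ((MvPolynomial.eval (x - fun _ => 1 / 2) (evenVandermonde m N) : ℝ) : ℂ) := by
    have hs : ∑ a : Fin N, (2 * m) * (Finset.Ioi a).card = m * (N * (N - 1)) := by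
      rw [← Finset.mul_sum]
      simp only [Fin.card_Ioi]
      rw [Fin.sum_univ_eq_sum_range (fun i => N - 1 - i), Finset.sum_range_reflect (fun i => i),
        ← Finset.sum_range_id_mul_two]
      ring
    rw [← hs, ← Finset.prod_pow_eq_pow_sum, evenVandermonde]
    simp only [map_prod, map_pow, map_sub, MvPolynomial.eval_X, Complex.ofReal_prod,
      Complex.ofReal_pow]
    rw [← Finset.prod_mul_distrib]
    refine Finset.prod_congr rfl fun a _ => ?_
    rw [pow_mul, ← Finset.prod_const, ← Finset.prod_mul_distrib]
    refine Finset.prod_congr rfl fun b _ => ?_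
    rw [lineCurve_sub, mul_pow, mul_comm]
    simp
  have h2 : ∏ k : Fin N, (Complex.exp (-((N : ℂ) * ((2 * m : ℕ) : ℂ) *
      quadraticPotential V ζ₁ ζ₂ (lineCurve ζ₁ ζ₂ (x k)))) * deriv (lineCurve ζ₁ ζ₂) (x k)) =
      (Complex.exp (-(2 * m * N * V.eval ((ζ₁ + ζ₂) / 2))) * (ζ₂ - ζ₁)) ^ N *
        ((∏ i, Real.exp (-(8 * m * N) * (x - fun _ => 1 / 2 : Fin N → ℝ) i ^ 2) : ℝ) : ℂ) := by
    have hc : (Complex.exp (-(2 * m * N * V.eval ((ζ₁ + ζ₂) / 2))) * (ζ₂ - ζ₁)) ^ N =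
        ∏ _k : Fin N, (Complex.exp (-(2 * m * N * V.eval ((ζ₁ + ζ₂) / 2))) * (ζ₂ - ζ₁)) := by
      simp
    rw [hc, Complex.ofReal_prod, ← Finset.prod_mul_distrib]
    refine Finset.prod_congr rfl fun k _ => ?_
    rw [deriv_lineCurve, quadraticPotential_lineCurve hζ, Complex.ofReal_exp,
      mul_right_comm (Complex.exp (-(2 * m * N * _))), ← Complex.exp_add]
    congr 2
    simp only [Pi.sub_apply]
    push_cast
    ring
  rw [partitionIntegrand, h1, h2, Complex.ofReal_mul]
  ring

theorem integrable_partitionIntegrand_lineCurve (hζ : ζ₁ ≠ ζ₂) (hm : 1 ≤ m) (N : ℕ) :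
    Integrable (partitionIntegrand (2 * m) N (quadraticPotential V ζ₁ ζ₂)
      (lineCurve ζ₁ ζ₂)) := by
  -- For `N = 0` the Gaussian rate vanishes, but the domain is a single point.
  rcases N.eq_zero_or_pos with rfl | hN
  · rw [Measure.volume_pi_eq_dirac 0]
    exact integrable_dirac (by simp)
  · have hb : (0 : ℝ) < 8 * m * N := by positivity
    rw [funext (partitionIntegrand_lineCurve hζ m N)]
    exact ((integrable_eval_mul_prod_exp hb (evenVandermonde m N)).comp_sub_right
      (fun _ => 1 / 2)).ofReal.const_mul _

theorem partitionFunction_lineCurve (hζ : ζ₁ ≠ ζ₂) (hm : 1 ≤ m) {N : ℕ} (hN : 1 ≤ N) :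
    partitionFunction (2 * m) N (quadraticPotential V ζ₁ ζ₂) (lineCurve ζ₁ ζ₂) =
      (ζ₂ - ζ₁) ^ (m * (N * (N - 1))) *
        (Complex.exp (-(2 * m * N * V.eval ((ζ₁ + ζ₂) / 2))) * (ζ₂ - ζ₁)) ^ N *
      ((√(Real.pi / (8 * m * N)) ^ N * ((1 / √(2 * (8 * m * N))) ^ (m * (N * (N - 1))) *
        ∏ j ∈ Finset.range N, ((((j + 1) * m).factorial : ℝ) / m.factorial)) : ℝ) : ℂ) := by
  have hb : (0 : ℝ) < 8 * m * N := by positivity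
  rw [partitionFunction, funext (partitionIntegrand_lineCurve hζ m N), integral_const_mul]
  congr 1
  rw [integral_complex_ofReal, ← integral_evenVandermonde_mul_prod_exp hb hm]
  congr 1
  exact integral_sub_right_eq_self (fun y : Fin N → ℝ =>
    MvPolynomial.eval y (evenVandermonde m N) * ∏ i, Real.exp (-(8 * m * N) * y i ^ 2))
    (fun _ => 1 / 2)

end Partition

/-! ### Sequences with an asymptotic expansion in powers of `1 / N` -/

section Expansion

open Asymptotics

/-- The sequence `f` has an asymptotic expansion to all orders in nonnegative powers of `1 / N`. -/
def HasInvExpansion (f : ℕ → ℝ) : Prop :=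
  ∀ K : ℕ, ∃ p : Polynomial ℝ,
    (fun N : ℕ => f N - p.eval (1 / (N : ℝ))) =O[atTop] fun N : ℕ => (1 / (N : ℝ)) ^ K

theorem tendsto_eval_one_div (p : Polynomial ℝ) :
    Tendsto (fun N : ℕ => p.eval (1 / (N : ℝ))) atTop (𝓝 (p.coeff 0)) := by
  rw [Polynomial.coeff_zero_eq_eval_zero]
  exact (p.continuous.tendsto 0).comp (tendsto_const_div_atTop_nhds_zero_nat 1)

theorem tendsto_of_isBigO_one_div_pow {f : ℕ → ℝ} {K : ℕ}
    (h : f =O[atTop] fun N : ℕ => (1 / (N : ℝ)) ^ (K + 1)) : Tendsto f atTop (𝓝 0) := by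
  refine h.trans_tendsto ?_
  simpa using (tendsto_const_div_atTop_nhds_zero_nat (1 : ℝ)).pow (K + 1)

theorem isBigO_natCast_mul {f : ℕ → ℝ} {K : ℕ}
    (h : f =O[atTop] fun N : ℕ => (1 / (N : ℝ)) ^ (K + 1)) :
    (fun N : ℕ => (N : ℝ) * f N) =O[atTop] fun N : ℕ => (1 / (N : ℝ)) ^ K := by
  refine ((isBigO_refl (fun N : ℕ => (N : ℝ)) atTop).mul h).congr' EventuallyEq.rfl ?_
  filter_upwards [eventually_gt_atTop 0] with N hN
  have : (N : ℝ) ≠ 0 := by positivity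
  rw [pow_succ]
  field_simp

namespace HasInvExpansion

variable {f g : ℕ → ℝ}

theorem congr (hf : HasInvExpansion f) (h : f =ᶠ[atTop] g) : HasInvExpansion g := by
  intro K
  obtain ⟨p, hp⟩ := hf K
  exact ⟨p, hp.congr' (h.mono fun N hN => by simp only [hN]) EventuallyEq.rfl⟩

theorem eval (p : Polynomial ℝ) : HasInvExpansion fun N => p.eval (1 / (N : ℝ)) := fun K =>
  ⟨p, by simpa using isBigO_zero _ _⟩

theorem const (c : ℝ) : HasInvExpansion fun _ => c := by
  simpa using HasInvExpansion.eval (Polynomial.C c)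

theorem one_div : HasInvExpansion fun N => 1 / (N : ℝ) := by
  simpa using HasInvExpansion.eval Polynomial.X

theorem add (hf : HasInvExpansion f) (hg : HasInvExpansion g) :
    HasInvExpansion fun N => f N + g N := by
  intro K
  obtain ⟨p, hp⟩ := hf K
  obtain ⟨q, hq⟩ := hg K
  refine ⟨p + q, (hp.add hq).congr_left fun N => ?_⟩
  rw [Polynomial.eval_add]
  ring

theorem isBigO_one (hf : HasInvExpansion f) : f =O[atTop] fun _ => (1 : ℝ) := by
  obtain ⟨p, hp⟩ := hf 0
  have h := (tendsto_eval_one_div p).isBigO_one ℝ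
  simpa using (hp.congr_right fun N => pow_zero _).add h

theorem mul (hf : HasInvExpansion f) (hg : HasInvExpansion g) :
    HasInvExpansion fun N => f N * g N := by
  intro K
  obtain ⟨p, hp⟩ := hf K
  obtain ⟨q, hq⟩ := hg K
  refine ⟨p * q, ?_⟩
  have h1 := hp.mul hg.isBigO_one
  have h2 := ((tendsto_eval_one_div p).isBigO_one ℝ).mul hq
  simp only [mul_one, one_mul] at h1 h2
  refine (h1.add h2).congr_left fun N => ?_
  rw [Polynomial.eval_mul]
  ring

theorem const_mul (hf : HasInvExpansion f) (c : ℝ) : HasInvExpansion fun N => c * f N :=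
  (const c).mul hf

theorem sub (hf : HasInvExpansion f) (hg : HasInvExpansion g) :
    HasInvExpansion fun N => f N - g N :=
  (hf.add (hg.const_mul (-1))).congr (Eventually.of_forall fun N => by ring)

theorem pow (hf : HasInvExpansion f) (k : ℕ) : HasInvExpansion fun N => f N ^ k := by
  induction k with
  | zero => simpa using const 1
  | succ k ih => simpa only [pow_succ] using ih.mul hf

theorem comp_mul (hf : HasInvExpansion f) {m : ℕ} (hm : 1 ≤ m) :
    HasInvExpansion fun N => f (N * m) := by
  intro K
  obtain ⟨p, hp⟩ := hf K
  have ht : Tendsto (fun N : ℕ => N * m) atTop atTop :=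
    tendsto_id.atTop_mul_const' (by omega)
  refine ⟨p.comp (Polynomial.C (1 / (m : ℝ)) * Polynomial.X), ?_⟩
  have h1 := hp.comp_tendsto ht
  refine (h1.congr_left fun N => ?_).trans ?_
  · simp only [Function.comp_apply, Polynomial.eval_comp, Polynomial.eval_mul, Polynomial.eval_C,
      Polynomial.eval_X, Nat.cast_mul]
    rw [one_div_mul_one_div, mul_comm (m : ℝ)]
  · refine (isBigO_const_mul_self ((1 / (m : ℝ)) ^ K) (fun N : ℕ => (1 / (N : ℝ)) ^ K) _).congr_left
      fun N => ?_
    simp only [Function.comp_apply, Nat.cast_mul]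
    rw [← mul_pow, one_div_mul_one_div, mul_comm (m : ℝ)]

theorem exists_tendsto (hf : HasInvExpansion f) : ∃ c, Tendsto f atTop (𝓝 c) := by
  obtain ⟨p, hp⟩ := hf 1
  refine ⟨p.coeff 0, ?_⟩
  simpa using (tendsto_of_isBigO_one_div_pow (K := 0) hp).add (tendsto_eval_one_div p)

/-- Shifts an expansion by one order: the constant coefficient of the approximating polynomial has
to be the limit, and the rest is divisible by `X`. -/
theorem natCast_mul_sub (hf : HasInvExpansion f) {c : ℝ} (hc : Tendsto f atTop (𝓝 c)) :
    HasInvExpansion fun N => N * (f N - c) := by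
  intro K
  obtain ⟨p, hp⟩ := hf (K + 1)
  have h0 : p.coeff 0 = c := by
    refine tendsto_nhds_unique ?_ hc
    simpa using (tendsto_of_isBigO_one_div_pow hp).add (tendsto_eval_one_div p)
  refine ⟨p.divX, (isBigO_natCast_mul hp).congr' ?_ EventuallyEq.rfl⟩
  filter_upwards [eventually_gt_atTop 0] with N hN
  have hN' : (N : ℝ) ≠ 0 := by positivity
  have h1 : p.eval (1 / (N : ℝ)) = p.divX.eval (1 / (N : ℝ)) * (1 / N) + c := by
    conv_lhs => rw [← Polynomial.divX_mul_X_add p]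
    simp [h0]
  rw [h1]
  field_simp
  ring

/-- The coefficients of the expansion do not depend on the order. -/
theorem exists_coeff (hf : HasInvExpansion f) :
    ∃ c : ℕ → ℝ, ∀ K : ℕ, (fun N : ℕ => f N - ∑ k ∈ Finset.range K, c k / (N : ℝ) ^ k) =O[atTop]
      fun N : ℕ => (1 / (N : ℝ)) ^ K := by
  -- The coefficients are successive limits: subtract the limit, multiply by `N`, and repeat. The
  -- order `K` plays no part in this.
  choose! l hl using fun g : ℕ → ℝ => exists_tendsto (f := g)
  let F : ℕ → ℕ → ℝ := fun k =>
    Nat.rec (motive := fun _ => ℕ → ℝ) f (fun _ g N => (N : ℝ) * (g N - l g)) k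
  have hF0 : F 0 = f := rfl
  have hFs : ∀ k, F (k + 1) = fun N : ℕ => (N : ℝ) * (F k N - l (F k)) := fun k => rfl
  have hF : ∀ k, HasInvExpansion (F k) := by
    intro k
    induction k with
    | zero => exact hf
    | succ k ih => exact ih.natCast_mul_sub (hl _ ih)
  refine ⟨fun k => l (F k), fun K => ?_⟩
  have key : ∀ N : ℕ, 0 < N → f N - ∑ k ∈ Finset.range K, l (F k) / (N : ℝ) ^ k =
      F K N * (1 / (N : ℝ)) ^ K := by
    intro N hN
    have hN' : (N : ℝ) ≠ 0 := by positivity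
    induction K with
    | zero => simp [hF0]
    | succ K ih =>
      rw [Finset.sum_range_succ, ← sub_sub, ih, hFs, pow_succ, one_div_pow]
      field_simp
  have h := (hF K).isBigO_one.mul (isBigO_refl (fun N : ℕ => (1 / (N : ℝ)) ^ K) atTop)
  simp only [one_mul] at h
  refine h.congr' ?_ EventuallyEq.rfl
  filter_upwards [eventually_gt_atTop 0] with N hN
  exact (key N hN).symm

end HasInvExpansion

/-- The geometric series of `1 / (1 + 1/N)` with its exact remainder. -/
theorem hasInvExpansion_div_succ : HasInvExpansion fun N => (N : ℝ) / (N + 1) := by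
  intro K
  refine ⟨∑ k ∈ Finset.range K, (-Polynomial.X) ^ k, ?_⟩
  refine IsBigO.of_bound 1 ?_
  filter_upwards [eventually_gt_atTop 0] with N hN
  have hN' : (0 : ℝ) < N := by positivity
  have h1 := geom_sum_mul (-(1 / (N : ℝ))) K
  have h2 : (N : ℝ) / (N + 1) - ∑ k ∈ Finset.range K, (-(1 / (N : ℝ))) ^ k =
      (-(1 / (N : ℝ))) ^ K * (N / (N + 1)) := by
    have h3 : (-(1 / (N : ℝ)) - 1) = -(((N : ℝ) + 1) / N) := by
      field_simp
      ring
    rw [h3] at h1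
    have h4 : ((N : ℝ) + 1) / N * (N / (N + 1)) = 1 := by field_simp
    linear_combination (∑ k ∈ Finset.range K, (-(1 / (N : ℝ))) ^ k) * h4 +
      (N / (N + 1 : ℝ)) * h1
  rw [Polynomial.eval_finsetSum]
  simp only [Polynomial.eval_pow, Polynomial.eval_neg, Polynomial.eval_X]
  rw [h2, norm_mul, norm_pow, norm_neg, norm_pow, one_mul]
  refine mul_le_of_le_one_right (by positivity) ?_
  rw [Real.norm_of_nonneg (by positivity), div_le_one (by positivity)]
  linarith

theorem tendsto_natCast_mul_div_succ_pow_sub_one (d : ℕ) :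
    Tendsto (fun N : ℕ => (N : ℝ) * (((N : ℝ) / (N + 1)) ^ d - 1)) atTop (𝓝 (-d)) := by
  have h1 : Tendsto (fun N : ℕ => (N : ℝ) / (N + 1)) atTop (𝓝 1) :=
    tendsto_natCast_div_add_atTop 1
  induction d with
  | zero => simp
  | succ d ih =>
    have h := (ih.mul h1).sub h1
    refine (h.congr fun N => ?_).trans (by
      rw [show (-(d : ℝ)) * 1 - 1 = -((d + 1 : ℕ) : ℝ) by push_cast; ring])
    have : (N : ℝ) + 1 ≠ 0 := by positivity
    rw [pow_succ]
    field_simp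
    ring

/-- The increments are dominated by those of the decreasing sequence `b`, a multiple of `N^(-K-1)`;
telescoping gives both the limit and the rate. -/
theorem exists_isBigO_sub_of_isBigO_diff {f : ℕ → ℝ} {K : ℕ}
    (h : (fun N : ℕ => (N : ℝ) ^ (K + 2) * (f (N + 1) - f N)) =O[atTop] fun _ => (1 : ℝ)) :
    ∃ c, (fun N : ℕ => f N - c) =O[atTop] fun N : ℕ => (1 / (N : ℝ)) ^ (K + 1) := by
  obtain ⟨C, hC0, hC⟩ := h.exists_pos
  rw [IsBigOWith_def, eventually_atTop] at hC
  obtain ⟨N₀, hN₀⟩ := hC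
  set M := max N₀ 1 with hM
  set b : ℕ → ℝ := fun N => 2 * C * (1 / (N : ℝ)) ^ (K + 1) with hb
  have hstep : ∀ N, M ≤ N → |f (N + 1) - f N| ≤ b N - b (N + 1) := by
    intro N hN
    have hN1 : 1 ≤ N := le_trans (le_max_right _ _) hN
    have hN1' : (1 : ℝ) ≤ N := by exact_mod_cast hN1
    have hNp : (0 : ℝ) < N := by positivity
    have h1 := hN₀ N (le_trans (le_max_left _ _) hN)
    rw [norm_mul, norm_pow, norm_one, mul_one, Real.norm_of_nonneg hNp.le, Real.norm_eq_abs] at h1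
    have h2 : |f (N + 1) - f N| ≤ C * (1 / (N : ℝ)) ^ (K + 2) := by
      rw [one_div_pow, mul_one_div, le_div_iff₀ (by positivity), mul_comm]
      exact h1
    refine h2.trans ?_
    have h3 : (1 / ((N : ℝ) + 1)) ^ K ≤ (1 / (N : ℝ)) ^ K := by
      refine pow_le_pow_left₀ (by positivity) ?_ K
      exact one_div_le_one_div_of_le hNp (by linarith)
    -- This is `N + 1 ≤ 2N`, the source of the `2` in `b` and of the `1` in `M`.
    have h4 : (1 / (N : ℝ)) ^ 2 ≤ 2 * (1 / (N : ℝ) - 1 / (N + 1)) := by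
      have h5 : 2 * (1 / (N : ℝ) - 1 / (N + 1)) - (1 / (N : ℝ)) ^ 2 =
          (N - 1) / (N ^ 2 * (N + 1)) := by
        field_simp
        ring
      have h6 : 0 ≤ ((N : ℝ) - 1) / (N ^ 2 * (N + 1)) := by
        apply div_nonneg <;> nlinarith
      linarith
    simp only [hb]
    push_cast
    have h7 : (1 / (N : ℝ)) ^ K * (1 / (N : ℝ)) ^ 2 ≤
        (1 / (N : ℝ)) ^ K * (2 * (1 / (N : ℝ) - 1 / (N + 1))) :=
      mul_le_mul_of_nonneg_left h4 (by positivity)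
    have h8 : (1 / ((N : ℝ) + 1)) ^ K * (1 / (N + 1)) ≤ (1 / (N : ℝ)) ^ K * (1 / (N + 1)) :=
      mul_le_mul_of_nonneg_right h3 (by positivity)
    rw [pow_succ, pow_succ (1 / ((N : ℝ) + 1)), pow_add]
    nlinarith
  have hle : ∀ N, M ≤ N → ∀ j, |f (N + j) - f N| ≤ b N - b (N + j) := by
    intro N hN j
    induction j with
    | zero => simp
    | succ j ih =>
      have h1 := hstep (N + j) (by omega)
      have h2 := abs_sub_le (f (N + (j + 1))) (f (N + j)) (f N)
      rw [← add_assoc] at h2 ⊢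
      linarith
  have hbnn : ∀ N, 0 ≤ b N := fun N => by positivity
  have hbt : Tendsto b atTop (𝓝 0) := by
    simpa [hb] using ((tendsto_const_div_atTop_nhds_zero_nat (1 : ℝ)).pow (K + 1)).const_mul (2 * C)
  have hcauchy : CauchySeq fun N => f (N + M) := by
    refine cauchySeq_of_le_tendsto_0 (fun N => 2 * b (N + M)) (fun n k N hn hk => ?_) ?_
    · obtain ⟨i, rfl⟩ := Nat.exists_eq_add_of_le hn
      obtain ⟨j, rfl⟩ := Nat.exists_eq_add_of_le hk
      have h1 := hle (N + M) (by omega) i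
      have h2 := hle (N + M) (by omega) j
      rw [Nat.add_right_comm N i, Nat.add_right_comm N j, Real.dist_eq]
      have h3 := abs_sub_le (f (N + M + i)) (f (N + M)) (f (N + M + j))
      rw [abs_sub_comm (f (N + M))] at h3
      have := hbnn (N + M + i)
      have := hbnn (N + M + j)
      linarith
    · simpa using ((tendsto_add_atTop_iff_nat M).2 hbt).const_mul 2
  obtain ⟨c, hc⟩ := cauchySeq_tendsto_of_complete hcauchy
  rw [tendsto_add_atTop_iff_nat] at hc
  refine ⟨c, IsBigO.of_bound (2 * C) ?_⟩
  filter_upwards [eventually_ge_atTop M] with N hN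
  have h1 : Tendsto (fun j => |f (N + j) - f N|) atTop (𝓝 |c - f N|) := by
    have := (hc.comp (tendsto_add_atTop_nat N)).sub_const (f N)
    refine (this.abs).congr fun j => ?_
    simp [add_comm]
  have h2 : |c - f N| ≤ b N :=
    le_of_tendsto' h1 fun j => (hle N hN j).trans (by linarith [hbnn (N + j)])
  rw [Real.norm_eq_abs, abs_sub_comm, Real.norm_of_nonneg (by positivity)]
  exact h2

/-- The increments of `s / ((d+1) N^(d+1))` are asymptotic to `-s / N^(d+2)`, so adding this term
cancels the leading increment of `f` and gains one order. -/
theorem HasInvExpansion.diff_step {f : ℕ → ℝ} {d : ℕ} {s : ℝ}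
    (h : HasInvExpansion fun N => (N : ℝ) ^ (d + 2) * (f (N + 1) - f N))
    (hs : Tendsto (fun N : ℕ => (N : ℝ) ^ (d + 2) * (f (N + 1) - f N)) atTop (𝓝 s)) :
    HasInvExpansion fun N => (N : ℝ) ^ (d + 3) *
      ((f (N + 1) + s / (d + 1) * (1 / ((N + 1 : ℕ) : ℝ)) ^ (d + 1)) -
        (f N + s / (d + 1) * (1 / (N : ℝ)) ^ (d + 1))) := by
  have h1 := h.natCast_mul_sub hs
  have hw : HasInvExpansion fun N : ℕ => (N : ℝ) * (((N : ℝ) / (N + 1)) ^ (d + 1) - 1) := by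
    refine (hasInvExpansion_div_succ.pow (d + 1)).natCast_mul_sub ?_
    simpa using (tendsto_natCast_div_add_atTop (1 : ℝ)).pow (d + 1)
  have h2 := (hw.natCast_mul_sub (tendsto_natCast_mul_div_succ_pow_sub_one (d + 1))).const_mul
    (s / (d + 1))
  refine (h1.add h2).congr ?_
  filter_upwards [eventually_gt_atTop 0] with N hN
  have hN' : (N : ℝ) ≠ 0 := by positivity
  have hN1 : (N : ℝ) + 1 ≠ 0 := by positivity
  have hd : (d : ℝ) + 1 ≠ 0 := by positivity
  push_cast
  have e1 : (N : ℝ) ^ (d + 3) * (1 / (N : ℝ)) ^ (d + 1) = N ^ 2 := by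
    rw [one_div_pow]
    field_simp
    ring
  have e2 : (N : ℝ) ^ (d + 3) * (1 / ((N : ℝ) + 1)) ^ (d + 1) =
      N ^ 2 * ((N : ℝ) / (N + 1)) ^ (d + 1) := by
    rw [div_pow, div_pow, one_pow]
    field_simp
    ring
  have e3 : s / ((d : ℝ) + 1) * (d + 1) = s := by field_simp
  linear_combination (s / ((d : ℝ) + 1)) * e1 - (s / ((d : ℝ) + 1)) * e2 + N * e3

/-- Discrete integration. In `key`, the leading increment is removed by `diff_step` until only `j =
0` orders remain; what is left is a constant plus an error of the required size. -/
theorem hasInvExpansion_of_diff {f : ℕ → ℝ}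
    (h : HasInvExpansion fun N => (N : ℝ) ^ 2 * (f (N + 1) - f N)) : HasInvExpansion f := by
  have key : ∀ K j d : ℕ, d + j = K → ∀ f : ℕ → ℝ,
      HasInvExpansion (fun N => (N : ℝ) ^ (d + 2) * (f (N + 1) - f N)) →
      ∃ p : Polynomial ℝ, (fun N : ℕ => f N - p.eval (1 / (N : ℝ))) =O[atTop]
        fun N : ℕ => (1 / (N : ℝ)) ^ (K + 1) := by
    intro K j
    induction j with
    | zero =>
      rintro d rfl f hf
      obtain ⟨c, hc⟩ := exists_isBigO_sub_of_isBigO_diff hf.isBigO_one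
      exact ⟨Polynomial.C c, by simpa using hc⟩
    | succ j ih =>
      intro d hd f hf
      obtain ⟨s, hs⟩ := hf.exists_tendsto
      obtain ⟨p, hp⟩ := ih (d + 1) (by omega)
        (fun N => f N + s / (d + 1) * (1 / (N : ℝ)) ^ (d + 1)) (hf.diff_step hs)
      refine ⟨p - Polynomial.C (s / (d + 1)) * Polynomial.X ^ (d + 1), hp.congr_left fun N => ?_⟩
      simp only [Polynomial.eval_sub, Polynomial.eval_mul, Polynomial.eval_C, Polynomial.eval_pow,
        Polynomial.eval_X]
      ring
  intro K
  rcases K with _ | K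
  · obtain ⟨p, hp⟩ := key 0 0 0 rfl f h
    refine ⟨p, hp.trans ?_⟩
    simpa using ((tendsto_const_div_atTop_nhds_zero_nat (1 : ℝ)).isBigO_one ℝ)
  · exact key K K 0 (by simp) f h

/-- The tail of the sum of `s / n²` from `N` on is asymptotic to `s / N`; this identifies the
coefficient of `1 / N`. -/
theorem tendsto_natCast_mul_sub_of_diff {f : ℕ → ℝ} {s c : ℝ}
    (h : HasInvExpansion fun N => (N : ℝ) ^ 2 * (f (N + 1) - f N))
    (hs : Tendsto (fun N : ℕ => (N : ℝ) ^ 2 * (f (N + 1) - f N)) atTop (𝓝 s))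
    (hc : Tendsto f atTop (𝓝 c)) :
    Tendsto (fun N : ℕ => (N : ℝ) * (f N - c)) atTop (𝓝 (-s)) := by
  have h1 := HasInvExpansion.diff_step (d := 0) h hs
  obtain ⟨c', hc'⟩ := exists_isBigO_sub_of_isBigO_diff (K := 1)
    (f := fun N => f N + s / ((0 : ℕ) + 1) * (1 / (N : ℝ)) ^ (0 + 1)) h1.isBigO_one
  simp only [Nat.cast_zero, zero_add, div_one, pow_one, Nat.reduceAdd] at hc'
  have h2 : c' = c := by
    have h3 := tendsto_of_isBigO_one_div_pow hc'
    have h4 := (hc.add ((tendsto_const_div_atTop_nhds_zero_nat (1 : ℝ)).const_mul s)).sub_const c'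
    have := tendsto_nhds_unique h3 h4
    linarith
  subst h2
  have h5 := (tendsto_of_isBigO_one_div_pow (isBigO_natCast_mul hc')).sub_const s
  rw [zero_sub] at h5
  refine h5.congr' ?_
  filter_upwards [eventually_gt_atTop 0] with N hN
  have hN' : (N : ℝ) ≠ 0 := by positivity
  field_simp
  ring

end Expansion

/-! ### The expansion of `∑ j ≤ N, log (j m)!` -/

section LogFactorial

open Asymptotics

/-- The third remainder of the expansion of `log (1 + 1 / N)`. -/
noncomputable def logRemainder (N : ℕ) : ℝ :=
  (N : ℝ) ^ 3 * (Real.log (1 + 1 / (N : ℝ)) - 1 / N + 1 / (2 * N ^ 2))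

theorem isBigO_logRemainder_sub (K : ℕ) :
    (fun N : ℕ => logRemainder N - ∑ k ∈ Finset.range K, (-(1 / (N : ℝ))) ^ k / (k + 3)) =O[atTop]
      fun N : ℕ => (1 / (N : ℝ)) ^ K := by
  refine IsBigO.of_bound 2 ?_
  filter_upwards [eventually_ge_atTop 2] with N hN
  have hN' : (2 : ℝ) ≤ N := by exact_mod_cast hN
  have hN0 : (0 : ℝ) < N := by linarith
  -- For `N ≥ 2` the geometric factor `1 / (1 - |x|)` of the Taylor remainder is at most `2`, the
  -- constant claimed.
  have hx : |-(1 / (N : ℝ))| ≤ 1 / 2 := by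
    rw [abs_neg, abs_of_nonneg (by positivity)]
    exact one_div_le_one_div_of_le (by norm_num) hN'
  have h := Real.abs_log_sub_add_sum_range_le (lt_of_le_of_lt hx (by norm_num)) (K + 2)
  rw [sub_neg_eq_add, Finset.sum_range_succ', Finset.sum_range_succ'] at h
  have h1 : logRemainder N - ∑ k ∈ Finset.range K, (-(1 / (N : ℝ))) ^ k / (k + 3) =
      (N : ℝ) ^ 3 * (∑ k ∈ Finset.range K, (-(1 / (N : ℝ))) ^ (k + 1 + 1 + 1) /
        (((k + 1 + 1 : ℕ) : ℝ) + 1) + (-(1 / (N : ℝ))) ^ (0 + 1 + 1) / (((0 + 1 : ℕ) : ℝ) + 1) +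
        (-(1 / (N : ℝ))) ^ (0 + 1) / (((0 : ℕ) : ℝ) + 1) + Real.log (1 + 1 / N)) := by
    have h2 : (N : ℝ) ^ 3 * ∑ k ∈ Finset.range K, (-(1 / (N : ℝ))) ^ (k + 1 + 1 + 1) /
        (((k + 1 + 1 : ℕ) : ℝ) + 1) = -∑ k ∈ Finset.range K, (-(1 / (N : ℝ))) ^ k / (k + 3) := by
      rw [Finset.mul_sum, ← Finset.sum_neg_distrib]
      refine Finset.sum_congr rfl fun k _ => ?_
      rw [pow_add, pow_add, pow_add]
      push_cast
      have : (k : ℝ) + 3 ≠ 0 := by positivity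
      rw [show (k : ℝ) + 1 + 1 + 1 = k + 3 by ring]
      field_simp
    generalize ∑ k ∈ Finset.range K, (-(1 / (N : ℝ))) ^ (k + 1 + 1 + 1) /
        (((k + 1 + 1 : ℕ) : ℝ) + 1) = A at h2 ⊢
    rw [← neg_eq_iff_eq_neg.2 h2, logRemainder]
    push_cast
    field_simp
    ring
  rw [h1, norm_mul, Real.norm_of_nonneg (by positivity), Real.norm_eq_abs,
    Real.norm_of_nonneg (by positivity)]
  refine (mul_le_mul_of_nonneg_left h (by positivity)).trans ?_
  have h3 : |-(1 / (N : ℝ))| ^ (K + 2 + 1) / (1 - |-(1 / (N : ℝ))|) ≤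
      |-(1 / (N : ℝ))| ^ (K + 2 + 1) * 2 := by
    rw [div_le_iff₀ (by linarith), mul_assoc]
    refine le_mul_of_one_le_right (by positivity) (by linarith)
  refine (mul_le_mul_of_nonneg_left h3 (by positivity)).trans (le_of_eq ?_)
  rw [abs_neg, abs_of_nonneg (by positivity), add_assoc K, pow_add]
  have h4 : (N : ℝ) ^ 3 * (1 / N) ^ (2 + 1) = 1 := by
    rw [← mul_pow, mul_one_div_cancel hN0.ne', one_pow]
  linear_combination (2 * (1 / (N : ℝ)) ^ K) * h4

theorem hasInvExpansion_logRemainder : HasInvExpansion logRemainder := by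
  intro K
  refine ⟨∑ k ∈ Finset.range K, Polynomial.C (1 / ((k : ℝ) + 3)) * (-Polynomial.X) ^ k,
    (isBigO_logRemainder_sub K).congr_left fun N => ?_⟩
  rw [Polynomial.eval_finsetSum]
  simp [div_eq_inv_mul]

theorem tendsto_logRemainder : Tendsto logRemainder atTop (𝓝 (1 / 3)) := by
  have h := (tendsto_of_isBigO_one_div_pow (isBigO_logRemainder_sub 1)).add_const (1 / 3)
  simpa using h

theorem log_one_add_one_div_eq {N : ℕ} (hN : 0 < N) :
    Real.log (1 + 1 / (N : ℝ)) = 1 / N - 1 / (2 * N ^ 2) + logRemainder N / N ^ 3 := by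
  have : (N : ℝ) ≠ 0 := by positivity
  rw [logRemainder]
  field_simp
  ring

theorem log_succ_eq {N : ℕ} (hN : 0 < N) :
    Real.log ((N : ℝ) + 1) =
      Real.log N + (1 / N - 1 / (2 * N ^ 2) + logRemainder N / N ^ 3) := by
  have : (0 : ℝ) < N := by positivity
  rw [← log_one_add_one_div_eq hN, ← Real.log_mul (by positivity) (by positivity)]
  congr 1
  field_simp

/-- The remainder in Stirling's formula. -/
noncomputable def stirlingRemainder (N : ℕ) : ℝ :=
  Real.log N.factorial - (N + 1 / 2) * Real.log N + N

/-- The increment of `log N!` is `log (N + 1)`; after its Taylor expansion everything of order above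
`1 / N²` cancels. -/
theorem sq_mul_stirlingRemainder_diff {N : ℕ} (hN : 0 < N) :
    (N : ℝ) ^ 2 * (stirlingRemainder (N + 1) - stirlingRemainder N) =
      1 / 4 - logRemainder N - 1 / 2 * (1 / (N : ℝ) * logRemainder N) := by
  have h : (N : ℝ) ≠ 0 := by positivity
  have h1 : Real.log (N + 1).factorial = Real.log ((N : ℝ) + 1) + Real.log N.factorial := by
    rw [Nat.factorial_succ, Nat.cast_mul, Real.log_mul (by positivity) (by positivity)]
    push_cast
    rfl
  rw [stirlingRemainder, stirlingRemainder, h1]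
  push_cast
  rw [log_succ_eq hN]
  field_simp
  ring

theorem hasInvExpansion_sq_mul_stirlingRemainder_diff :
    HasInvExpansion fun N =>
      (N : ℝ) ^ 2 * (stirlingRemainder (N + 1) - stirlingRemainder N) := by
  refine (((HasInvExpansion.const (1 / 4)).sub hasInvExpansion_logRemainder).sub
    ((HasInvExpansion.one_div.mul hasInvExpansion_logRemainder).const_mul (1 / 2))).congr ?_
  filter_upwards [eventually_gt_atTop 0] with N hN
  exact (sq_mul_stirlingRemainder_diff hN).symm

theorem tendsto_stirlingRemainder :
    Tendsto stirlingRemainder atTop (𝓝 (Real.log (2 * Real.pi) / 2)) := by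
  have h1 : Tendsto (fun N => Real.log (Stirling.stirlingSeq N)) atTop
      (𝓝 (Real.log √Real.pi)) :=
    Stirling.tendsto_stirlingSeq_sqrt_pi.log (by positivity)
  have h2 := h1.add_const (Real.log 2 / 2)
  have h3 : Real.log √Real.pi + Real.log 2 / 2 = Real.log (2 * Real.pi) / 2 := by
    rw [Real.log_sqrt (by positivity), Real.log_mul (by positivity) (by positivity)]
    ring
  rw [h3] at h2
  refine h2.congr' ?_
  filter_upwards [eventually_gt_atTop 0] with N hN
  have h4 : (0 : ℝ) < N := by positivity
  rw [Stirling.log_stirlingSeq_formula, stirlingRemainder, Real.log_mul (by positivity) h4.ne',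
    Real.log_div h4.ne' (by positivity), Real.log_exp]
  ring

/-- The second remainder in Stirling's formula. -/
noncomputable def stirlingRemainder₂ (N : ℕ) : ℝ :=
  N * (N * (stirlingRemainder N - Real.log (2 * Real.pi) / 2) - 1 / 12)

theorem hasInvExpansion_stirlingRemainder₂ : HasInvExpansion stirlingRemainder₂ := by
  have h1 := hasInvExpansion_of_diff hasInvExpansion_sq_mul_stirlingRemainder_diff
  refine (h1.natCast_mul_sub tendsto_stirlingRemainder).natCast_mul_sub ?_
  -- The limit is `1/4 - 1/3 = -1/12`; summing the tail changes the sign and yields Stirling's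
  -- `1/12`.
  have h2 : Tendsto (fun N : ℕ =>
      (N : ℝ) ^ 2 * (stirlingRemainder (N + 1) - stirlingRemainder N)) atTop
      (𝓝 (-(1 / 12))) := by
    have h3 := (tendsto_logRemainder.const_sub (1 / 4)).sub
      (((tendsto_const_div_atTop_nhds_zero_nat (1 : ℝ)).mul tendsto_logRemainder).const_mul (1 / 2))
    rw [show (1 / 4 : ℝ) - 1 / 3 - 1 / 2 * (0 * (1 / 3)) = -(1 / 12) by norm_num] at h3
    refine h3.congr' ?_
    filter_upwards [eventually_gt_atTop 0] with N hN
    exact (sq_mul_stirlingRemainder_diff hN).symm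
  simpa using tendsto_natCast_mul_sub_of_diff hasInvExpansion_sq_mul_stirlingRemainder_diff h2
    tendsto_stirlingRemainder

theorem log_factorial_eq {N : ℕ} (hN : 0 < N) :
    Real.log N.factorial = (N + 1 / 2) * Real.log N - N + Real.log (2 * Real.pi) / 2 +
      1 / (12 * N) + stirlingRemainder₂ N / N ^ 2 := by
  have h : (N : ℝ) ≠ 0 := by positivity
  rw [stirlingRemainder₂, stirlingRemainder]
  field_simp
  ring

theorem log_factorial_mul_eq {m N : ℕ} (hm : 1 ≤ m) (hN : 0 < N) :
    Real.log (N * m).factorial = (N * m + 1 / 2) * (Real.log N + Real.log m) - N * m +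
      Real.log (2 * Real.pi) / 2 + 1 / (12 * (N * m)) +
      stirlingRemainder₂ (N * m) / (N * m) ^ 2 := by
  have h : (N : ℝ) ≠ 0 := by positivity
  have hm' : (m : ℝ) ≠ 0 := by positivity
  rw [log_factorial_eq (by positivity)]
  push_cast
  rw [Real.log_mul h hm']

/-- The increment of the sum is `log (Nm)!`. The subtracted terms are chosen so that their
increments reproduce Stirling's terms down to order `1 / N`, so the difference has increments of
order `1 / N²`. -/
theorem hasInvExpansion_sum_range_log_factorial {m : ℕ} (hm : 1 ≤ m) :
    HasInvExpansion fun N => ∑ j ∈ Finset.range N, Real.log (j * m).factorial -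
      ((m : ℝ) / 2 * N ^ 2 * Real.log N + (1 / 2 - (m : ℝ) / 2) * N * Real.log N +
        ((m : ℝ) / 12 - 1 / 4 + 1 / (12 * m)) * Real.log N +
        (m * Real.log m / 2 - 3 * m / 4) * N ^ 2 +
        (-(1 / 2) - m * Real.log m / 2 + Real.log m / 2 + m / 2 + Real.log (2 * Real.pi) / 2) *
          N) := by
  have hm' : (m : ℝ) ≠ 0 := by positivity
  refine hasInvExpansion_of_diff ?_
  have g3 := hasInvExpansion_logRemainder
  have g4 := g3.natCast_mul_sub tendsto_logRemainder
  have r := hasInvExpansion_stirlingRemainder₂.comp_mul hm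
  have u := HasInvExpansion.one_div
  have c := HasInvExpansion.const
  refine ((r.const_mul (1 / (m : ℝ) ^ 2)).sub
    -- The three brackets are the Taylor remainders in the increments of `N² log N`, `N log N` and
    -- `log N`.
    ((((g4.add (g3.mul ((c 2).add u))).add (c (-(1 / 2)))).const_mul ((m : ℝ) / 2)).add
      ((((g3.mul ((c 1).add u)).add (c (-(1 / 2)))).const_mul (1 / 2 - (m : ℝ) / 2)).add
      (((g3.mul u).add (c (-(1 / 2)))).const_mul ((m : ℝ) / 12 - 1 / 4 + 1 / (12 * m)))))).congr ?_
  filter_upwards [eventually_gt_atTop 0] with N hN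
  have h : (N : ℝ) ≠ 0 := by positivity
  rw [Finset.sum_range_succ, log_factorial_mul_eq hm hN]
  push_cast
  rw [log_succ_eq hN]
  field_simp
  ring

theorem hasInvExpansion_sum_log_factorial {m : ℕ} (hm : 1 ≤ m) :
    HasInvExpansion fun N => ∑ j ∈ Finset.range N, Real.log ((j + 1) * m).factorial -
      ((m : ℝ) / 2 * N ^ 2 * Real.log N + (m / 2 + 1 / 2) * N * Real.log N +
        ((m : ℝ) / 12 + 1 / 4 + 1 / (12 * m)) * Real.log N +
        (m * Real.log m / 2 - 3 * m / 4) * N ^ 2 +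
        (-(1 / 2) + m * Real.log m / 2 + Real.log m / 2 - m / 2 + Real.log (2 * Real.pi) / 2) *
          N) := by
  have hm' : (m : ℝ) ≠ 0 := by positivity
  have r := hasInvExpansion_stirlingRemainder₂.comp_mul hm
  have u := HasInvExpansion.one_div
  refine (((hasInvExpansion_sum_range_log_factorial hm).add
    (HasInvExpansion.const (Real.log m / 2 + Real.log (2 * Real.pi) / 2))).add
    ((u.const_mul (1 / (12 * (m : ℝ)))).add ((u.pow 2).mul (r.const_mul (1 / (m : ℝ) ^ 2))))).congr
    ?_
  filter_upwards [eventually_gt_atTop 0] with N hN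
  have h : (N : ℝ) ≠ 0 := by positivity
  have h1 : ∑ j ∈ Finset.range N, Real.log ((j + 1) * m).factorial =
      ∑ j ∈ Finset.range N, Real.log (j * m).factorial + Real.log (N * m).factorial := by
    rw [← Finset.sum_range_succ, Finset.sum_range_succ']
    simp
  rw [h1, log_factorial_mul_eq hm hN]
  field_simp
  ring

end LogFactorial

/-! ### The expansion of the partition function -/

section PartitionExpansion

open Asymptotics

/-- The logarithm of the modulus of Mehta's integral for the weight `exp (-8 m N x ^ 2)`. -/
noncomputable def logMehta (m N : ℕ) : ℝ :=
  N * (Real.log (Real.pi / (8 * m * N)) / 2) +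
    (m * (N * (N - 1) : ℝ)) * (-(Real.log (2 * (8 * m * N)) / 2)) +
    ∑ j ∈ Finset.range N, (Real.log ((j + 1) * m).factorial - Real.log m.factorial)

theorem exp_logMehta {m N : ℕ} (hm : 1 ≤ m) (hN : 1 ≤ N) :
    Real.exp (logMehta m N) =
      √(Real.pi / (8 * m * N)) ^ N * ((1 / √(2 * (8 * m * N))) ^ (m * (N * (N - 1))) *
        ∏ j ∈ Finset.range N, ((((j + 1) * m).factorial : ℝ) / m.factorial)) := by
  have h1 : (0 : ℝ) < Real.pi / (8 * m * N) := by positivity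
  have h2 : (0 : ℝ) < 2 * (8 * m * N) := by positivity
  have h3 : (m * (N * (N - 1) : ℝ)) = ((m * (N * (N - 1)) : ℕ) : ℝ) := by
    push_cast [Nat.cast_sub hN]
    ring
  rw [logMehta, Real.exp_add, Real.exp_add, Real.exp_sum, h3, Real.exp_nat_mul,
    Real.exp_nat_mul, Real.exp_neg, ← Real.log_sqrt h1.le, ← Real.log_sqrt h2.le,
    Real.exp_log (Real.sqrt_pos.2 h1), Real.exp_log (Real.sqrt_pos.2 h2), one_div, mul_assoc]
  congr 2
  refine Finset.prod_congr rfl fun j _ => ?_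
  rw [Real.exp_sub, Real.exp_log (by positivity), Real.exp_log (by positivity)]

/-- The `N² log N` of the factorials cancels against the scaling of the Vandermonde product by the
standard deviation, leaving `m N log N`. -/
theorem hasInvExpansion_logMehta {m : ℕ} (hm : 1 ≤ m) :
    HasInvExpansion fun N => logMehta m N -
      ((m : ℝ) * N * Real.log N + ((m : ℝ) / 12 + 1 / 4 + 1 / (12 * m)) * Real.log N +
        (-(2 * m * Real.log 2) - 3 * m / 4) * N ^ 2 +
        ((2 * m - 1) * Real.log 2 + Real.log Real.pi + m * Real.log m - 1 / 2 - m / 2 -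
          Real.log m.factorial) * N) := by
  refine (hasInvExpansion_sum_log_factorial hm).congr ?_
  filter_upwards [eventually_gt_atTop 0] with N hN
  have hN' : (N : ℝ) ≠ 0 := by positivity
  have hm' : (m : ℝ) ≠ 0 := by positivity
  have h1 : Real.log (Real.pi / (8 * m * N)) =
      Real.log Real.pi - (3 * Real.log 2 + Real.log m + Real.log N) := by
    rw [Real.log_div (by positivity) (by positivity), Real.log_mul (by positivity) hN',
      Real.log_mul (by positivity) hm', show (8 : ℝ) = 2 ^ 3 by norm_num, Real.log_pow]
    push_cast
    ring
  have h2 : Real.log (2 * (8 * m * N)) = 4 * Real.log 2 + Real.log m + Real.log N := by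
    rw [Real.log_mul (by positivity) (by positivity), Real.log_mul (by positivity) hN',
      Real.log_mul (by positivity) hm', show (8 : ℝ) = 2 ^ 3 by norm_num, Real.log_pow]
    push_cast
    ring
  have h3 : Real.log (2 * Real.pi) = Real.log 2 + Real.log Real.pi :=
    Real.log_mul (by positivity) (by positivity)
  rw [logMehta, h1, h2, h3, Finset.sum_sub_distrib, Finset.sum_const, Finset.card_range,
    nsmul_eq_mul]
  ring

theorem sum_Icc_neg_two (f : ℤ → ℂ) (K : ℕ) :
    ∑ k ∈ Finset.Icc (-2 : ℤ) K, f k =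
      f (-2) + f (-1) + ∑ k ∈ Finset.range (K + 1), f k := by
  induction K with
  | zero =>
    have : Finset.Icc (-2 : ℤ) ((0 : ℕ) : ℤ) = {-2, -1, 0} := by decide
    rw [this, Finset.sum_insert (by decide), Finset.sum_insert (by decide)]
    simp [add_assoc]
  | succ K ih =>
    have : Finset.Icc (-2 : ℤ) ((K + 1 : ℕ) : ℤ) =
        insert ((K + 1 : ℕ) : ℤ) (Finset.Icc (-2 : ℤ) (K : ℤ)) := by
      ext x
      simp only [Finset.mem_Icc, Finset.mem_insert]
      push_cast
      omega
    rw [this, Finset.sum_insert (by simp), ih, Finset.sum_range_succ _ (K + 1)]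
    ring

/-- With `lam` as the logarithm of `ζ₂ - ζ₁`, the complex part of the chosen logarithm is a
polynomial in `N` and affects only `F (-2)` and `F (-1)`. -/
theorem exists_partitionFunction_expansion {m : ℕ} (hm : 1 ≤ m) (V : Polynomial ℂ) {ζ₁ ζ₂ : ℂ}
    (hζ : ζ₁ ≠ ζ₂) {lam : ℂ} (hlam : Complex.exp lam = ζ₂ - ζ₁) {E S : ℂ}
    (hE : E = -lam + ((2 * Real.log 2 + 3 / 4 : ℝ) : ℂ) + 2 * V.eval ((ζ₁ + ζ₂) / 2))
    (hS : S = -lam + ((Real.log 2 - Real.log Real.pi + 1 / 2 : ℝ) : ℂ)) :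
    ∃ (F : ℤ → ℂ) (lnZ : ℕ → ℂ),
      (∀ N : ℕ, 1 ≤ N → Complex.exp (lnZ N) =
        partitionFunction (2 * m) N (quadraticPotential V ζ₁ ζ₂) (lineCurve ζ₁ ζ₂)) ∧
      (∀ K : ℕ,
        (fun N : ℕ => lnZ N -
          (((2 * m : ℕ) : ℂ) / 2 * (N : ℂ) * (Real.log N : ℂ) +
            (3 + ((2 * m : ℕ) : ℂ) / 2 + 2 / ((2 * m : ℕ) : ℂ)) / 12 * (Real.log N : ℂ) +
            ∑ k ∈ Finset.Icc (-2 : ℤ) (K : ℤ), F k / (N : ℂ) ^ k))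
        =O[atTop] (fun N : ℕ => (N : ℝ) ^ (-(K : ℤ) - 1))) ∧
      F (-2) = -(((2 * m : ℕ) : ℂ) / 2) * E ∧
      F (-1) = (((2 * m : ℕ) : ℂ) / 2 - 1) * (S + (Real.log (((2 * m : ℕ) : ℝ) / 2) : ℂ)) +
        ((2 * m : ℕ) : ℂ) / 2 * (Real.log (2 * Real.pi / Real.exp 1) : ℂ) -
        (Real.log (Real.Gamma (((2 * m : ℕ) : ℝ) / 2)) : ℂ) := by
  have hm' : (m : ℝ) ≠ 0 := by positivity
  have hmC : (m : ℂ) ≠ 0 := by exact_mod_cast hm'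
  obtain ⟨c, hc⟩ := (hasInvExpansion_logMehta hm).exists_coeff
  set v := V.eval ((ζ₁ + ζ₂) / 2) with hv
  set A : ℝ := -(2 * m * Real.log 2) - 3 * m / 4 with hA
  set B : ℝ := (2 * m - 1) * Real.log 2 + Real.log Real.pi + m * Real.log m - 1 / 2 - m / 2 -
          Real.log m.factorial with hB
  -- The total power of `ζ₂ - ζ₁` is `mN(N-1) + N`, which puts `m * lam` at `N²` and `(1 - m) * lam`
  -- at `N`.
  let F : ℤ → ℂ := fun k => if k = -2 then m * lam - 2 * m * v + A else
    if k = -1 then (1 - m) * lam + B else c k.toNat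
  have hF2 : F (-2) = m * lam - 2 * m * v + A := rfl
  have hF1 : F (-1) = (1 - m) * lam + B := rfl
  have hFk : ∀ k : ℕ, F k = c k := by
    intro k
    simp only [F]
    rw [if_neg (by omega), if_neg (by omega), Int.toNat_natCast]
  refine ⟨F, fun N => (m * (N * (N - 1))) * lam +
    N * (-(2 * m * N * v) + lam) + (logMehta m N : ℂ), fun N hN => ?_, fun K => ?_, ?_, ?_⟩
  · have h3 : (m * (N * (N - 1)) : ℂ) = ((m * (N * (N - 1)) : ℕ) : ℂ) := by
      push_cast [Nat.cast_sub hN]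
      ring
    rw [partitionFunction_lineCurve hζ hm hN, ← exp_logMehta hm hN, Complex.exp_add,
      Complex.exp_add, h3, Complex.exp_nat_mul, Complex.exp_nat_mul, Complex.exp_add, hlam,
      Complex.ofReal_exp]
  · have h1 : (fun N : ℕ => (1 / (N : ℝ)) ^ (K + 1)) =ᶠ[atTop]
        fun N : ℕ => (N : ℝ) ^ (-(K : ℤ) - 1) := by
      refine Eventually.of_forall fun N => ?_
      simp only
      rw [show -(K : ℤ) - 1 = -((K + 1 : ℕ) : ℤ) by push_cast; ring, zpow_neg, zpow_natCast,
        one_div, inv_pow]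
    refine IsBigO.congr' (Complex.isBigO_ofReal_left.2 (hc (K + 1))) ?_ h1
    filter_upwards [eventually_gt_atTop 0] with N hN
    have hN' : (N : ℂ) ≠ 0 := by exact_mod_cast hN.ne'
    rw [sum_Icc_neg_two, hF2, hF1]
    simp only [hFk]
    rw [show ((N : ℂ) ^ (-2 : ℤ)) = ((N : ℂ) ^ 2)⁻¹ from rfl,
      show ((N : ℂ) ^ (-1 : ℤ)) = ((N : ℂ) ^ 1)⁻¹ from by rw [pow_one, zpow_neg_one]]
    push_cast
    simp only [zpow_natCast, div_inv_eq_mul, pow_one]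
    field_simp
    ring
  · rw [hF2, hE, hA]
    push_cast
    ring
  · have h1 : ((2 * m : ℕ) : ℝ) / 2 = m := by
      push_cast
      ring
    have h2 : Real.log (2 * Real.pi / Real.exp 1) = Real.log 2 + Real.log Real.pi - 1 := by
      rw [Real.log_div (by positivity) (by positivity), Real.log_mul (by positivity)
        (by positivity), Real.log_exp]
    -- Subtracting `log m!` instead of `log Γ(m)` turns `m log m` into the required `(m - 1) log m`.
    have h3 : Real.log m.factorial = Real.log m + Real.log (Real.Gamma m) := by
      rw [← Real.Gamma_nat_eq_factorial, Real.Gamma_add_one hm',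
        Real.log_mul hm' (Real.Gamma_pos_of_pos (by positivity)).ne']
    rw [hF1, hS, h1, h2, hB, h3]
    push_cast
    ring

end PartitionExpansion

/-! ### The semicircle law and its logarithmic potential -/

section Semicircle

/-- The semicircle law on `[0, 1]`. -/
noncomputable def semicircleReal : Measure ℝ :=
  (volume.restrict (Icc (0 : ℝ) 1)).withDensity
    (fun x => ENNReal.ofReal (8 / Real.pi * √(x * (1 - x))))

theorem semicircleMeasure_eq_map (ζ₁ ζ₂ : ℂ) :
    semicircleMeasure ζ₁ ζ₂ = semicircleReal.map (lineCurve ζ₁ ζ₂) := rfl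

variable {E : Type*} [NormedAddCommGroup E] [NormedSpace ℝ E]

theorem measurable_semicircleDensity :
    Measurable fun x : ℝ => ENNReal.ofReal (8 / Real.pi * √(x * (1 - x))) := by
  fun_prop

theorem semicircleDensity_nonneg (x : ℝ) : 0 ≤ 8 / Real.pi * √(x * (1 - x)) := by positivity

theorem integral_semicircleReal_eq (f : ℝ → E) :
    ∫ x, f x ∂semicircleReal = ∫ x in Icc (0 : ℝ) 1, (8 / Real.pi * √(x * (1 - x))) • f x := by
  rw [semicircleReal, integral_withDensity_eq_integral_toReal_smul measurable_semicircleDensity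
    (ae_of_all _ fun x => ENNReal.ofReal_lt_top)]
  simp only [ENNReal.toReal_ofReal (semicircleDensity_nonneg _)]

theorem integrable_semicircleReal_iff {f : ℝ → E} :
    Integrable f semicircleReal ↔
      IntegrableOn (fun x => (8 / Real.pi * √(x * (1 - x))) • f x) (Icc (0 : ℝ) 1) := by
  rw [semicircleReal, integrable_withDensity_iff_integrable_smul' measurable_semicircleDensity
    (ae_of_all _ fun x => ENNReal.ofReal_lt_top)]
  simp only [ENNReal.toReal_ofReal (semicircleDensity_nonneg _), IntegrableOn]

theorem image_cos_sq_Icc :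
    (fun θ : ℝ => Real.cos θ ^ 2) '' Icc 0 (Real.pi / 2) = Icc (0 : ℝ) 1 := by
  have hpi := Real.pi_pos
  apply Subset.antisymm
  · rintro _ ⟨θ, -, rfl⟩
    exact ⟨sq_nonneg _, Real.cos_sq_le_one θ⟩
  · have h := intermediate_value_Icc' (f := fun θ : ℝ => Real.cos θ ^ 2)
      (show (0 : ℝ) ≤ Real.pi / 2 by positivity) (by fun_prop)
    simpa using h

theorem injOn_cos_sq : InjOn (fun θ : ℝ => Real.cos θ ^ 2) (Icc 0 (Real.pi / 2)) := by
  have hpi := Real.pi_pos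
  intro x hx y hy hxy
  have h1 : 0 ≤ Real.cos x := Real.cos_nonneg_of_mem_Icc ⟨by linarith [hx.1], hx.2⟩
  have h2 : 0 ≤ Real.cos y := Real.cos_nonneg_of_mem_Icc ⟨by linarith [hy.1], hy.2⟩
  exact Real.injOn_cos ⟨hx.1, by linarith [hx.2]⟩ ⟨hy.1, by linarith [hy.2]⟩
    ((sq_eq_sq₀ h1 h2).1 hxy)

theorem hasDerivAt_cos_sq (θ : ℝ) :
    HasDerivAt (fun θ : ℝ => Real.cos θ ^ 2) (-Real.sin (2 * θ)) θ := by
  refine ((Real.hasDerivAt_cos θ).pow 2).congr_deriv ?_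
  rw [Real.sin_two_mul]
  push_cast
  ring

theorem abs_sin_smul_semicircleDensity (f : ℝ → E) (θ : ℝ) :
    |(-Real.sin (2 * θ))| • ((8 / Real.pi * √(Real.cos θ ^ 2 * (1 - Real.cos θ ^ 2))) •
      f (Real.cos θ ^ 2)) = (4 / Real.pi * Real.sin (2 * θ) ^ 2) • f (Real.cos θ ^ 2) := by
  have h : Real.cos θ ^ 2 * (1 - Real.cos θ ^ 2) = (Real.sin (2 * θ) / 2) ^ 2 := by
    rw [Real.sin_two_mul]
    have := Real.sin_sq_add_cos_sq θ
    linear_combination (-Real.cos θ ^ 2) * this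
  rw [h, Real.sqrt_sq_eq_abs, smul_smul, abs_neg, abs_div, abs_two, ← sq_abs (Real.sin (2 * θ))]
  congr 1
  ring

/-- Integration against the semicircle law, in the variable `x = cos² θ`. -/
theorem integral_semicircleReal (f : ℝ → E) :
    ∫ x, f x ∂semicircleReal = ∫ θ in (0 : ℝ)..(Real.pi / 2),
      (4 / Real.pi * Real.sin (2 * θ) ^ 2) • f (Real.cos θ ^ 2) := by
  rw [integral_semicircleReal_eq, ← image_cos_sq_Icc,
    integral_image_eq_integral_abs_deriv_smul measurableSet_Icc
      (fun θ _ => (hasDerivAt_cos_sq θ).hasDerivWithinAt) injOn_cos_sq,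
    intervalIntegral.integral_of_le (by positivity), integral_Icc_eq_integral_Ioc]
  simp only [abs_sin_smul_semicircleDensity]

theorem integrable_semicircleReal {f : ℝ → E} :
    Integrable f semicircleReal ↔ IntervalIntegrable (fun θ : ℝ =>
      (4 / Real.pi * Real.sin (2 * θ) ^ 2) • f (Real.cos θ ^ 2)) volume 0 (Real.pi / 2) := by
  rw [integrable_semicircleReal_iff, ← image_cos_sq_Icc,
    integrableOn_image_iff_integrableOn_abs_deriv_smul measurableSet_Icc
      (fun θ _ => (hasDerivAt_cos_sq θ).hasDerivWithinAt) injOn_cos_sq,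
    intervalIntegrable_iff_integrableOn_Icc_of_le (by positivity)]
  simp only [abs_sin_smul_semicircleDensity]

theorem integral_sin_two_mul_sq :
    ∫ θ in (0 : ℝ)..(Real.pi / 2), 4 / Real.pi * Real.sin (2 * θ) ^ 2 = 1 := by
  rw [intervalIntegral.integral_const_mul,
    intervalIntegral.integral_comp_mul_left (fun x => Real.sin x ^ 2) two_ne_zero, integral_sin_sq]
  have : (2 : ℝ) * (Real.pi / 2) = Real.pi := by ring
  simp [this]
  field_simp
  norm_num

instance isProbabilityMeasure_semicircleReal : IsProbabilityMeasure semicircleReal := by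
  have h1 : ∫ _, (1 : ℝ) ∂semicircleReal = 1 := by
    rw [integral_semicircleReal]
    simpa using integral_sin_two_mul_sq
  rw [integral_const, smul_eq_mul, mul_one] at h1
  constructor
  rw [Measure.real, ENNReal.toReal_eq_one_iff] at h1
  exact h1

theorem semicircleReal_compl_Icc : semicircleReal (Icc (0 : ℝ) 1)ᶜ = 0 := by
  refine withDensity_absolutelyContinuous _ _ ?_
  rw [Measure.restrict_apply measurableSet_Icc.compl]
  simp

theorem ae_semicircleReal_mem_Icc : ∀ᵐ x ∂semicircleReal, x ∈ Icc (0 : ℝ) 1 :=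
  semicircleReal_compl_Icc

theorem semicircleReal_absolutelyContinuous : semicircleReal ≪ volume :=
  (withDensity_absolutelyContinuous _ _).trans Measure.restrict_le_self.absolutelyContinuous

instance nullSingletonClass_semicircleReal : NullSingletonClass semicircleReal :=
  ⟨fun x => semicircleReal_absolutelyContinuous (measure_singleton x)⟩

theorem integral_log_sin_mul_cos_four_mul :
    ∫ x in (0 : ℝ)..Real.pi, Real.cos (4 * x) * Real.log (Real.sin x) = -Real.pi / 4 := by
  have hint : IntervalIntegrable (fun x => Real.cos (4 * x) * Real.log (Real.sin x)) volume 0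
      Real.pi :=
    (intervalIntegrable_log_sin (a := 0) (b := Real.pi)).continuousOn_mul (by fun_prop)
  have h := intervalIntegral.integral_eq_sub_of_hasDerivAt_of_le Real.pi_pos.le
    -- Integration by parts made explicit, with `sin 4x / 4 = sin x cos x cos 2x`. Keeping `sin x`
    -- next to its logarithm makes the primitive continuous at the endpoints.
    (f := fun x => Real.cos x * Real.cos (2 * x) * (Real.sin x * Real.log (Real.sin x)) - x / 4 -
      Real.sin (2 * x) / 4 - Real.sin (4 * x) / 16)
    (by
      have := Real.continuous_mul_log.comp Real.continuous_sin
      simp only [Function.comp_def] at this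
      fun_prop)
    (fun x hx => ?_) hint
  · rw [h]
    have h2 : Real.sin (2 * Real.pi) = 0 := Real.sin_two_pi
    have h4 : Real.sin (4 * Real.pi) = 0 := by
      simpa using Real.sin_nat_mul_pi 4
    simp [h2, h4]
    ring
  · have hs : Real.sin x ≠ 0 := (Real.sin_pos_of_mem_Ioo hx).ne'
    have d1 := Real.hasDerivAt_cos x
    have d2 : HasDerivAt (fun x : ℝ => Real.cos (2 * x)) (-Real.sin (2 * x) * 2) x := by
      simpa using ((hasDerivAt_id' x).const_mul 2).cos
    have d3 : HasDerivAt (fun x : ℝ => Real.sin (2 * x)) (Real.cos (2 * x) * 2) x := by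
      simpa using ((hasDerivAt_id' x).const_mul 2).sin
    have d4 : HasDerivAt (fun x : ℝ => Real.sin (4 * x)) (Real.cos (4 * x) * 4) x := by
      simpa using ((hasDerivAt_id' x).const_mul 4).sin
    have d5 := (Real.hasDerivAt_sin x).mul ((Real.hasDerivAt_sin x).log hs)
    refine ((((d1.mul d2).mul d5).sub ((hasDerivAt_id x).div_const 4)).sub
      (d3.div_const 4)).sub (d4.div_const 16) |>.congr_deriv ?_
    have e1 : Real.cos (4 * x) = 2 * Real.cos (2 * x) ^ 2 - 1 := by
      rw [← Real.cos_two_mul]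
      ring_nf
    simp only [Pi.mul_apply]
    rw [e1, Real.sin_two_mul, Real.cos_two_mul]
    have e2 : Real.sin x ^ 2 = 1 - Real.cos x ^ 2 := Real.sin_sq x
    field_simp
    rw [e2]
    ring

theorem intervalIntegrable_log_sin_add (α a b : ℝ) :
    IntervalIntegrable (fun x => Real.log (Real.sin (x + α))) volume a b := by
  have h := (intervalIntegrable_log_sin (a := a + α) (b := b + α)).comp_add_right α
  simpa using h

/-- A translation over a full period: `Real.log` ignores signs, so `log (sin x)` has period `π`. -/
theorem integral_mul_log_sin_add (α : ℝ) :
    ∫ x in (0 : ℝ)..Real.pi, Real.sin (2 * x) ^ 2 * Real.log (Real.sin (x + α)) =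
      ∫ x in (0 : ℝ)..Real.pi, Real.sin (2 * (x - α)) ^ 2 * Real.log (Real.sin x) := by
  have h1 := intervalIntegral.integral_comp_add_right (a := 0) (b := Real.pi)
    (fun x => Real.sin (2 * (x - α)) ^ 2 * Real.log (Real.sin x)) α
  simp only [add_sub_cancel_right] at h1
  rw [h1, zero_add, add_comm]
  have hp : Function.Periodic
      (fun x => Real.sin (2 * (x - α)) ^ 2 * Real.log (Real.sin x)) Real.pi := by
    intro x
    simp only
    rw [Real.sin_add_pi, Real.log_neg_eq_log,
      show 2 * (x + Real.pi - α) = 2 * (x - α) + 2 * Real.pi by ring, Real.sin_add_two_pi]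
  simpa using hp.intervalIntegral_add_eq α 0

/-- After translation the two weights add up to `1 - cos 4α cos 4x`, so only two integrals of `log
sin` are needed. -/
theorem integral_sin_sq_mul_log_sin (α : ℝ) :
    ∫ x in (0 : ℝ)..Real.pi, Real.sin (2 * x) ^ 2 *
      (Real.log (Real.sin (x - α)) + Real.log (Real.sin (x + α))) =
      Real.pi * (Real.cos (4 * α) / 4 - Real.log 2) := by
  have hi : ∀ α a b : ℝ, IntervalIntegrable
      (fun x => Real.sin (2 * x) ^ 2 * Real.log (Real.sin (x + α))) volume a b := fun α a b =>
    (intervalIntegrable_log_sin_add α a b).continuousOn_mul (by fun_prop)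
  have hi2 : ∀ α : ℝ, IntervalIntegrable
      (fun x => Real.sin (2 * (x - α)) ^ 2 * Real.log (Real.sin x)) volume 0 Real.pi := fun α =>
    (intervalIntegrable_log_sin (a := 0) (b := Real.pi)).continuousOn_mul (by fun_prop)
  simp only [mul_add, sub_eq_add_neg]
  rw [intervalIntegral.integral_add (hi (-α) _ _) (hi α _ _), integral_mul_log_sin_add,
    integral_mul_log_sin_add, ← intervalIntegral.integral_add (hi2 _) (hi2 _)]
  have hc : ∀ x : ℝ, Real.sin (2 * (x - -α)) ^ 2 * Real.log (Real.sin x) +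
      Real.sin (2 * (x - α)) ^ 2 * Real.log (Real.sin x) =
      Real.log (Real.sin x) - Real.cos (4 * α) * (Real.cos (4 * x) * Real.log (Real.sin x)) := by
    intro x
    rw [Real.sin_sq_eq_half_sub, Real.sin_sq_eq_half_sub,
      show 2 * (2 * (x - -α)) = 4 * x + 4 * α by ring,
      show 2 * (2 * (x - α)) = 4 * x - 4 * α by ring, Real.cos_add, Real.cos_sub]
    ring
  simp only [hc]
  have h1 : IntervalIntegrable (fun x => Real.log (Real.sin x)) volume 0 Real.pi :=
    intervalIntegrable_log_sin
  have h2 : IntervalIntegrable (fun x => Real.cos (4 * x) * Real.log (Real.sin x)) volume 0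
      Real.pi :=
    (intervalIntegrable_log_sin (a := 0) (b := Real.pi)).continuousOn_mul (by fun_prop)
  rw [intervalIntegral.integral_sub h1 (h2.const_mul _), intervalIntegral.integral_const_mul,
    integral_log_sin_mul_cos_four_mul, integral_log_sin_zero_pi]
  ring

/-- The reflection `x ↦ π - x` exchanges the two logarithms, so the halves of the interval
contribute equally. -/
theorem integral_half_sin_sq_mul_log_sin (α : ℝ) :
    ∫ x in (0 : ℝ)..(Real.pi / 2), Real.sin (2 * x) ^ 2 *
      (Real.log (Real.sin (x - α)) + Real.log (Real.sin (x + α))) =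
      Real.pi / 2 * (Real.cos (4 * α) / 4 - Real.log 2) := by
  set g : ℝ → ℝ := fun x => Real.sin (2 * x) ^ 2 *
    (Real.log (Real.sin (x - α)) + Real.log (Real.sin (x + α))) with hg
  have hi : ∀ a b, IntervalIntegrable g volume a b := fun a b =>
    ((intervalIntegrable_log_sin_add (-α) a b).add
      (intervalIntegrable_log_sin_add α a b)).continuousOn_mul (by fun_prop)
  have h1 := intervalIntegral.integral_add_adjacent_intervals (hi 0 (Real.pi / 2))
    (hi (Real.pi / 2) Real.pi)
  have hsymm : ∀ x, g (Real.pi - x) = g x := by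
    intro x
    simp only [hg]
    rw [show 2 * (Real.pi - x) = 2 * Real.pi - 2 * x by ring, Real.sin_two_pi_sub, neg_sq,
      show Real.pi - x - α = Real.pi - (x + α) by ring, Real.sin_pi_sub,
      show Real.pi - x + α = Real.pi - (x - α) by ring, Real.sin_pi_sub, add_comm (Real.log _)]
  have h2 : ∫ x in (Real.pi / 2)..Real.pi, g x = ∫ x in (0 : ℝ)..(Real.pi / 2), g x := by
    have h3 := intervalIntegral.integral_comp_sub_left (a := 0) (b := Real.pi / 2) g Real.pi
    simp only [hsymm] at h3
    rw [h3, sub_zero, show Real.pi - Real.pi / 2 = Real.pi / 2 by ring]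
  rw [h2, integral_sin_sq_mul_log_sin] at h1
  linarith

/-- From `cos² α - cos² θ = sin (θ - α) sin (θ + α)`. The second factor could vanish only at `θ = α
= π / 2`, which is excluded. -/
theorem log_cos_sq_sub_cos_sq {α θ : ℝ} (hα : α ∈ Icc 0 (Real.pi / 2))
    (hθ : θ ∈ Ioc 0 (Real.pi / 2)) (hne : θ ≠ α) :
    Real.log (Real.cos α ^ 2 - Real.cos θ ^ 2) =
      Real.log (Real.sin (θ - α)) + Real.log (Real.sin (θ + α)) := by
  have hpi := Real.pi_pos
  have h1 : Real.sin (θ - α) ≠ 0 := by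
    rw [Ne, Real.sin_eq_zero_iff_of_lt_of_lt (by linarith [hα.2, hθ.1]) (by linarith [hα.1, hθ.2])]
    exact sub_ne_zero.2 hne
  have h2 : Real.sin (θ + α) ≠ 0 := by
    refine (Real.sin_pos_of_pos_of_lt_pi (by linarith [hα.1, hθ.1]) ?_).ne'
    refine lt_of_le_of_ne (by linarith [hα.2, hθ.2]) fun h => hne ?_
    linarith [hα.2, hθ.2]
  rw [← Real.log_mul h1 h2]
  congr 1
  rw [Real.sin_sub, Real.sin_add]
  have h3 := Real.sin_sq_add_cos_sq θ
  have h4 := Real.sin_sq_add_cos_sq α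
  linear_combination Real.cos θ ^ 2 * h4 - Real.cos α ^ 2 * h3

theorem ae_smul_log_cos_sq_sub {α : ℝ} (hα : α ∈ Icc 0 (Real.pi / 2)) :
    ∀ᵐ θ : ℝ, θ ∈ uIoc 0 (Real.pi / 2) →
      4 / Real.pi * (Real.sin (2 * θ) ^ 2 *
        (Real.log (Real.sin (θ - α)) + Real.log (Real.sin (θ + α)))) =
      (4 / Real.pi * Real.sin (2 * θ) ^ 2) • Real.log (Real.cos α ^ 2 - Real.cos θ ^ 2) := by
  filter_upwards [Measure.ae_ne volume α] with θ hne hθ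
  rw [uIoc_of_le (by positivity)] at hθ
  rw [log_cos_sq_sub_cos_sq hα hθ hne, smul_eq_mul, mul_assoc]

theorem exists_cos_sq_eq {t : ℝ} (ht : t ∈ Icc (0 : ℝ) 1) :
    ∃ α ∈ Icc 0 (Real.pi / 2), Real.cos α ^ 2 = t := by
  rw [← image_cos_sq_Icc] at ht
  exact ht

theorem integrable_log_sub_of_mem {t : ℝ} (ht : t ∈ Icc (0 : ℝ) 1) :
    Integrable (fun y => Real.log (t - y)) semicircleReal := by
  obtain ⟨α, hα, rfl⟩ := exists_cos_sq_eq ht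
  rw [integrable_semicircleReal]
  have h : IntervalIntegrable (fun θ => 4 / Real.pi * (Real.sin (2 * θ) ^ 2 *
        (Real.log (Real.sin (θ - α)) + Real.log (Real.sin (θ + α))))) volume 0 (Real.pi / 2) :=
    (((intervalIntegrable_log_sin_add (-α) _ _).add
      (intervalIntegrable_log_sin_add α _ _)).continuousOn_mul (by fun_prop)).const_mul _
  refine h.congr_ae ?_
  rw [Filter.EventuallyEq, ae_restrict_iff' measurableSet_uIoc]
  exact ae_smul_log_cos_sq_sub hα

/-- The logarithmic potential of the semicircle law on its support. -/
theorem integral_log_sub_of_mem {t : ℝ} (ht : t ∈ Icc (0 : ℝ) 1) :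
    ∫ y, Real.log (t - y) ∂semicircleReal = 4 * (t - 1 / 2) ^ 2 - 2 * Real.log 2 - 1 / 2 := by
  obtain ⟨α, hα, rfl⟩ := exists_cos_sq_eq ht
  rw [integral_semicircleReal, ← intervalIntegral.integral_congr_ae (ae_smul_log_cos_sq_sub hα),
    intervalIntegral.integral_const_mul, integral_half_sin_sq_mul_log_sin]
  have e1 : Real.cos (4 * α) = 2 * Real.cos (2 * α) ^ 2 - 1 := by
    rw [← Real.cos_two_mul]
    ring_nf
  rw [e1, Real.cos_two_mul]
  have := Real.pi_pos
  field_simp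
  ring

theorem integrable_semicircleReal_of_continuous {f : ℝ → E} (hf : Continuous f) :
    Integrable f semicircleReal := by
  rw [integrable_semicircleReal]
  exact Continuous.intervalIntegrable (by fun_prop) _ _

theorem integral_sq_semicircleReal :
    ∫ y, 4 * (y - 1 / 2) ^ 2 ∂semicircleReal = 1 / 4 := by
  rw [integral_semicircleReal]
  have h : ∀ θ : ℝ, (4 / Real.pi * Real.sin (2 * θ) ^ 2) • (4 * (Real.cos θ ^ 2 - 1 / 2) ^ 2) =
      4 / Real.pi * (Real.sin (2 * θ) ^ 2 * Real.cos (2 * θ) ^ 2) := by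
    intro θ
    rw [Real.cos_two_mul, smul_eq_mul]
    ring
  simp only [h]
  rw [intervalIntegral.integral_const_mul, intervalIntegral.integral_comp_mul_left
    (fun x => Real.sin x ^ 2 * Real.cos x ^ 2) two_ne_zero, integral_sin_sq_mul_cos_sq]
  have h1 : Real.sin (4 * (2 * (Real.pi / 2))) = 0 := by
    rw [show 4 * (2 * (Real.pi / 2)) = ((4 : ℕ) : ℝ) * Real.pi by push_cast; ring]
    exact Real.sin_nat_mul_pi 4
  rw [h1]
  have := Real.pi_pos
  simp
  field_simp
  norm_num

theorem ae_inv_sub_eq : ∀ᵐ θ : ℝ, θ ∈ uIoc 0 (Real.pi / 2) →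
    16 / Real.pi * Real.cos θ ^ 2 =
      (4 / Real.pi * Real.sin (2 * θ) ^ 2) • (1 - Real.cos θ ^ 2)⁻¹ := by
  refine ae_of_all _ fun θ hθ => ?_
  have hpi := Real.pi_pos
  rw [uIoc_of_le (by positivity)] at hθ
  have h1 : Real.sin θ ≠ 0 := (Real.sin_pos_of_pos_of_lt_pi hθ.1 (by linarith [hθ.2])).ne'
  rw [← Real.sin_sq, Real.sin_two_mul, smul_eq_mul]
  field_simp
  ring

theorem integrable_inv_one_sub : Integrable (fun y : ℝ => (1 - y)⁻¹) semicircleReal := by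
  rw [integrable_semicircleReal]
  have h : IntervalIntegrable (fun θ => 16 / Real.pi * Real.cos θ ^ 2) volume 0 (Real.pi / 2) :=
    Continuous.intervalIntegrable (by fun_prop) _ _
  refine h.congr_ae ?_
  rw [Filter.EventuallyEq, ae_restrict_iff' measurableSet_uIoc]
  exact ae_inv_sub_eq

/-- The value equals the derivative of `4(t - 1/2)²` at `t = 1`, so the potential is tangent to the
quadratic at the edge. -/
theorem integral_inv_one_sub : ∫ y : ℝ, (1 - y)⁻¹ ∂semicircleReal = 4 := by
  rw [integral_semicircleReal, ← intervalIntegral.integral_congr_ae ae_inv_sub_eq,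
    intervalIntegral.integral_const_mul, integral_cos_sq]
  have := Real.pi_pos
  simp
  field_simp
  norm_num

end Semicircle

/-! ### The logarithmic potential on the whole real line. -/

section Potential

theorem ae_semicircleReal_ne (t : ℝ) : ∀ᵐ y ∂semicircleReal, y ≠ t := by
  simp [ae_iff]

theorem integrable_log_sub (t : ℝ) : Integrable (fun y => Real.log (t - y)) semicircleReal := by
  by_cases ht : t ∈ Icc (0 : ℝ) 1
  · exact integrable_log_sub_of_mem ht
  obtain ⟨c, hc, hcle⟩ : ∃ c : ℝ, 0 < c ∧ ∀ y ∈ Icc (0 : ℝ) 1, c ≤ |t - y| := by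
    rcases lt_or_ge t 0 with h | h
    · refine ⟨-t, by linarith, fun y hy => ?_⟩
      rw [abs_of_nonpos (by linarith [hy.1])]
      linarith [hy.1]
    · have h1 : 1 < t := by
        by_contra h2
        exact ht ⟨h, not_lt.1 h2⟩
      refine ⟨t - 1, by linarith, fun y hy => ?_⟩
      rw [abs_of_nonneg (by linarith [hy.2])]
      linarith [hy.2]
  refine Integrable.of_bound (Measurable.log (by fun_prop)).aestronglyMeasurable
    (max |Real.log c| |Real.log (|t| + 1)|) ?_
  filter_upwards [ae_semicircleReal_mem_Icc] with y hy
  rw [Real.norm_eq_abs, ← Real.log_abs]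
  have h1 := hcle y hy
  have h2 : |t - y| ≤ |t| + 1 := (abs_sub t y).trans (by
    have : |y| ≤ 1 := abs_le.2 ⟨by linarith [hy.1], hy.2⟩
    linarith)
  exact abs_le_max_abs_abs (Real.log_le_log hc h1) (Real.log_le_log (by linarith) h2)

theorem integral_comp_one_sub_semicircleReal (f : ℝ → ℝ) :
    ∫ y, f (1 - y) ∂semicircleReal = ∫ y, f y ∂semicircleReal := by
  rw [integral_semicircleReal_eq, integral_semicircleReal_eq, integral_Icc_eq_integral_Ioc,
    integral_Icc_eq_integral_Ioc, ← intervalIntegral.integral_of_le zero_le_one,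
    ← intervalIntegral.integral_of_le zero_le_one]
  have h := intervalIntegral.integral_comp_sub_left (a := 0) (b := 1)
    (fun x : ℝ => (8 / Real.pi * √(x * (1 - x))) • f x) 1
  simp only [sub_sub_cancel, sub_self, sub_zero] at h
  rw [← h]
  refine intervalIntegral.integral_congr fun x _ => ?_
  simp only [mul_comm]

/-- The logarithmic potential `∫ log |t - y| dμ(y)` of the semicircle law. -/
noncomputable def semicirclePotential (t : ℝ) : ℝ := ∫ y, Real.log (t - y) ∂semicircleReal

theorem semicirclePotential_one_sub (t : ℝ) :
    semicirclePotential (1 - t) = semicirclePotential t := by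
  rw [semicirclePotential, ← integral_comp_one_sub_semicircleReal]
  refine integral_congr_ae (ae_of_all _ fun y => ?_)
  simp only
  rw [← Real.log_neg_eq_log]
  congr 1
  ring

/-- From `log (1 + u) ≤ u`, the potential is at most its value at `1` plus `4(t - 1)`, and the
quadratic lies above this tangent. -/
theorem semicirclePotential_le_of_one_lt {t : ℝ} (ht : 1 < t) :
    semicirclePotential t ≤ 4 * (t - 1 / 2) ^ 2 - 2 * Real.log 2 - 1 / 2 := by
  have h1 : semicirclePotential t ≤
      ∫ y, (Real.log (1 - y) + (t - 1) * (1 - y)⁻¹) ∂semicircleReal := by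
    refine integral_mono_ae (integrable_log_sub t)
      ((integrable_log_sub 1).add (integrable_inv_one_sub.const_mul _)) ?_
    filter_upwards [ae_semicircleReal_mem_Icc, ae_semicircleReal_ne 1] with y hy hy1
    have h2 : 0 < 1 - y := sub_pos.2 (lt_of_le_of_ne hy.2 hy1)
    have h3 : t - y = (1 - y) * (1 + (t - 1) * (1 - y)⁻¹) := by
      field_simp
      ring
    have h4 : 0 < (t - 1) * (1 - y)⁻¹ := mul_pos (by linarith) (by positivity)
    rw [h3, Real.log_mul h2.ne' (by linarith)]
    have := Real.log_le_sub_one_of_pos (show 0 < 1 + (t - 1) * (1 - y)⁻¹ by linarith)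
    linarith
  rw [integral_add (integrable_log_sub 1) (integrable_inv_one_sub.const_mul _),
    integral_const_mul, integral_inv_one_sub,
    integral_log_sub_of_mem (show (1 : ℝ) ∈ Icc (0 : ℝ) 1 by simp)] at h1
  nlinarith [sq_nonneg (t - 1)]

theorem le_semicirclePotential_of_one_lt {t : ℝ} (ht : 1 < t) :
    -2 * Real.log 2 - 1 / 2 ≤ semicirclePotential t := by
  have h1 : ∫ y, Real.log (1 - y) ∂semicircleReal ≤ semicirclePotential t := by
    refine integral_mono_ae (integrable_log_sub 1) (integrable_log_sub t) ?_
    filter_upwards [ae_semicircleReal_mem_Icc, ae_semicircleReal_ne 1] with y hy hy1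
    have h2 : 0 < 1 - y := sub_pos.2 (lt_of_le_of_ne hy.2 hy1)
    exact Real.log_le_log h2 (by linarith)
  rw [integral_log_sub_of_mem (show (1 : ℝ) ∈ Icc (0 : ℝ) 1 by simp)] at h1
  linarith

theorem semicirclePotential_of_mem {t : ℝ} (ht : t ∈ Icc (0 : ℝ) 1) :
    semicirclePotential t = 4 * (t - 1 / 2) ^ 2 - 2 * Real.log 2 - 1 / 2 :=
  integral_log_sub_of_mem ht

theorem semicirclePotential_le (t : ℝ) :
    semicirclePotential t ≤ 4 * (t - 1 / 2) ^ 2 - 2 * Real.log 2 - 1 / 2 := by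
  rcases lt_or_ge t 0 with h | h
  · have := semicirclePotential_le_of_one_lt (t := 1 - t) (by linarith)
    rw [semicirclePotential_one_sub] at this
    linarith
  · rcases lt_or_ge 1 t with h1 | h1
    · exact semicirclePotential_le_of_one_lt h1
    · exact (semicirclePotential_of_mem ⟨h, h1⟩).le

theorem le_semicirclePotential (t : ℝ) : -2 * Real.log 2 - 1 / 2 ≤ semicirclePotential t := by
  rcases lt_or_ge t 0 with h | h
  · have := le_semicirclePotential_of_one_lt (t := 1 - t) (by linarith)
    rwa [semicirclePotential_one_sub] at this
  · rcases lt_or_ge 1 t with h1 | h1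
    · exact le_semicirclePotential_of_one_lt h1
    · rw [semicirclePotential_of_mem ⟨h, h1⟩]
      linarith [sq_nonneg (t - 1 / 2)]

end Potential

/-! ### Boundary values of the `g`-function, the complex energy and the log-density. -/

section ComplexEnergy

variable {ζ₁ ζ₂ lam : ℂ}

theorem continuous_lineCurve (ζ₁ ζ₂ : ℂ) : Continuous (lineCurve ζ₁ ζ₂) := by
  unfold lineCurve
  fun_prop

/-- The affine coordinate along the line. -/
noncomputable def lineCoord (ζ₁ ζ₂ z : ℂ) : ℝ := ((z - ζ₁) / (ζ₂ - ζ₁)).re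

theorem continuous_lineCoord (ζ₁ ζ₂ : ℂ) : Continuous (lineCoord ζ₁ ζ₂) := by
  unfold lineCoord
  simp only [div_eq_mul_inv]
  fun_prop

theorem lineCoord_lineCurve (hζ : ζ₁ ≠ ζ₂) (t : ℝ) :
    lineCoord ζ₁ ζ₂ (lineCurve ζ₁ ζ₂ t) = t := by
  rw [lineCoord, lineCurve, add_sub_cancel_left,
    mul_div_cancel_right₀ _ (sub_ne_zero.2 hζ.symm), Complex.ofReal_re]

theorem measurableEmbedding_lineCurve (hζ : ζ₁ ≠ ζ₂) :
    MeasurableEmbedding (lineCurve ζ₁ ζ₂) :=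
  (continuous_lineCurve ζ₁ ζ₂).measurableEmbedding
    (Function.LeftInverse.injective (lineCoord_lineCurve hζ))

theorem integral_semicircleMeasure (hζ : ζ₁ ≠ ζ₂) (f : ℂ → ℂ) :
    ∫ z, f z ∂semicircleMeasure ζ₁ ζ₂ = ∫ y, f (lineCurve ζ₁ ζ₂ y) ∂semicircleReal := by
  rw [semicircleMeasure_eq_map, (measurableEmbedding_lineCurve hζ).integral_map]

theorem integrable_semicircleMeasure (hζ : ζ₁ ≠ ζ₂) {f : ℂ → ℂ} :
    Integrable f (semicircleMeasure ζ₁ ζ₂) ↔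
      Integrable (fun y => f (lineCurve ζ₁ ζ₂ y)) semicircleReal := by
  rw [semicircleMeasure_eq_map, (measurableEmbedding_lineCurve hζ).integrable_map_iff]
  rfl

theorem lineLog_lineCurve (hζ : ζ₁ ≠ ζ₂) (s : ℂ) (y : ℝ) :
    lineLog ζ₁ ζ₂ lam (ζ₁ + s * (ζ₂ - ζ₁)) (lineCurve ζ₁ ζ₂ y) = lam + Complex.log (s - y) := by
  have h : ζ₂ - ζ₁ ≠ 0 := sub_ne_zero.2 hζ.symm
  rw [lineLog, lineCurve]
  congr 2
  field_simp
  ring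

theorem norm_log_le (z : ℂ) : ‖Complex.log z‖ ≤ |Real.log ‖z‖| + Real.pi := by
  refine (Complex.norm_le_abs_re_add_abs_im _).trans ?_
  rw [Complex.log_re, Complex.log_im]
  exact add_le_add_right (Complex.abs_arg_le_pi z) _

theorem integrable_clog_sub (t : ℝ) :
    Integrable (fun y : ℝ => Complex.log ((t - y : ℝ) : ℂ)) semicircleReal := by
  refine Integrable.mono' ((integrable_log_sub t).abs.add (integrable_const Real.pi))
    (Complex.measurable_log.comp (by fun_prop)).aestronglyMeasurable (ae_of_all _ fun y => ?_)
  refine (norm_log_le _).trans (le_of_eq ?_)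
  rw [Complex.norm_real, Real.norm_eq_abs, Real.log_abs]
  rfl

/-- The boundary value of `∫ log (z - y) dμ(y)` from the upper half-plane. -/
noncomputable def semicircleLogBoundary (t : ℝ) : ℂ :=
  ∫ y : ℝ, Complex.log ((t - y : ℝ) : ℂ) ∂semicircleReal

theorem semicircleLogBoundary_re (t : ℝ) :
    (semicircleLogBoundary t).re = semicirclePotential t := by
  have h := integral_re (𝕜 := ℂ) (integrable_clog_sub t)
  simp only [RCLike.re_eq_complex_re] at h
  rw [semicircleLogBoundary, ← h, semicirclePotential]
  refine integral_congr_ae (ae_of_all _ fun y => ?_)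
  simp only
  rw [Complex.log_re, Complex.norm_real, Real.norm_eq_abs, Real.log_abs]

theorem integrable_clog_sub_of_im_ne_zero {s : ℂ} (hs : s.im ≠ 0) :
    Integrable (fun y : ℝ => Complex.log (s - y)) semicircleReal := by
  refine integrable_semicircleReal_of_continuous ?_
  refine Continuous.clog (by fun_prop) fun y => Or.inr ?_
  simpa using hs

/-- The principal logarithm is continuous from above along its cut, so the upper boundary value is
its own value there. -/
theorem tendsto_clog_add_mul_I {x : ℝ} (hx : x ≠ 0) :
    Tendsto (fun ε : ℝ => Complex.log (x + ε * Complex.I)) (𝓝[>] 0) (𝓝 (Complex.log x)) := by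
  have hc : Tendsto (fun ε : ℝ => (x : ℂ) + ε * Complex.I) (𝓝 0) (𝓝 x) := by
    have : Continuous fun ε : ℝ => (x : ℂ) + ε * Complex.I := by fun_prop
    simpa using this.tendsto 0
  rcases lt_or_gt_of_ne hx with h | h
  · have h1 := Complex.continuousWithinAt_log_of_re_neg_of_im_zero (z := (x : ℂ)) (by simpa using h)
      (by simp)
    refine Tendsto.comp h1 (tendsto_nhdsWithin_iff.2 ⟨hc.mono_left nhdsWithin_le_nhds, ?_⟩)
    filter_upwards [self_mem_nhdsWithin] with ε hε
    simpa using (mem_Ioi.1 hε).le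
  · have h1 : (x : ℂ) ∈ Complex.slitPlane := Or.inl (by simpa using h)
    exact ((continuousAt_clog h1).tendsto.comp hc).mono_left nhdsWithin_le_nhds

/-- Dominated convergence: a displacement by `iε` only increases the modulus, so `|t - y|` and `|t|
+ 2` bound it for `ε < 1`. -/
theorem tendsto_integral_clog (t : ℝ) :
    Tendsto (fun ε : ℝ => ∫ y : ℝ, Complex.log (((t : ℂ) + ε * Complex.I) - y) ∂semicircleReal)
      (𝓝[>] 0) (𝓝 (semicircleLogBoundary t)) := by
  refine tendsto_integral_filter_of_dominated_convergence
    (fun y => |Real.log (t - y)| + |Real.log (|t| + 2)| + Real.pi)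
    (Eventually.of_forall fun ε =>
      (Complex.measurable_log.comp (by fun_prop)).aestronglyMeasurable) ?_
    (((integrable_log_sub t).abs.add (integrable_const _)).add (integrable_const _)) ?_
  · filter_upwards [Ioo_mem_nhdsGT (zero_lt_one' ℝ)] with ε hε
    filter_upwards [ae_semicircleReal_mem_Icc, ae_semicircleReal_ne t] with y hy hyt
    have hty : 0 < |t - y| := abs_pos.2 (sub_ne_zero.2 hyt.symm)
    have h1 : |t - y| ≤ ‖((t : ℂ) + ε * Complex.I) - y‖ := by
      have := Complex.abs_re_le_norm (((t : ℂ) + ε * Complex.I) - y)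
      simpa using this
    have h2 : ‖((t : ℂ) + ε * Complex.I) - y‖ ≤ |t| + 2 := by
      refine (norm_sub_le _ _).trans ((add_le_add_left (norm_add_le _ _) _).trans ?_)
      rw [norm_mul, Complex.norm_I, mul_one, Complex.norm_real, Complex.norm_real,
        Complex.norm_real, Real.norm_eq_abs, Real.norm_eq_abs, Real.norm_eq_abs,
        abs_of_pos hε.1, abs_of_nonneg hy.1]
      linarith [hε.2, hy.2]
    refine (norm_log_le _).trans (add_le_add_left ?_ _)
    refine (abs_le_max_abs_abs (Real.log_le_log hty h1)
      (Real.log_le_log (hty.trans_le h1) h2)).trans ?_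
    rw [Real.log_abs]
    exact max_le_add_of_nonneg (abs_nonneg _) (abs_nonneg _)
  · filter_upwards [ae_semicircleReal_ne t] with y hyt
    have h := tendsto_clog_add_mul_I (sub_ne_zero.2 hyt.symm)
    refine h.congr fun ε => ?_
    congr 1
    push_cast
    ring

theorem gFunction_semicircleMeasure (hζ : ζ₁ ≠ ζ₂) {s : ℂ} (hs : s.im ≠ 0) :
    gFunction (lineLog ζ₁ ζ₂ lam) (semicircleMeasure ζ₁ ζ₂) (ζ₁ + s * (ζ₂ - ζ₁)) =
      -(lam + ∫ y : ℝ, Complex.log (s - y) ∂semicircleReal) := by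
  rw [gFunction, integral_semicircleMeasure hζ]
  simp only [lineLog_lineCurve hζ]
  rw [integral_add (integrable_const _) (integrable_clog_sub_of_im_ne_zero hs), integral_const]
  simp

/-- The logarithmic integrals on the two sides are conjugate, so the mean of the boundary values is
`-lam` minus the real potential. On the support this cancels one of the two copies of `4(y - 1/2)²`;
the other has mean `1/4`. -/
theorem hasComplexEnergy_semicircleMeasure (hζ : ζ₁ ≠ ζ₂) (V : Polynomial ℂ) (lam : ℂ) :
    HasComplexEnergy (lineCurve ζ₁ ζ₂) (lineLog ζ₁ ζ₂ lam) (quadraticPotential V ζ₁ ζ₂)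
      (semicircleMeasure ζ₁ ζ₂)
      (-lam + ((2 * Real.log 2 + 3 / 4 : ℝ) : ℂ) + 2 * V.eval ((ζ₁ + ζ₂) / 2)) := by
  have h0 : ζ₂ - ζ₁ ≠ 0 := sub_ne_zero.2 hζ.symm
  have hsum : ∀ᵐ y ∂semicircleReal,
      1 / 2 * -(lam + semicircleLogBoundary (lineCoord ζ₁ ζ₂ (lineCurve ζ₁ ζ₂ y))) +
        1 / 2 * -(lam + (starRingEnd ℂ)
          (semicircleLogBoundary (lineCoord ζ₁ ζ₂ (lineCurve ζ₁ ζ₂ y)))) +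
        2 * quadraticPotential V ζ₁ ζ₂ (lineCurve ζ₁ ζ₂ y) =
      (-lam + ((2 * Real.log 2 + 1 / 2 : ℝ) : ℂ) + 2 * V.eval ((ζ₁ + ζ₂) / 2)) +
        ((4 * (y - 1 / 2) ^ 2 : ℝ) : ℂ) := by
    filter_upwards [ae_semicircleReal_mem_Icc] with y hy
    have h1 : semicircleLogBoundary y + (starRingEnd ℂ) (semicircleLogBoundary y) =
        2 * ((4 * (y - 1 / 2) ^ 2 - 2 * Real.log 2 - 1 / 2 : ℝ) : ℂ) := by
      rw [Complex.add_conj, semicircleLogBoundary_re, semicirclePotential_of_mem hy]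
      push_cast
      ring
    rw [lineCoord_lineCurve hζ, quadraticPotential_lineCurve hζ]
    push_cast at h1 ⊢
    linear_combination (-1 / 2) * h1
  have hi : Integrable (fun y : ℝ => ((4 * (y - 1 / 2) ^ 2 : ℝ) : ℂ)) semicircleReal :=
    integrable_semicircleReal_of_continuous (by fun_prop)
  refine ⟨fun z hz => ?_, fun z => -(lam + semicircleLogBoundary (lineCoord ζ₁ ζ₂ z)),
    fun z => -(lam + (starRingEnd ℂ) (semicircleLogBoundary (lineCoord ζ₁ ζ₂ z))),
    fun t => ?_, fun t => ?_, ?_, ?_⟩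
  · rw [integrable_semicircleMeasure hζ]
    obtain ⟨s, rfl⟩ : ∃ s, z = ζ₁ + s * (ζ₂ - ζ₁) :=
      ⟨(z - ζ₁) / (ζ₂ - ζ₁), by field_simp; ring⟩
    simp only [lineLog_lineCurve hζ]
    refine (integrable_const _).add (integrable_clog_sub_of_im_ne_zero fun hs => hz ?_)
    refine ⟨s.re, ?_⟩
    rw [lineCurve, show ((s.re : ℝ) : ℂ) = s from Complex.ext (by simp) (by simp [hs])]
  · simp only [lineCoord_lineCurve hζ]
    refine ((tendsto_integral_clog t).const_add lam).neg.congr' ?_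
    filter_upwards [self_mem_nhdsWithin] with ε hε
    rw [deriv_lineCurve, ← gFunction_semicircleMeasure hζ (by simpa using (mem_Ioi.1 hε).ne')]
    congr 1
    rw [lineCurve]
    ring
  · simp only [lineCoord_lineCurve hζ]
    have h1 := (Complex.continuous_conj.tendsto _).comp (tendsto_integral_clog t)
    refine (h1.const_add lam).neg.congr' ?_
    filter_upwards [self_mem_nhdsWithin] with ε hε
    have hε' : ε ≠ 0 := (mem_Ioi.1 hε).ne'
    have h2 : (starRingEnd ℂ) (∫ y : ℝ, Complex.log (((t : ℂ) + ε * Complex.I) - y)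
        ∂semicircleReal) =
        ∫ y : ℝ, Complex.log (((t : ℂ) - ε * Complex.I) - y) ∂semicircleReal := by
      rw [← integral_conj]
      refine integral_congr_ae (ae_of_all _ fun y => ?_)
      simp only
      rw [← Complex.log_conj]
      · simp [sub_eq_add_neg]
      · intro harg
        have := (Complex.arg_eq_pi_iff.1 harg).2
        simp at this
        exact hε' this
    rw [Function.comp_apply, h2, deriv_lineCurve,
      ← gFunction_semicircleMeasure hζ (by simpa using hε')]
    congr 1
    rw [lineCurve]
    ring
  · rw [integrable_semicircleMeasure hζ]
    exact ((integrable_const _).add hi).congr (hsum.mono fun y hy => hy.symm)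
  · rw [integral_semicircleMeasure hζ, integral_congr_ae hsum,
      integral_add (integrable_const _) hi, integral_complex_ofReal, integral_sq_semicircleReal,
      integral_const]
    simp
    ring

theorem semicircleReal_eq_withDensity :
    semicircleReal = volume.withDensity
      (fun x => ENNReal.ofReal (8 / Real.pi * √(x * (1 - x)))) := by
  rw [semicircleReal, ← withDensity_indicator measurableSet_Icc]
  congr 1
  ext x
  rw [indicator_apply]
  split_ifs with h
  · rfl
  · have h1 : x * (1 - x) ≤ 0 := by
      rcases lt_or_ge x 0 with h2 | h2
      · nlinarith
      · have h3 : 1 < x := by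
          by_contra h4
          exact h ⟨h2, not_lt.1 h4⟩
        nlinarith
    simp [Real.sqrt_eq_zero_of_nonpos h1]

theorem integrable_semicircleDensity :
    Integrable fun x : ℝ => 8 / Real.pi * √(x * (1 - x)) := by
  have h1 : ∫⁻ x : ℝ, ENNReal.ofReal (8 / Real.pi * √(x * (1 - x))) = 1 := by
    have := isProbabilityMeasure_semicircleReal.measure_univ
    rwa [semicircleReal_eq_withDensity, withDensity_apply _ MeasurableSet.univ,
      Measure.restrict_univ] at this
  refine ⟨by fun_prop, ?_⟩
  rw [hasFiniteIntegral_iff_ofReal (ae_of_all _ semicircleDensity_nonneg), h1]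
  exact ENNReal.one_lt_top

/-- The logarithm of the density is `log (8/π)` plus half of `log y + log (1 - y)`, so its integral
is given by the potential at the two endpoints; `log (0 - y)` is written for `log y` to match. -/
theorem hasLogDensityIntegral_semicircleMeasure (hζ : ζ₁ ≠ ζ₂) (lam : ℂ) :
    HasLogDensityIntegral (lineCurve ζ₁ ζ₂) (lineDensityLog ζ₁ ζ₂ lam) (semicircleMeasure ζ₁ ζ₂)
      (-lam + ((Real.log 2 - Real.log Real.pi + 1 / 2 : ℝ) : ℂ)) := by
  have h0 : ζ₂ - ζ₁ ≠ 0 := sub_ne_zero.2 hζ.symm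
  set w : ℝ → ℝ := fun x => 8 / Real.pi * √(x * (1 - x)) with hw
  set ρ : ℂ → ℂ := fun z => (w (lineCoord ζ₁ ζ₂ z) : ℂ) / (ζ₂ - ζ₁) with hρ
  have hρw : ∀ t, ρ (lineCurve ζ₁ ζ₂ t) * (ζ₂ - ζ₁) = w t := by
    intro t
    simp only [hρ, lineCoord_lineCurve hζ]
    field_simp
  have hlog : ∀ᵐ y ∂semicircleReal, lineDensityLog ζ₁ ζ₂ lam (ρ (lineCurve ζ₁ ζ₂ y)) =
      ((Real.log (8 / Real.pi) + 1 / 2 * (Real.log (0 - y) + Real.log (1 - y)) : ℝ) : ℂ) +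
        -lam := by
    filter_upwards [ae_semicircleReal_mem_Icc, ae_semicircleReal_ne 0, ae_semicircleReal_ne 1]
      with y hy hy0 hy1
    have h1 : 0 < y := lt_of_le_of_ne hy.1 hy0.symm
    have h2 : 0 < 1 - y := sub_pos.2 (lt_of_le_of_ne hy.2 hy1)
    rw [lineDensityLog, hρw, ← Complex.ofReal_log (semicircleDensity_nonneg y), sub_eq_add_neg,
      Real.log_mul (by positivity) (by positivity), Real.log_sqrt (by positivity),
      Real.log_mul h1.ne' h2.ne', zero_sub, Real.log_neg_eq_log]
    congr 2
    ring
  have hl : Integrable (fun y : ℝ => Real.log (0 - y) + Real.log (1 - y)) semicircleReal :=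
    (integrable_log_sub 0).add (integrable_log_sub 1)
  have hi : Integrable (fun y : ℝ => Real.log (8 / Real.pi) +
      1 / 2 * (Real.log (0 - y) + Real.log (1 - y))) semicircleReal :=
    (integrable_const _).add (hl.const_mul _)
  refine ⟨ρ, ⟨?_, ?_, fun s hs => ?_⟩, ?_, ?_⟩
  · refine Continuous.continuousOn ?_
    have := continuous_lineCoord ζ₁ ζ₂
    simp only [hρ, hw, div_eq_mul_inv]
    fun_prop
  · simp only [deriv_lineCurve, hρw]
    exact integrable_semicircleDensity.ofReal
  · simp only [deriv_lineCurve, hρw]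
    have hs' : MeasurableSet (lineCurve ζ₁ ζ₂ ⁻¹' s) :=
      (continuous_lineCurve ζ₁ ζ₂).measurable hs
    rw [integral_complex_ofReal, semicircleMeasure_eq_map,
      (measurableEmbedding_lineCurve hζ).map_apply, semicircleReal_eq_withDensity,
      withDensity_apply _ hs', ← ofReal_integral_eq_lintegral_ofReal
        integrable_semicircleDensity.integrableOn (ae_of_all _ semicircleDensity_nonneg),
      ENNReal.toReal_ofReal (integral_nonneg semicircleDensity_nonneg)]
  · rw [integrable_semicircleMeasure hζ]
    exact (hi.ofReal.add (integrable_const _)).congr (hlog.mono fun y hy => hy.symm)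
  · rw [integral_semicircleMeasure hζ, integral_congr_ae hlog, integral_add hi.ofReal
      (integrable_const _), integral_complex_ofReal, integral_add (integrable_const _)
      (hl.const_mul _), integral_const_mul,
      integral_add (integrable_log_sub 0) (integrable_log_sub 1),
      integral_log_sub_of_mem (show (1 : ℝ) ∈ Icc (0 : ℝ) 1 by simp),
      integral_log_sub_of_mem (show (0 : ℝ) ∈ Icc (0 : ℝ) 1 by simp), integral_const,
      integral_const]
    have h8 : Real.log (8 / Real.pi) = 3 * Real.log 2 - Real.log Real.pi := by
      rw [Real.log_div (by norm_num) (by positivity), show (8 : ℝ) = 2 ^ 3 by norm_num,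
        Real.log_pow]
      push_cast
      ring
    rw [h8]
    simp
    ring

end ComplexEnergy

/-! ### Positivity of the logarithmic energy -/

section Positivity

open ProbabilityTheory

theorem integrableOn_frullani_exp {a : ℝ} (ha : 0 < a) :
    IntegrableOn (fun s : ℝ => s⁻¹ * (Real.exp (-s) - Real.exp (-(a * s)))) (Ioi 0) := by
  have hc : 0 < min 1 a := lt_min one_pos ha
  refine Integrable.mono' ((exp_neg_integrableOn_Ioi 0 hc).const_mul |a - 1|)
    (by fun_prop) ?_
  refine (ae_restrict_iff' measurableSet_Ioi).2 (ae_of_all _ fun s hs => ?_)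
  have hs : 0 < s := hs
  have key : ∀ u v : ℝ, u ≤ v → |Real.exp (-u) - Real.exp (-v)| ≤ (v - u) * Real.exp (-u) := by
    intro u v huv
    have h1 : Real.exp (-v) = Real.exp (-u) * Real.exp (-(v - u)) := by
      rw [← Real.exp_add]
      ring_nf
    have h2 := Real.add_one_le_exp (-(v - u))
    have h3 : Real.exp (-v) ≤ Real.exp (-u) := Real.exp_le_exp.2 (by linarith)
    rw [abs_of_nonneg (by linarith), h1]
    nlinarith [Real.exp_pos (-u)]
  have h4 : |Real.exp (-s) - Real.exp (-(a * s))| ≤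
      s * (|a - 1| * Real.exp (-(min 1 a) * s)) := by
    rcases le_total 1 a with h | h
    · have := key s (a * s) (by nlinarith)
      rw [min_eq_left h, abs_of_nonneg (by linarith : 0 ≤ a - 1), neg_one_mul]
      linarith
    · have := key (a * s) s (by nlinarith)
      rw [min_eq_right h, abs_of_nonpos (by linarith : a - 1 ≤ 0), abs_sub_comm, neg_mul]
      refine this.trans (le_of_eq ?_)
      rw [neg_mul]
      ring
  rw [norm_mul, norm_inv, Real.norm_of_nonneg hs.le, Real.norm_eq_abs]
  rwa [inv_mul_le_iff₀ hs]

theorem integral_frullani_exp {a : ℝ} (ha : 0 < a) :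
    ∫ s in Ioi (0 : ℝ), s⁻¹ * (Real.exp (-s) - Real.exp (-(a * s))) = Real.log a := by
  have hcont : Continuous fun s : ℝ => Real.exp (-s) := by fun_prop
  have h := Frullani.integral_Ioi_eq (f := fun s : ℝ => Real.exp (-s)) (L := 1) (R := 0)
    (hcont.locallyIntegrable.locallyIntegrableOn _) one_pos ha
    (by simpa using (hcont.tendsto 0).mono_left nhdsWithin_le_nhds)
    (Real.tendsto_exp_neg_atTop_nhds_zero) (by simpa using integrableOn_frullani_exp ha)
  simpa using h

/-- The integrand has a constant sign. Consequently integrability of the logarithm is all that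
Fubini requires. -/
theorem integral_norm_frullani_exp {a : ℝ} (ha : 0 < a) :
    ∫ s in Ioi (0 : ℝ), ‖s⁻¹ * (Real.exp (-s) - Real.exp (-(a * s)))‖ = |Real.log a| := by
  rcases le_total 1 a with h | h
  · rw [abs_of_nonneg (Real.log_nonneg h), ← integral_frullani_exp ha]
    refine setIntegral_congr_fun measurableSet_Ioi fun s hs => Real.norm_of_nonneg ?_
    have hs : 0 < s := hs
    refine mul_nonneg (by positivity) (sub_nonneg.2 (Real.exp_le_exp.2 ?_))
    nlinarith
  · rw [abs_of_nonpos (Real.log_nonpos ha.le h), ← integral_frullani_exp ha, ← integral_neg]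
    refine setIntegral_congr_fun measurableSet_Ioi fun s hs => Real.norm_of_nonpos ?_
    have hs : 0 < s := hs
    refine mul_nonpos_of_nonneg_of_nonpos (by positivity) (sub_nonpos.2 (Real.exp_le_exp.2 ?_))
    nlinarith

/-- The mutual Gaussian energy of two measures. -/
noncomputable def gaussianEnergy (α β : Measure ℝ) (s : ℝ) : ℝ :=
  ∫ p : ℝ × ℝ, Real.exp (-((p.1 - p.2) ^ 2 * s)) ∂(α.prod β)

/-- The mutual logarithmic energy of two measures, without the minus sign. -/
noncomputable def mutualLog (α β : Measure ℝ) : ℝ :=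
  ∫ p : ℝ × ℝ, Real.log (p.1 - p.2) ∂(α.prod β)

variable {α β μ ν : Measure ℝ} [IsProbabilityMeasure α] [IsProbabilityMeasure β]
  [IsProbabilityMeasure μ] [IsProbabilityMeasure ν]

theorem integrable_exp_neg_sq_mul {s : ℝ} (hs : 0 ≤ s) :
    Integrable (fun p : ℝ × ℝ => Real.exp (-((p.1 - p.2) ^ 2 * s))) (α.prod β) := by
  refine Integrable.of_bound (by fun_prop) 1 (ae_of_all _ fun p => ?_)
  rw [Real.norm_of_nonneg (Real.exp_pos _).le]
  exact Real.exp_le_one_iff.2 (neg_nonpos.2 (by positivity))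

theorem integrable_prod_frullani {α β : Measure ℝ} [SFinite α] [SFinite β]
    (hne : ∀ᵐ p ∂α.prod β, p.1 ≠ p.2)
    (hint : Integrable (fun p : ℝ × ℝ => Real.log (p.1 - p.2)) (α.prod β)) :
    Integrable (fun q : (ℝ × ℝ) × ℝ =>
      q.2⁻¹ * (Real.exp (-q.2) - Real.exp (-((q.1.1 - q.1.2) ^ 2 * q.2))))
      ((α.prod β).prod (volume.restrict (Ioi 0))) := by
  have hm : Measurable (fun q : (ℝ × ℝ) × ℝ =>
      q.2⁻¹ * (Real.exp (-q.2) - Real.exp (-((q.1.1 - q.1.2) ^ 2 * q.2)))) := by fun_prop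
  rw [integrable_prod_iff hm.aestronglyMeasurable]
  constructor
  · filter_upwards [hne] with p hp
    exact integrableOn_frullani_exp (sq_pos_of_ne_zero (sub_ne_zero.2 hp))
  · refine (hint.abs.const_mul 2).congr ?_
    filter_upwards [hne] with p hp
    rw [integral_norm_frullani_exp (sq_pos_of_ne_zero (sub_ne_zero.2 hp)), Real.log_pow, abs_mul]
    simp

theorem integral_frullani_prod {s : ℝ} (hs : 0 < s) :
    ∫ p : ℝ × ℝ, s⁻¹ * (Real.exp (-s) - Real.exp (-((p.1 - p.2) ^ 2 * s))) ∂(α.prod β) =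
      s⁻¹ * (Real.exp (-s) - gaussianEnergy α β s) := by
  rw [integral_const_mul, integral_sub (integrable_const _) (integrable_exp_neg_sq_mul hs.le),
    integral_const, gaussianEnergy]
  simp

theorem integrableOn_gaussianEnergy (hne : ∀ᵐ p ∂α.prod β, p.1 ≠ p.2)
    (hint : Integrable (fun p : ℝ × ℝ => Real.log (p.1 - p.2)) (α.prod β)) :
    IntegrableOn (fun s => s⁻¹ * (Real.exp (-s) - gaussianEnergy α β s)) (Ioi 0) := by
  refine (integrable_prod_frullani hne hint).integral_prod_right.congr ?_
  refine (ae_restrict_iff' measurableSet_Ioi).2 (ae_of_all _ fun s hs => ?_)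
  exact integral_frullani_prod hs

theorem integral_gaussianEnergy (hne : ∀ᵐ p ∂α.prod β, p.1 ≠ p.2)
    (hint : Integrable (fun p : ℝ × ℝ => Real.log (p.1 - p.2)) (α.prod β)) :
    ∫ s in Ioi (0 : ℝ), s⁻¹ * (Real.exp (-s) - gaussianEnergy α β s) = 2 * mutualLog α β := by
  have h := integral_integral_swap
    (f := fun (p : ℝ × ℝ) (s : ℝ) => s⁻¹ * (Real.exp (-s) - Real.exp (-((p.1 - p.2) ^ 2 * s))))
    (integrable_prod_frullani hne hint)
  rw [setIntegral_congr_fun measurableSet_Ioi fun s hs => (integral_frullani_prod hs).symm, ← h,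
    mutualLog, ← integral_const_mul]
  refine integral_congr_ae ?_
  filter_upwards [hne] with p hp
  rw [integral_frullani_exp (sq_pos_of_ne_zero (sub_ne_zero.2 hp)), Real.log_pow]
  norm_num

theorem charFun_mul_conj_charFun (t : ℝ) :
    charFun α t * (starRingEnd ℂ) (charFun β t) =
      ∫ p : ℝ × ℝ, Complex.exp (t * (p.1 - p.2 : ℝ) * Complex.I) ∂(α.prod β) := by
  rw [charFun_apply_real, charFun_apply_real, ← integral_conj, ← integral_prod_mul]
  refine integral_congr_ae (ae_of_all _ fun p => ?_)
  simp only
  rw [← Complex.exp_conj, ← Complex.exp_add]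
  congr 1
  simp
  ring

/-- The kernel `exp (-s(x-y)²)` is the characteristic function at `x - y` of the centred normal law
of variance `2s`. -/
theorem integral_charFun_mul_conj {s : ℝ} (hs : 0 < s) :
    ∫ t, charFun α t * (starRingEnd ℂ) (charFun β t) ∂(gaussianReal 0 (2 * s).toNNReal) =
      gaussianEnergy α β s := by
  have hint : Integrable (fun q : ℝ × (ℝ × ℝ) =>
      Complex.exp (q.1 * (q.2.1 - q.2.2 : ℝ) * Complex.I))
      ((gaussianReal 0 (2 * s).toNNReal).prod (α.prod β)) := by
    refine Integrable.of_bound (by fun_prop) 1 (ae_of_all _ fun q => ?_)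
    rw [← Complex.ofReal_mul, Complex.norm_exp_ofReal_mul_I]
  have h := integral_integral_swap
    (f := fun (t : ℝ) (p : ℝ × ℝ) => Complex.exp (t * (p.1 - p.2 : ℝ) * Complex.I)) hint
  simp only [charFun_mul_conj_charFun]
  rw [h, gaussianEnergy, ← integral_complex_ofReal]
  refine integral_congr_ae (ae_of_all _ fun p => ?_)
  have h1 := charFun_gaussianReal (μ := 0) (v := (2 * s).toNNReal) (p.1 - p.2)
  rw [charFun_apply_real] at h1
  simp only
  simp only [mul_comm _ ((p.1 - p.2 : ℝ) : ℂ)] at h1 ⊢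
  rw [h1, Complex.ofReal_exp, Real.coe_toNNReal _ (by positivity)]
  congr 1
  push_cast
  ring

theorem integrable_charFun_mul_conj (γ : Measure ℝ) [IsFiniteMeasure γ] :
    Integrable (fun t => charFun α t * (starRingEnd ℂ) (charFun β t)) γ := by
  have h1 : Measurable (charFun α) := measurable_charFun
  have h2 : Measurable (charFun β) := measurable_charFun
  refine Integrable.of_bound
    (h1.mul (Complex.continuous_conj.measurable.comp h2)).aestronglyMeasurable 1
    (ae_of_all _ fun t => ?_)
  rw [norm_mul, Complex.norm_conj]
  exact mul_le_one₀ (norm_charFun_le_one _) (norm_nonneg _) (norm_charFun_le_one _)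

theorem gaussianEnergy_comm (s : ℝ) : gaussianEnergy α β s = gaussianEnergy β α s := by
  rw [gaussianEnergy, gaussianEnergy, ← integral_prod_swap]
  refine integral_congr_ae (ae_of_all _ fun p => ?_)
  simp only [Prod.fst_swap, Prod.snd_swap]
  congr 2
  ring

theorem integral_norm_charFun_sub_sq {s : ℝ} (hs : 0 < s) :
    ∫ t, ‖charFun μ t - charFun ν t‖ ^ 2 ∂(gaussianReal 0 (2 * s).toNNReal) =
      gaussianEnergy μ μ s - 2 * gaussianEnergy μ ν s + gaussianEnergy ν ν s := by
  set γ := gaussianReal 0 (2 * s).toNNReal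
  have h1 : ∀ t, ((‖charFun μ t - charFun ν t‖ ^ 2 : ℝ) : ℂ) =
      (charFun μ t * (starRingEnd ℂ) (charFun μ t) - charFun μ t * (starRingEnd ℂ) (charFun ν t)) -
      (charFun ν t * (starRingEnd ℂ) (charFun μ t) -
        charFun ν t * (starRingEnd ℂ) (charFun ν t)) := by
    intro t
    push_cast
    rw [← Complex.mul_conj', map_sub]
    ring
  have i1 : Integrable (fun t => charFun μ t * (starRingEnd ℂ) (charFun μ t)) γ :=
    integrable_charFun_mul_conj γ
  have i2 : Integrable (fun t => charFun μ t * (starRingEnd ℂ) (charFun ν t)) γ :=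
    integrable_charFun_mul_conj γ
  have i3 : Integrable (fun t => charFun ν t * (starRingEnd ℂ) (charFun μ t)) γ :=
    integrable_charFun_mul_conj γ
  have i4 : Integrable (fun t => charFun ν t * (starRingEnd ℂ) (charFun ν t)) γ :=
    integrable_charFun_mul_conj γ
  have i12 : Integrable (fun t => charFun μ t * (starRingEnd ℂ) (charFun μ t) -
      charFun μ t * (starRingEnd ℂ) (charFun ν t)) γ := i1.sub i2
  have i34 : Integrable (fun t => charFun ν t * (starRingEnd ℂ) (charFun μ t) -
      charFun ν t * (starRingEnd ℂ) (charFun ν t)) γ := i3.sub i4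
  have h2 : ((∫ t, ‖charFun μ t - charFun ν t‖ ^ 2 ∂γ : ℝ) : ℂ) =
      ((gaussianEnergy μ μ s - 2 * gaussianEnergy μ ν s + gaussianEnergy ν ν s : ℝ) : ℂ) := by
    rw [← integral_complex_ofReal]
    simp only [h1]
    rw [integral_sub i12 i34, integral_sub i1 i2, integral_sub i3 i4,
      integral_charFun_mul_conj hs, integral_charFun_mul_conj hs, integral_charFun_mul_conj hs,
      integral_charFun_mul_conj hs, gaussianEnergy_comm (α := ν) (β := μ)]
    push_cast
    ring
  exact_mod_cast h2

/-- The energy is the integral of `|charFun μ - charFun ν|²` against a normal law, which charges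
every open set; by continuity the characteristic functions coincide. A single `s` suffices. -/
theorem eq_of_gaussianEnergy_eq_zero {s : ℝ} (hs : 0 < s)
    (h : gaussianEnergy μ μ s - 2 * gaussianEnergy μ ν s + gaussianEnergy ν ν s = 0) : μ = ν := by
  have hc : Continuous fun t : ℝ => ‖charFun μ t - charFun ν t‖ ^ 2 :=
    ((continuous_charFun.sub continuous_charFun).norm).pow 2
  rw [← integral_norm_charFun_sub_sq hs, integral_eq_zero_iff_of_nonneg
    (fun t => by positivity) (Integrable.of_bound hc.aestronglyMeasurable (2 ^ 2)
      (ae_of_all _ fun t => by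
        rw [norm_pow, norm_norm]
        refine pow_le_pow_left₀ (norm_nonneg _) ((norm_sub_le _ _).trans ?_) 2
        linarith [norm_charFun_le_one (μ := μ) t, norm_charFun_le_one (μ := ν) t]))] at h
  have h1 : (fun t : ℝ => ‖charFun μ t - charFun ν t‖ ^ 2) =ᵐ[volume] 0 :=
    (gaussianReal_absolutelyContinuous' 0
      (by simpa using hs : (2 * s).toNNReal ≠ 0)).ae_le h
  have h2 := (hc.ae_eq_iff_eq volume continuous_const).1 h1
  refine Measure.ext_of_charFun (funext fun t => ?_)
  have h3 : ‖charFun μ t - charFun ν t‖ ^ 2 = 0 := congrFun h2 t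
  exact sub_eq_zero.1 (norm_eq_zero.1 ((pow_eq_zero_iff two_ne_zero).1 h3))

/-- The logarithmic energy of a difference of probability measures is positive definite. -/
theorem mutualLog_positive (hne₁ : ∀ᵐ p ∂μ.prod μ, p.1 ≠ p.2) (hne₂ : ∀ᵐ p ∂μ.prod ν, p.1 ≠ p.2)
    (hne₃ : ∀ᵐ p ∂ν.prod ν, p.1 ≠ p.2)
    (h₁ : Integrable (fun p : ℝ × ℝ => Real.log (p.1 - p.2)) (μ.prod μ))
    (h₂ : Integrable (fun p : ℝ × ℝ => Real.log (p.1 - p.2)) (μ.prod ν))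
    (h₃ : Integrable (fun p : ℝ × ℝ => Real.log (p.1 - p.2)) (ν.prod ν)) :
    0 ≤ -mutualLog μ μ + 2 * mutualLog μ ν - mutualLog ν ν ∧
      (-mutualLog μ μ + 2 * mutualLog μ ν - mutualLog ν ν = 0 → μ = ν) := by
  have i1 := integrableOn_gaussianEnergy hne₁ h₁
  have i2 := integrableOn_gaussianEnergy hne₂ h₂
  have i3 := integrableOn_gaussianEnergy hne₃ h₃
  -- In this combination the terms `exp (-s)` of Frullani's formula cancel.
  set Q : ℝ → ℝ := fun s =>
    s⁻¹ * (gaussianEnergy μ μ s - 2 * gaussianEnergy μ ν s + gaussianEnergy ν ν s) with hQ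
  have hQe : ∀ s, Q s = 2 * (s⁻¹ * (Real.exp (-s) - gaussianEnergy μ ν s)) -
      s⁻¹ * (Real.exp (-s) - gaussianEnergy μ μ s) -
      s⁻¹ * (Real.exp (-s) - gaussianEnergy ν ν s) := by
    intro s
    simp only [hQ]
    ring
  have hQi : IntegrableOn Q (Ioi 0) := by
    rw [funext hQe]
    exact ((i2.const_mul 2).sub i1).sub i3
  have hQv : ∫ s in Ioi 0, Q s = 2 * (-mutualLog μ μ + 2 * mutualLog μ ν - mutualLog ν ν) := by
    have i21 : IntegrableOn (fun s => 2 * (s⁻¹ * (Real.exp (-s) - gaussianEnergy μ ν s)) -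
        s⁻¹ * (Real.exp (-s) - gaussianEnergy μ μ s)) (Ioi 0) := (i2.const_mul 2).sub i1
    simp only [hQe]
    rw [integral_sub i21 i3, integral_sub (i2.const_mul 2) i1,
      integral_const_mul, integral_gaussianEnergy hne₁ h₁, integral_gaussianEnergy hne₂ h₂,
      integral_gaussianEnergy hne₃ h₃]
    ring
  have hQ0 : ∀ s ∈ Ioi (0 : ℝ), 0 ≤ Q s := by
    intro s hs
    have hs : 0 < s := hs
    simp only [hQ]
    rw [← integral_norm_charFun_sub_sq hs]
    positivity
  refine ⟨?_, fun h => ?_⟩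
  · have := setIntegral_nonneg (μ := volume) measurableSet_Ioi hQ0
    rw [hQv] at this
    linarith
  · rw [h, mul_zero, setIntegral_eq_zero_iff_of_nonneg_ae
      ((ae_restrict_iff' measurableSet_Ioi).2 (ae_of_all _ hQ0)) hQi] at hQv
    rw [Filter.EventuallyEq, ae_restrict_iff' measurableSet_Ioi] at hQv
    have hfreq : ∃ᵐ s : ℝ, s ∈ Ioi (0 : ℝ) := by
      rw [frequently_ae_mem_iff]
      simp
    obtain ⟨s, hs, hs0⟩ := (hfreq.and_eventually hQv).exists
    have h3 := hs0 hs
    simp only [hQ, Pi.zero_apply] at h3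
    have hs : 0 < s := hs
    exact eq_of_gaussianEnergy_eq_zero hs ((mul_eq_zero.1 h3).resolve_left (by positivity))

end Positivity

/-! ### The equilibrium measure -/

section Equilibrium

section ExtendedIntegral

variable {α : Type*} [MeasurableSpace α] {π : Measure α} {K : α → EReal} {k : α → ℝ}

theorem lintegral_toENNReal_sub_eq_integral (hK : ∀ᵐ p ∂π, K p = k p) (hk : Integrable k π) :
    ((∫⁻ p, (K p).toENNReal ∂π : ENNReal) : EReal) -
      ((∫⁻ p, (-K p).toENNReal ∂π : ENNReal) : EReal) = ((∫ p, k p ∂π : ℝ) : EReal) := by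
  have h1 : ∫⁻ p, (K p).toENNReal ∂π = ∫⁻ p, ENNReal.ofReal (k p) ∂π := by
    refine lintegral_congr_ae ?_
    filter_upwards [hK] with p hp
    rw [hp, EReal.toENNReal_of_ne_top (EReal.coe_ne_top _), EReal.toReal_coe]
  have h2 : ∫⁻ p, (-K p).toENNReal ∂π = ∫⁻ p, ENNReal.ofReal (-k p) ∂π := by
    refine lintegral_congr_ae ?_
    filter_upwards [hK] with p hp
    rw [hp, ← EReal.coe_neg, EReal.toENNReal_of_ne_top (EReal.coe_ne_top _), EReal.toReal_coe]
  have f1 : ∫⁻ p, ENNReal.ofReal (k p) ∂π ≠ ⊤ := hk.lintegral_lt_top.ne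
  have f2 : ∫⁻ p, ENNReal.ofReal (-k p) ∂π ≠ ⊤ := hk.neg.lintegral_lt_top.ne
  rw [h1, h2, integral_eq_lintegral_pos_part_sub_lintegral_neg_part hk, EReal.coe_sub,
    EReal.coe_ennreal_toReal f1, EReal.coe_ennreal_toReal f2]

/-- The lower bound makes the negative part finite, so the positive part must be finite too. For the
energy this makes the diagonal null. -/
theorem ae_ne_top_and_integrable_of_ne_top [IsFiniteMeasure π] {c : ℝ} (hKm : Measurable K)
    (hkm : Measurable k) (hK : ∀ p, K p = ⊤ ∨ K p = k p) (hc : ∀ p, -c ≤ k p)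
    (h : ((∫⁻ p, (K p).toENNReal ∂π : ENNReal) : EReal) -
      ((∫⁻ p, (-K p).toENNReal ∂π : ENNReal) : EReal) ≠ ⊤) :
    (∀ᵐ p ∂π, K p ≠ ⊤) ∧ Integrable k π := by
  have f2 : ∫⁻ p, (-K p).toENNReal ∂π ≠ ⊤ := by
    have : ∫⁻ p, (-K p).toENNReal ∂π ≤ ∫⁻ _, ENNReal.ofReal c ∂π := by
      refine lintegral_mono fun p => ?_
      rcases hK p with hp | hp
      · simp [hp]
      · rw [hp, ← EReal.coe_neg, EReal.toENNReal_of_ne_top (EReal.coe_ne_top _), EReal.toReal_coe]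
        exact ENNReal.ofReal_le_ofReal (by linarith [hc p])
    refine (this.trans_lt ?_).ne
    rw [lintegral_const]
    exact ENNReal.mul_lt_top ENNReal.ofReal_lt_top (measure_lt_top _ _)
  have f1 : ∫⁻ p, (K p).toENNReal ∂π ≠ ⊤ := by
    intro h1
    apply h
    rw [h1, ← EReal.coe_ennreal_toReal f2]
    simp
  refine ⟨?_, hkm.aestronglyMeasurable, ?_⟩
  · filter_upwards [ae_lt_top hKm.ereal_toENNReal f1] with p hp
    exact fun h => by simp [h] at hp
  · refine lt_of_le_of_lt (b := ∫⁻ p, ((K p).toENNReal + ENNReal.ofReal c) ∂π) ?_ ?_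
    · refine lintegral_mono fun p => ?_
      rcases hK p with hp | hp
      · simp [hp]
      · rw [hp, EReal.toENNReal_of_ne_top (EReal.coe_ne_top _), EReal.toReal_coe,
          Real.enorm_eq_ofReal_abs]
        rcases le_total 0 (k p) with h0 | h0
        · rw [abs_of_nonneg h0]
          exact le_self_add
        · rw [abs_of_nonpos h0]
          exact (ENNReal.ofReal_le_ofReal (by linarith [hc p])).trans le_add_self
    · rw [lintegral_add_right _ measurable_const, lintegral_const]
      exact ENNReal.add_lt_top.2
        ⟨lt_top_iff_ne_top.2 f1, ENNReal.mul_lt_top ENNReal.ofReal_lt_top (measure_lt_top _ _)⟩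

end ExtendedIntegral

/-- The weighted logarithmic kernel in the affine coordinate of the line. -/
noncomputable def lineKernel (C : ℝ) (p : ℝ × ℝ) : ℝ :=
  -Real.log (p.1 - p.2) + 4 * (p.1 - 1 / 2) ^ 2 + 4 * (p.2 - 1 / 2) ^ 2 + C

theorem measurable_lineKernel (C : ℝ) : Measurable (lineKernel C) := by
  unfold lineKernel
  have : Measurable fun p : ℝ × ℝ => Real.log (p.1 - p.2) := Measurable.log (by fun_prop)
  fun_prop

/-- Since `log |x - y| ≤ |x - y|`, the logarithm costs one unit of each quadratic coefficient. The
remaining `3` makes the energy bounded below and controls second moments. -/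
theorem le_lineKernel (C : ℝ) (p : ℝ × ℝ) :
    3 * (p.1 - 1 / 2) ^ 2 + 3 * (p.2 - 1 / 2) ^ 2 - 1 / 2 + C ≤ lineKernel C p := by
  have h1 : Real.log (p.1 - p.2) ≤ |p.1 - p.2| := by
    rw [← Real.log_abs]
    exact Real.log_le_self (abs_nonneg _)
  have h2 : |p.1 - p.2| ≤ (p.1 - 1 / 2) ^ 2 + (p.2 - 1 / 2) ^ 2 + 1 / 2 := by
    rw [abs_le]
    constructor <;> nlinarith [sq_nonneg (p.1 - 1 / 2 - 1 / 2), sq_nonneg (p.1 - 1 / 2 + 1 / 2),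
      sq_nonneg (p.2 - 1 / 2 - 1 / 2), sq_nonneg (p.2 - 1 / 2 + 1 / 2)]
  unfold lineKernel
  linarith

variable {ζ₁ ζ₂ : ℂ} {V : Polynomial ℂ}

open Classical in
theorem energyKernel_lineCurve (hζ : ζ₁ ≠ ζ₂) {C : ℝ}
    (hC : C = -Real.log ‖ζ₂ - ζ₁‖ + 2 * (V.eval ((ζ₁ + ζ₂) / 2)).re) (p : ℝ × ℝ) :
    energyKernel (quadraticPotential V ζ₁ ζ₂) (lineCurve ζ₁ ζ₂ p.1) (lineCurve ζ₁ ζ₂ p.2) =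
      if p.1 = p.2 then ⊤ else ((lineKernel C p : ℝ) : EReal) := by
  have hinj := (measurableEmbedding_lineCurve hζ).injective
  unfold energyKernel
  by_cases h : p.1 = p.2
  · simp [h]
  · rw [if_neg (fun h' => h (hinj h')), if_neg h]
    congr 1
    have h1 : Real.log (1 / ‖lineCurve ζ₁ ζ₂ p.1 - lineCurve ζ₁ ζ₂ p.2‖) =
        -(Real.log (p.1 - p.2) + Real.log ‖ζ₂ - ζ₁‖) := by
      rw [one_div, Real.log_inv, lineCurve_sub, norm_mul,
        Complex.norm_real, Real.log_mul (by simpa [sub_eq_zero] using h)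
          (by simpa [sub_eq_zero] using hζ.symm), Real.norm_eq_abs, Real.log_abs]
    rw [h1, quadraticPotential_lineCurve hζ, quadraticPotential_lineCurve hζ, Complex.add_re,
      Complex.add_re, Complex.ofReal_re, Complex.ofReal_re, lineKernel, hC]
    ring

open Classical in
theorem logEnergy_map_lineCurve (hζ : ζ₁ ≠ ζ₂) {C : ℝ}
    (hC : C = -Real.log ‖ζ₂ - ζ₁‖ + 2 * (V.eval ((ζ₁ + ζ₂) / 2)).re) (ν : Measure ℝ) [SFinite ν] :
    logEnergy (quadraticPotential V ζ₁ ζ₂) (ν.map (lineCurve ζ₁ ζ₂)) =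
      ((∫⁻ p : ℝ × ℝ, (if p.1 = p.2 then (⊤ : EReal) else (lineKernel C p : ℝ)).toENNReal
        ∂(ν.prod ν) : ENNReal) : EReal) -
      ((∫⁻ p : ℝ × ℝ, (-(if p.1 = p.2 then (⊤ : EReal) else (lineKernel C p : ℝ))).toENNReal
        ∂(ν.prod ν) : ENNReal) : EReal) := by
  have hm := (continuous_lineCurve ζ₁ ζ₂).measurable
  have hinj := (measurableEmbedding_lineCurve hζ).injective
  have hme : MeasurableEmbedding (Prod.map (lineCurve ζ₁ ζ₂) (lineCurve ζ₁ ζ₂)) :=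
    ((continuous_lineCurve ζ₁ ζ₂).prodMap (continuous_lineCurve ζ₁ ζ₂)).measurableEmbedding
      (hinj.prodMap hinj)
  rw [logEnergy, Measure.map_prod_map _ _ hm hm, hme.lintegral_map, hme.lintegral_map]
  simp only [Prod.map_fst, Prod.map_snd, energyKernel_lineCurve hζ hC]

variable {ν : Measure ℝ} [IsProbabilityMeasure ν]

theorem logEnergy_map_eq_integral (hζ : ζ₁ ≠ ζ₂) {C : ℝ}
    (hC : C = -Real.log ‖ζ₂ - ζ₁‖ + 2 * (V.eval ((ζ₁ + ζ₂) / 2)).re)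
    (hne : ∀ᵐ p ∂ν.prod ν, p.1 ≠ p.2) (hk : Integrable (lineKernel C) (ν.prod ν)) :
    logEnergy (quadraticPotential V ζ₁ ζ₂) (ν.map (lineCurve ζ₁ ζ₂)) =
      ((∫ p, lineKernel C p ∂(ν.prod ν) : ℝ) : EReal) := by
  rw [logEnergy_map_lineCurve hζ hC]
  refine lintegral_toENNReal_sub_eq_integral ?_ hk
  filter_upwards [hne] with p hp
  rw [if_neg hp]

theorem integrable_lineKernel_of_logEnergy_ne_top (hζ : ζ₁ ≠ ζ₂) {C : ℝ}
    (hC : C = -Real.log ‖ζ₂ - ζ₁‖ + 2 * (V.eval ((ζ₁ + ζ₂) / 2)).re)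
    (h : logEnergy (quadraticPotential V ζ₁ ζ₂) (ν.map (lineCurve ζ₁ ζ₂)) ≠ ⊤) :
    (∀ᵐ p ∂ν.prod ν, p.1 ≠ p.2) ∧ Integrable (lineKernel C) (ν.prod ν) := by
  classical
  rw [logEnergy_map_lineCurve hζ hC] at h
  have h1 := ae_ne_top_and_integrable_of_ne_top (c := 1 / 2 - C)
    (K := fun p : ℝ × ℝ => if p.1 = p.2 then (⊤ : EReal) else (lineKernel C p : ℝ))
    (Measurable.ite (measurableSet_eq_fun measurable_fst measurable_snd) measurable_const
      (measurable_lineKernel C).coe_real_ereal) (measurable_lineKernel C)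
    (fun p => by by_cases hp : p.1 = p.2 <;> simp [hp])
    (fun p => by
      have := le_lineKernel C p
      nlinarith [sq_nonneg (p.1 - 1 / 2), sq_nonneg (p.2 - 1 / 2)]) h
  refine ⟨?_, h1.2⟩
  filter_upwards [h1.1] with p hp hp'
  exact hp (if_pos hp')

theorem integrable_sq_of_lineKernel {C : ℝ} (hk : Integrable (lineKernel C) (ν.prod ν)) :
    Integrable (fun x : ℝ => (x - 1 / 2) ^ 2) ν := by
  have h1 : Integrable (fun p : ℝ × ℝ => (p.1 - 1 / 2) ^ 2) (ν.prod ν) := by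
    refine Integrable.mono' (hk.add (integrable_const (1 / 2 - C))) (by fun_prop)
      (ae_of_all _ fun p => ?_)
    have := le_lineKernel C p
    rw [Real.norm_of_nonneg (sq_nonneg _), Pi.add_apply]
    nlinarith [sq_nonneg (p.1 - 1 / 2), sq_nonneg (p.2 - 1 / 2)]
  have h2 := (measurePreserving_fst (μ := ν) (ν := ν)).integrable_comp
    (g := fun x : ℝ => (x - 1 / 2) ^ 2) (by fun_prop)
  exact h2.1 h1

theorem integrable_log_of_lineKernel {C : ℝ} (hk : Integrable (lineKernel C) (ν.prod ν)) :
    Integrable (fun p : ℝ × ℝ => Real.log (p.1 - p.2)) (ν.prod ν) := by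
  have h0 := (integrable_sq_of_lineKernel hk).const_mul 4
  have h := (((h0.comp_fst ν).add (h0.comp_snd ν)).add (integrable_const C)).sub hk
  refine h.congr (ae_of_all _ fun p => ?_)
  simp only [Pi.sub_apply, Pi.add_apply, lineKernel]
  ring

theorem integrable_lineKernel (C : ℝ) (hs : Integrable (fun x : ℝ => (x - 1 / 2) ^ 2) ν)
    (hl : Integrable (fun p : ℝ × ℝ => Real.log (p.1 - p.2)) (ν.prod ν)) :
    Integrable (lineKernel C) (ν.prod ν) := by
  have h0 := hs.const_mul 4
  exact ((hl.neg.add (h0.comp_fst ν)).add (h0.comp_snd ν)).add (integrable_const C)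

theorem integral_lineKernel (C : ℝ) (hs : Integrable (fun x : ℝ => (x - 1 / 2) ^ 2) ν)
    (hl : Integrable (fun p : ℝ × ℝ => Real.log (p.1 - p.2)) (ν.prod ν)) :
    ∫ p, lineKernel C p ∂(ν.prod ν) =
      -mutualLog ν ν + 2 * ∫ x, 4 * (x - 1 / 2) ^ 2 ∂ν + C := by
  have h0 := hs.const_mul 4
  have i1 : Integrable (fun p : ℝ × ℝ => 4 * (p.1 - 1 / 2) ^ 2) (ν.prod ν) := h0.comp_fst ν
  have i2 : Integrable (fun p : ℝ × ℝ => 4 * (p.2 - 1 / 2) ^ 2) (ν.prod ν) := h0.comp_snd ν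
  have i0 : Integrable (fun p : ℝ × ℝ => -Real.log (p.1 - p.2)) (ν.prod ν) := hl.neg
  have i3 : Integrable (fun p : ℝ × ℝ => -Real.log (p.1 - p.2) + 4 * (p.1 - 1 / 2) ^ 2)
    (ν.prod ν) := i0.add i1
  have i4 : Integrable (fun p : ℝ × ℝ => -Real.log (p.1 - p.2) + 4 * (p.1 - 1 / 2) ^ 2 +
    4 * (p.2 - 1 / 2) ^ 2) (ν.prod ν) := i3.add i2
  unfold lineKernel
  rw [integral_add i4 (integrable_const _), integral_add i3 i2, integral_add i0 i1,
    integral_neg, integral_fun_fst (μ := ν) (ν := ν) (fun x => 4 * (x - 1 / 2) ^ 2),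
    integral_fun_snd (μ := ν) (ν := ν) (fun x => 4 * (x - 1 / 2) ^ 2), mutualLog]
  simp
  ring

theorem integral_abs_log_sub_le (t : ℝ) :
    ∫ y, |Real.log (t - y)| ∂semicircleReal ≤
      2 * (|t| + 1) + (2 * Real.log 2 + 1 / 2) := by
  -- If `u ≤ A` and `0 ≤ A`, then `|u| ≤ 2A - u`; this reduces the absolute value to the potential
  -- and its lower bound.
  have h1 : ∫ y, |Real.log (t - y)| ∂semicircleReal ≤
      ∫ y, (2 * (|t| + 1) - Real.log (t - y)) ∂semicircleReal := by
    refine integral_mono_ae (integrable_log_sub t).abs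
      ((integrable_const _).sub (integrable_log_sub t)) ?_
    filter_upwards [ae_semicircleReal_mem_Icc] with y hy
    have h2 : Real.log (t - y) ≤ |t| + 1 := by
      rw [← Real.log_abs]
      refine (Real.log_le_self (abs_nonneg _)).trans ((abs_sub t y).trans ?_)
      have : |y| ≤ 1 := abs_le.2 ⟨by linarith [hy.1], hy.2⟩
      linarith
    have h3 := abs_nonneg t
    rcases le_total 0 (Real.log (t - y)) with h | h
    · rw [abs_of_nonneg h]
      linarith
    · rw [abs_of_nonpos h]
      linarith
  rw [integral_sub (integrable_const _) (integrable_log_sub t)] at h1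
  have h4 := le_semicirclePotential t
  rw [semicirclePotential] at h4
  simp at h1
  linarith

theorem ae_prod_semicircleReal_ne {ν : Measure ℝ} : ∀ᵐ p ∂ν.prod semicircleReal, p.1 ≠ p.2 := by
  have hms : MeasurableSet {p : ℝ × ℝ | p.1 ≠ p.2} :=
    (measurableSet_eq_fun measurable_fst measurable_snd).compl
  rw [Measure.ae_prod_iff_ae_ae hms]
  refine ae_of_all _ fun x => ?_
  filter_upwards [ae_semicircleReal_ne x] with y hy
  exact hy.symm

theorem integrable_abs_of_sq (hs : Integrable (fun x : ℝ => (x - 1 / 2) ^ 2) ν) :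
    Integrable (fun x : ℝ => |x|) ν := by
  refine Integrable.mono' (hs.add (integrable_const 1)) (by fun_prop) (ae_of_all _ fun x => ?_)
  rw [norm_abs_eq_norm, Real.norm_eq_abs, Pi.add_apply, abs_le]
  constructor <;> nlinarith [sq_nonneg (x - 1), sq_nonneg x]

theorem integrable_log_prod_semicircleReal
    (hs : Integrable (fun x : ℝ => (x - 1 / 2) ^ 2) ν) :
    Integrable (fun p : ℝ × ℝ => Real.log (p.1 - p.2)) (ν.prod semicircleReal) := by
  have hm : Measurable fun p : ℝ × ℝ => Real.log (p.1 - p.2) := Measurable.log (by fun_prop)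
  rw [integrable_prod_iff hm.aestronglyMeasurable]
  refine ⟨ae_of_all _ integrable_log_sub, ?_⟩
  refine Integrable.mono' ((((integrable_abs_of_sq hs).add (integrable_const 1)).const_mul 2).add
    (integrable_const (2 * Real.log 2 + 1 / 2)))
    (hm.norm.stronglyMeasurable.integral_prod_right').aestronglyMeasurable
    (ae_of_all _ fun x => ?_)
  rw [Real.norm_of_nonneg (integral_nonneg fun _ => norm_nonneg _)]
  exact integral_abs_log_sub_le x

theorem mutualLog_semicircleReal (hs : Integrable (fun x : ℝ => (x - 1 / 2) ^ 2) ν) :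
    Integrable semicirclePotential ν ∧ mutualLog ν semicircleReal = ∫ x, semicirclePotential x ∂ν :=
  ⟨(integrable_log_prod_semicircleReal hs).integral_prod_left,
    integral_prod _ (integrable_log_prod_semicircleReal hs)⟩

theorem integrable_sq_semicircleReal :
    Integrable (fun x : ℝ => (x - 1 / 2) ^ 2) semicircleReal :=
  integrable_semicircleReal_of_continuous (by fun_prop)

theorem mutualLog_semicircleReal_self :
    mutualLog semicircleReal semicircleReal = 1 / 4 - (2 * Real.log 2 + 1 / 2) := by
  have h : ∫ x, semicirclePotential x ∂semicircleReal =
      ∫ x, (4 * (x - 1 / 2) ^ 2 - (2 * Real.log 2 + 1 / 2)) ∂semicircleReal := by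
    refine integral_congr_ae ?_
    filter_upwards [ae_semicircleReal_mem_Icc] with x hx
    rw [semicirclePotential_of_mem hx]
    ring
  rw [(mutualLog_semicircleReal integrable_sq_semicircleReal).2, h,
    integral_sub (integrable_sq_semicircleReal.const_mul 4) (integrable_const _),
    integral_sq_semicircleReal]
  simp

/-- Positivity bounds the self-energy of `ν` from below by its mutual energy with the semicircle
law. The latter is controlled by the inequality for the potential, an equality on the support. Equal
energies make the positive form vanish. -/
theorem integral_lineKernel_semicircleReal_le (C : ℝ) (hne : ∀ᵐ p ∂ν.prod ν, p.1 ≠ p.2)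
    (hk : Integrable (lineKernel C) (ν.prod ν)) :
    ∫ p, lineKernel C p ∂(semicircleReal.prod semicircleReal) ≤
        ∫ p, lineKernel C p ∂(ν.prod ν) ∧
      (∫ p, lineKernel C p ∂(ν.prod ν) ≤
        ∫ p, lineKernel C p ∂(semicircleReal.prod semicircleReal) → ν = semicircleReal) := by
  have hs := integrable_sq_of_lineKernel hk
  have hl := integrable_log_of_lineKernel hk
  have hs₀ := integrable_sq_semicircleReal
  have hl₀ := integrable_log_prod_semicircleReal hs₀
  obtain ⟨hpos, heq⟩ := mutualLog_positive hne (ae_prod_semicircleReal_ne (ν := ν))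
    (ae_prod_semicircleReal_ne (ν := semicircleReal)) hl (integrable_log_prod_semicircleReal hs) hl₀
  obtain ⟨hUi, hU⟩ := mutualLog_semicircleReal hs
  have hUle : mutualLog ν semicircleReal ≤
      (∫ x, 4 * (x - 1 / 2) ^ 2 ∂ν) - (2 * Real.log 2 + 1 / 2) := by
    have h1 : ∫ x, semicirclePotential x ∂ν ≤
        ∫ x, (4 * (x - 1 / 2) ^ 2 - (2 * Real.log 2 + 1 / 2)) ∂ν :=
      integral_mono hUi ((hs.const_mul 4).sub (integrable_const _)) fun x =>
        (semicirclePotential_le x).trans (by linarith)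
    rw [integral_sub (hs.const_mul 4) (integrable_const _)] at h1
    rw [hU]
    simpa using h1
  have hself := mutualLog_semicircleReal_self
  rw [integral_lineKernel C hs hl, integral_lineKernel C hs₀ hl₀, integral_sq_semicircleReal]
  exact ⟨by linarith, fun h => heq (by linarith)⟩

theorem logEnergy_semicircleMeasure (hζ : ζ₁ ≠ ζ₂) {C : ℝ}
    (hC : C = -Real.log ‖ζ₂ - ζ₁‖ + 2 * (V.eval ((ζ₁ + ζ₂) / 2)).re) :
    logEnergy (quadraticPotential V ζ₁ ζ₂) (semicircleMeasure ζ₁ ζ₂) =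
      ((∫ p, lineKernel C p ∂(semicircleReal.prod semicircleReal) : ℝ) : EReal) := by
  have hs₀ := integrable_sq_semicircleReal
  rw [semicircleMeasure_eq_map]
  exact logEnergy_map_eq_integral hζ hC (ae_prod_semicircleReal_ne (ν := semicircleReal))
    (integrable_lineKernel C hs₀ (integrable_log_prod_semicircleReal hs₀))

theorem exists_eq_map_lineCurve (hζ : ζ₁ ≠ ζ₂) {ν : Measure ℂ} [IsProbabilityMeasure ν]
    (hν : ν (range (lineCurve ζ₁ ζ₂))ᶜ = 0) :
    ∃ μ : Measure ℝ, IsProbabilityMeasure μ ∧ ν = μ.map (lineCurve ζ₁ ζ₂) := by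
  have hme := measurableEmbedding_lineCurve hζ
  have h1 : ν = (ν.comap (lineCurve ζ₁ ζ₂)).map (lineCurve ζ₁ ζ₂) := by
    rw [hme.map_comap, Measure.restrict_eq_self_of_ae_mem]
    exact hν
  refine ⟨ν.comap (lineCurve ζ₁ ζ₂), ⟨?_⟩, h1⟩
  have h2 := congrArg (fun m : Measure ℂ => m univ) h1
  simp only [hme.map_apply, preimage_univ, measure_univ] at h2
  exact h2.symm

theorem logEnergy_semicircleMeasure_le (hζ : ζ₁ ≠ ζ₂) {ν : Measure ℂ} [IsProbabilityMeasure ν]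
    (hν : ν (range (lineCurve ζ₁ ζ₂))ᶜ = 0) :
    logEnergy (quadraticPotential V ζ₁ ζ₂) (semicircleMeasure ζ₁ ζ₂) ≤
        logEnergy (quadraticPotential V ζ₁ ζ₂) ν ∧
      (logEnergy (quadraticPotential V ζ₁ ζ₂) ν ≤
        logEnergy (quadraticPotential V ζ₁ ζ₂) (semicircleMeasure ζ₁ ζ₂) →
        ν = semicircleMeasure ζ₁ ζ₂) := by
  obtain ⟨μ, hμ, rfl⟩ := exists_eq_map_lineCurve hζ hν
  obtain ⟨C, hC⟩ : ∃ C : ℝ, C = -Real.log ‖ζ₂ - ζ₁‖ + 2 * (V.eval ((ζ₁ + ζ₂) / 2)).re := ⟨_, rfl⟩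
  -- Measures of infinite energy cannot compete, as the semicircle law has finite energy; for the
  -- others the energy is an honest integral.
  by_cases h : logEnergy (quadraticPotential V ζ₁ ζ₂) (μ.map (lineCurve ζ₁ ζ₂)) = ⊤
  · rw [h, logEnergy_semicircleMeasure hζ hC]
    exact ⟨le_top, fun h' => absurd (top_le_iff.1 h') (EReal.coe_ne_top _)⟩
  · obtain ⟨hne, hk⟩ := integrable_lineKernel_of_logEnergy_ne_top hζ hC h
    have hmain := integral_lineKernel_semicircleReal_le C hne hk
    rw [logEnergy_map_eq_integral hζ hC hne hk, logEnergy_semicircleMeasure hζ hC,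
      EReal.coe_le_coe_iff, EReal.coe_le_coe_iff]
    refine ⟨hmain.1, fun h' => ?_⟩
    rw [semicircleMeasure_eq_map, hmain.2 h']

theorem semicircleMeasure_compl_range (hζ : ζ₁ ≠ ζ₂) :
    semicircleMeasure ζ₁ ζ₂ (range (lineCurve ζ₁ ζ₂))ᶜ = 0 := by
  rw [semicircleMeasure_eq_map, (measurableEmbedding_lineCurve hζ).map_apply]
  simp [preimage_compl]

theorem isEquilibriumMeasure_iff (hζ : ζ₁ ≠ ζ₂) (V : Polynomial ℂ) (ν : Measure ℂ) :
    IsEquilibriumMeasure (range (lineCurve ζ₁ ζ₂)) (quadraticPotential V ζ₁ ζ₂) ν ↔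
      ν = semicircleMeasure ζ₁ ζ₂ := by
  have hprob : IsProbabilityMeasure (semicircleMeasure ζ₁ ζ₂) := by
    rw [semicircleMeasure_eq_map]
    exact Measure.isProbabilityMeasure_map (continuous_lineCurve ζ₁ ζ₂).aemeasurable
  constructor
  · intro h
    have := h.isProbabilityMeasure
    exact (logEnergy_semicircleMeasure_le hζ h.compl_null).2
      (h.le_energy _ hprob (semicircleMeasure_compl_range hζ))
  · rintro rfl
    exact ⟨hprob, semicircleMeasure_compl_range hζ,
      fun ν hν h => (logEnergy_semicircleMeasure_le hζ h).1⟩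

end Equilibrium

end SelbergExpansion

theorem mainTheorem7 (β : ℕ) (hβ : Even β) (hβ0 : 0 < β) (V : Polynomial ℂ)
    (ζ₁ ζ₂ : ℂ) (hζ : ζ₁ ≠ ζ₂) (lam : ℂ) (hlam : Complex.exp lam = ζ₂ - ζ₁) :
    (∀ ν : Measure ℂ,
      SelbergExpansion.IsEquilibriumMeasure (Set.range (SelbergExpansion.lineCurve ζ₁ ζ₂))
        (SelbergExpansion.quadraticPotential V ζ₁ ζ₂) ν ↔
      ν = SelbergExpansion.semicircleMeasure ζ₁ ζ₂) ∧
    (∀ N : ℕ, Integrable (SelbergExpansion.partitionIntegrand β N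
      (SelbergExpansion.quadraticPotential V ζ₁ ζ₂) (SelbergExpansion.lineCurve ζ₁ ζ₂))) ∧
    ∃ (E S : ℂ) (F : ℤ → ℂ) (lnZ : ℕ → ℂ),
      SelbergExpansion.HasComplexEnergy (SelbergExpansion.lineCurve ζ₁ ζ₂)
        (SelbergExpansion.lineLog ζ₁ ζ₂ lam) (SelbergExpansion.quadraticPotential V ζ₁ ζ₂)
        (SelbergExpansion.semicircleMeasure ζ₁ ζ₂) E ∧
      SelbergExpansion.HasLogDensityIntegral (SelbergExpansion.lineCurve ζ₁ ζ₂)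
        (SelbergExpansion.lineDensityLog ζ₁ ζ₂ lam)
        (SelbergExpansion.semicircleMeasure ζ₁ ζ₂) S ∧
      (∀ N : ℕ, 1 ≤ N → Complex.exp (lnZ N) =
        SelbergExpansion.partitionFunction β N (SelbergExpansion.quadraticPotential V ζ₁ ζ₂)
          (SelbergExpansion.lineCurve ζ₁ ζ₂)) ∧
      (∀ K : ℕ,
        (fun N : ℕ => lnZ N -
          ((β : ℂ) / 2 * (N : ℂ) * (Real.log N : ℂ) +
            (3 + (β : ℂ) / 2 + 2 / (β : ℂ)) / 12 * (Real.log N : ℂ) +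
            ∑ k ∈ Finset.Icc (-2 : ℤ) (K : ℤ), F k / (N : ℂ) ^ k))
        =O[atTop] (fun N : ℕ => (N : ℝ) ^ (-(K : ℤ) - 1))) ∧
      F (-2) = -((β : ℂ) / 2) * E ∧
      F (-1) = ((β : ℂ) / 2 - 1) * (S + (Real.log ((β : ℝ) / 2) : ℂ)) +
        (β : ℂ) / 2 * (Real.log (2 * Real.pi / Real.exp 1) : ℂ) -
        (Real.log (Real.Gamma ((β : ℝ) / 2)) : ℂ) := by
  obtain ⟨m, rfl⟩ := hβ
  rw [← two_mul]
  have hm : 1 ≤ m := by omega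
  refine ⟨SelbergExpansion.isEquilibriumMeasure_iff hζ V,
    SelbergExpansion.integrable_partitionIntegrand_lineCurve hζ hm, ?_⟩
  -- The two `rfl` fix `E` and `S` as the explicit values which the two lemmas below identify.
  obtain ⟨F, lnZ, h⟩ :=
    SelbergExpansion.exists_partitionFunction_expansion hm V hζ hlam rfl rfl
  exact ⟨_, _, F, lnZ, SelbergExpansion.hasComplexEnergy_semicircleMeasure hζ V lam,
    SelbergExpansion.hasLogDensityIntegral_semicircleMeasure hζ lam, h⟩
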